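/- **Problem and notation.** Consider $\min_{x\in\mathbb R^d} f(x)$ subject to $c(x)=0$, with $f:\mathbb R^d\to\mathbb R$, $c:\mathbb R^d\to\mathbb R^m$. Norms are Euclidean norms and operator norms. Write $G=\nabla c$ (Jacobian), $f_k=f(x_k)$, $g_k=\nabla f(x_k)$, $c_k=c(x_k)$, $G_k=G(x_k)$; let the columns of $Z_k$ be an orthonormal basis of $\ker G_k$. Put $\lambda_k=-[G_kG_k^T]^{-1}G_kg_k$, $\nabla\mathcal L_k=(g_k+G_k^T\lambda_k,\;c_k)$, let $\tau_k$ be the smallest eigenvalue of $Z_k^T\big(\nabla^2f(x_k)+\sum_i\lambda_k^i\nabla^2c^i(x_k)\big)Z_k$, and $\tau_k^+=|\min\{\tau_k,0\}|$ ($\tau_k^+=0$ if $\ker G_k=\{0\}$). **Algorithm TR-SQP-STORM.** Inputs: $\alpha\in\{0,1\}$ ($0$: first-order, $1$: second-order stationarity), $p_h,p_g,p_f,\eta\in(0,1)$, $\kappa_{fcd}\in(0,1]$, $r,\Delta_{\max},\kappa_h,\kappa_g>0$, $0<\kappa_f\le\frac{\kappa_{fcd}\eta^3}{16\max\{1,\Delta_{\max}\}}$,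 $\rho,\gamma>1$, deterministic $x_0\in\mathbb R^d$, $\Delta_0\in(0,\Delta_{\max})$, $\bar\epsilon_0,\bar\mu_0>0$. In iteration $k=0,1,\dots$: 1. Obtain $\bar g_k$; put $\bar\lambda_k=-[G_kG_k^T]^{-1}G_k\bar g_k$, $\bar\nabla_x\mathcal L_k=\bar g_k+G_k^T\bar\lambda_k$, $\bar\nabla\mathcal L_k=(\bar\nabla_x\mathcal L_k,c_k)$. If $\alpha=0$, choose any matrix $\bar H_k$ and put $\bar\tau_k^+=0$. If $\alpha=1$, obtain a symmetric $\bar\nabla^2f_k$, put $\bar H_k=\bar\nabla^2f_k+\sum_i\bar\lambda_k^i\nabla^2c^i(x_k)$ and $\bar\tau_k^+=|\min\{\bar\tau_k,0\}|$, with $\bar\tau_k$ the smallest eigenvalue of $Z_k^T\bar H_kZ_k$ ($\bar\tau_k^+=0$ if $\ker G_k=\{0\}$). 2. If $\max\{\|\bar\nabla\mathcal L_k\|/\max\{1,\|\bar H_k\|\},\bar\tau_k^+\}<\eta\Delta_k$, the iteration is unsuccessful: $x_{k+1}=x_k$, $\Delta_{k+1}=\Delta_k/\gamma$, $\bar\epsilon_{k+1}=\bar\epsilon_k/\gamma$,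 and $\bar\mu$ is unchanged. Otherwise let $q_k=\|\bar\nabla\mathcal L_k\|\min\{\Delta_k,\|\bar\nabla\mathcal L_k\|/\|\bar H_k\|\}$ and $e_k=\bar\tau_k^+\Delta_k(\Delta_k+\|c_k\|)$, and compute $\Delta x_k=w_k+Z_ku_k$ as follows. Let $a_k=\|c_k\|/\|G_k\|$; let $b_k=\|\bar\nabla_x\mathcal L_k\|/\|\bar H_k\|$ if $q_k\ge e_k$ (gradient step) and $b_k=\bar\tau_k^+/\|\bar H_k\|$ if $q_k<e_k$ (eigen step); $\breve\Delta_k=\frac{a_k}{\|(a_k,b_k)\|}\Delta_k$, $\tilde\Delta_k=\frac{b_k}{\|(a_k,b_k)\|}\Delta_k$; $v_k=-G_k^T[G_kG_k^T]^{-1}c_k$, $w_k=\min\{\breve\Delta_k/\|v_k\|,1\}v_k$. With $m(u)=\frac12(Z_ku)^T\bar H_kZ_ku+(\bar g_k+\bar H_kw_k)^TZ_ku$ and $y_k=\|Z_k^T(\bar g_k+\bar H_kw_k)\|$, $u_k$ is any vector with $\|u_k\|\le\tilde\Delta_k$ and, for a gradient step, $m(u_k)-m(0)\le-\frac{\kappa_{fcd}}2y_k\min\{\tilde\Delta_k,\,y_k/\|Z_k^T\bar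 H_kZ_k\|\}$; for an eigen step, $(\bar g_k+\bar H_kw_k)^TZ_ku_k\le0$ and $(Z_ku_k)^T\bar H_kZ_ku_k\le-\kappa_{fcd}\bar\tau_k^+\tilde\Delta_k^2$. (A quotient with zero denominator counts as $+\infty$ inside $\min\{\Delta_k,\cdot\}$ and $\min\{\tilde\Delta_k,\cdot\}$, and as $0$ elsewhere.) 3. Let $\mathrm{Pred}_k=\bar g_k^T\Delta x_k+\frac12\Delta x_k^T\bar H_k\Delta x_k+\bar\mu_k(\|c_k+G_k\Delta x_k\|-\|c_k\|)$ and multiply $\bar\mu_k$ by $\rho$ until $\mathrm{Pred}_k\le-\frac{\kappa_{fcd}}2\max\{q_k,e_k\}$ (below, $\bar\mu_k$ is the value after these updates; the next iteration starts from it). Obtain estimates $\bar f_k$ of $f(x_k)$ and $\bar f_{s_k}$ of $f(x_{s_k})$, $x_{s_k}=x_k+\Delta x_k$; let $\mathrm{Ared}_k=\bar f_{s_k}-\bar f_k+\bar\mu_k(\|c(x_{s_k})\|-\|c_k\|)$. 4. If $\mathrm{Ared}_k/\mathrm{Pred}_k<\eta$, $\alpha=1$ and $\|c_k\|\le r$,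 compute the second-order correction $d_k=-G_k^T[G_kG_k^T]^{-1}(c(x_k+\Delta x_k)-c_k-G_k\Delta x_k)$, replace the trial point by $x_{s_k}=x_k+\Delta x_k+d_k$, re-estimate $f(x_{s_k})$ by $\bar f'_{s_k}$, and recompute $\mathrm{Ared}_k$ with it. If (finally) $\mathrm{Ared}_k/\mathrm{Pred}_k\ge\eta$, put $x_{k+1}=x_{s_k}$, $\Delta_{k+1}=\min\{\gamma\Delta_k,\Delta_{\max}\}$, and $\bar\epsilon_{k+1}=\gamma\bar\epsilon_k$ if $-\mathrm{Pred}_k\ge\bar\epsilon_k$, $\bar\epsilon_{k+1}=\bar\epsilon_k/\gamma$ otherwise. Else $x_{k+1}=x_k$, $\Delta_{k+1}=\Delta_k/\gamma$, $\bar\epsilon_{k+1}=\bar\epsilon_k/\gamma$. **Random models.** All quantities live on a probability space. $(\mathcal F_{k-1})_{k\ge0}$ is a filtration and $\mathcal F_{k-0.5}\supseteq\mathcal F_{k-1}$ are $\sigma$-algebras such that $x_k,\Delta_k,\bar\epsilon_k$ and the value of $\bar\mu$ at the start of iteration $k$ are $\mathcal F_{k-1}$-measurable, and $\bar g_k,\bar\nabla^2f_k,\bar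 H_k,\Delta x_k,\bar\mu_k$ are $\mathcal F_{k-0.5}$-measurable. Almost surely, for all $k$: - if $\alpha=1$, $P(\|\bar\nabla^2f_k-\nabla^2f(x_k)\|\le\kappa_h\Delta_k\mid\mathcal F_{k-1})\ge1-p_h$; - $P(\|\bar g_k-g_k\|\le\kappa_g\Delta_k^{\alpha+1}\mid\mathcal F_{k-1})\ge1-p_g$; - in iterations that compute a trial step, conditionally on $\mathcal F_{k-0.5}$: with probability at least $1-p_f$ both $|\bar f_k-f_k|$ and $|\bar f_{s_k}-f(x_k+\Delta x_k)|$ are at most $\kappa_f\Delta_k^{\alpha+2}$, and their second moments are finite with conditional second moments at most $\bar\epsilon_k^2$; - with $S_k$ the event that the second-order correction is computed and $\delta_k=|\bar f'_{s_k}-f(x_k+\Delta x_k+d_k)|$: $P(S_k^c\cup\{\delta_k\le\kappa_f\Delta_k^{\alpha+2}\}\mid\mathcal F_{k-0.5})\ge1-p_f$, $\mathbb E[\mathbf 1_{S_k}\delta_k^2]<\infty$, and $\mathbb E[\mathbf 1_{S_k}\delta_k^2\mid\mathcal F_{k-0.5}]\le\bar\epsilon_k^2$. **Smoothness and boundedness.**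 There is an open convex set $D\subseteq\mathbb R^d$ that almost surely contains all iterates and all trial points $x_k+\Delta x_k$, $x_k+\Delta x_k+d_k$ that are computed. On $D$, $f$ and $c$ are twice continuously differentiable, $f\ge f_{\inf}$, and $\nabla f,\nabla^2f,G,\nabla^2c^i$ ($1\le i\le m$) are Lipschitz with constants $L_{\nabla f},L_{\nabla^2f},L_G,L_{\nabla^2c}$. There are constants $\kappa_c,\kappa_{\nabla f},\kappa_{1,G},\kappa_{2,G}>0$ such that almost surely, for all $k$, $\|c_k\|\le\kappa_c$, $\|g_k\|\le\kappa_{\nabla f}$, $\kappa_{1,G}I\preceq G_kG_k^T\preceq\kappa_{2,G}I$; and, if $\alpha=0$, $\|\bar H_k\|\le\kappa_B$ with a constant $\kappa_B\ge1$. **Merit parameter.** There is a deterministic $\hat\mu$ such that almost surely there is a (possibly random) $\bar K<\infty$ with $\bar\mu_k=\bar\mu_{\bar K}\le\hat\mu$ for all $k\ge\bar K$. **Constants.** If $\alpha=1$, put $\kappa_B=\max\big\{1,\;\kappa_h\Delta_{\max}+L_{\nabla f}+\frac{\sqrt m\,L_G}{\sqrt{\kappa_{1,G}}}(\kappa_g\Delta_{\max}^2+\kappa_{\nabla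 f})\big\}$. Let $M=\max\{1,\Delta_{\max}\}$, $\Upsilon_1=\kappa_gM+\frac12(L_{\nabla f}+\kappa_B+\hat\mu L_G)$, $$\Upsilon_3=\frac{3\kappa_{fcd}}8\max\Big\{\frac{\kappa_B}{\kappa_gM+\kappa_B},\;\frac{4\kappa_fM+8\Upsilon_1}{\{(1-\eta)\kappa_{fcd}\kappa_g+4\kappa_f\}M+8\Upsilon_1}\Big\},$$ and let $\nu\in(0,1)$ satisfy $\frac{\nu}{1-\nu}\ge\max\Big\{\frac{4\gamma^3M}{\min\{\eta^3\kappa_{fcd},\Upsilon_3\}},\frac{2\gamma}\eta\Big\}$. **Theorem (global first- and second-order convergence).** Under all of the above, if $$p_h+p_g+2p_f\le\frac{(1-\nu)^2}{16\nu^2}\Big(1-\frac1\gamma\Big)^2,$$ then $\liminf_{k\to\infty}\|\nabla\mathcal L_k\|=0$ almost surely, and, if $\alpha=1$, also $\liminf_{k\to\infty}\tau_k^+=0$ almost surely. -/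

import Mathlib

open MeasureTheory ProbabilityTheory Filter Topology

namespace TRSQP

noncomputable section

/-- `ℝⁿ` with the Euclidean norm; matrices are continuous linear maps with the operator norm. -/
abbrev Vec (n : ℕ) := EuclideanSpace ℝ (Fin n)

/-- The problem `min f(x)` subject to `c(x) = 0`. -/
structure Problem (d m : ℕ) where
  f : Vec d → ℝ
  c : Vec d → Vec m

/-- Hessian of a scalar function: the derivative of its gradient. -/
def hessian {d : ℕ} (h : Vec d → ℝ) (x : Vec d) : Vec d →L[ℝ] Vec d :=
  fderiv ℝ (fun y => gradient h y) x

namespace Problem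

variable {d m : ℕ} (P : Problem d m)

/-- `∇f(x)`. -/
def grad (x : Vec d) : Vec d := gradient P.f x

/-- `∇²f(x)`. -/
def hess (x : Vec d) : Vec d →L[ℝ] Vec d := hessian P.f x

/-- The Jacobian `G(x) = ∇c(x)`. -/
def jac (x : Vec d) : Vec d →L[ℝ] Vec m := fderiv ℝ P.c x

/-- `∇²cⁱ(x)`. -/
def hessC (i : Fin m) (x : Vec d) : Vec d →L[ℝ] Vec d := hessian (fun y => P.c y i) x

/-- `Q + ∑ᵢ λⁱ ∇²cⁱ(x)`, where `Q` is `∇²f(x)` or an estimate of it. -/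
def lagHess (Q : Vec d →L[ℝ] Vec d) (lam : Vec m) (x : Vec d) : Vec d →L[ℝ] Vec d :=
  Q + ∑ i, lam i • P.hessC i x

end Problem

section LinearAlgebra

variable {d m : ℕ}

/-- `[G Gᵀ]⁻¹`. -/
def gramInv (G : Vec d →L[ℝ] Vec m) : Vec m →L[ℝ] Vec m :=
  (G ∘L ContinuousLinearMap.adjoint G).inverse

/-- The multiplier `λ = -[G Gᵀ]⁻¹ G g`. -/
def multiplier (G : Vec d →L[ℝ] Vec m) (g : Vec d) : Vec m := -(gramInv G (G g))

/-- `∇ₓL = g + Gᵀ λ` with `λ = -[G Gᵀ]⁻¹ G g`. -/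
def lagGrad (G : Vec d →L[ℝ] Vec m) (g : Vec d) : Vec d :=
  g + ContinuousLinearMap.adjoint G (multiplier G g)

/-- Norm of a stacked pair of vectors, in terms of the two norms. -/
def pairNorm (a b : ℝ) : ℝ := Real.sqrt (a ^ 2 + b ^ 2)

/-- The KKT residual `‖∇L‖ = ‖(∇ₓL, c)‖`. -/
def kktNorm (G : Vec d →L[ℝ] Vec m) (g : Vec d) (c : Vec m) : ℝ :=
  pairNorm ‖lagGrad G g‖ ‖c‖

/-- The null space of `G`. -/
abbrev nullSpace (G : Vec d →L[ℝ] Vec m) : Submodule ℝ (Vec d) :=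
  LinearMap.ker (G : Vec d →ₗ[ℝ] Vec m)

/-- `Z`, with `ZᵀZ = I` and range `ker G`, realised as the inclusion of `ker G`; the reduced
variable `u ∈ ℝ^(d-m)` becomes an element of `ker G`. -/
def basisZ (G : Vec d →L[ℝ] Vec m) : nullSpace G →L[ℝ] Vec d := (nullSpace G).subtypeL

/-- `Zᵀ`. -/
def basisZT (G : Vec d →L[ℝ] Vec m) : Vec d →L[ℝ] nullSpace G :=
  ContinuousLinearMap.adjoint (basisZ G)

/-- `Zᵀ H Z`. -/
def reducedHess (G : Vec d →L[ℝ] Vec m) (H : Vec d →L[ℝ] Vec d) :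
    nullSpace G →L[ℝ] nullSpace G :=
  basisZT G ∘L H ∘L basisZ G

/-- The smallest eigenvalue of `Zᵀ H Z` (equal to `0` when `ker G` is trivial). -/
def minEig (G : Vec d →L[ℝ] Vec m) (H : Vec d →L[ℝ] Vec d) : ℝ :=
  sInf {t : ℝ | Module.End.HasEigenvalue
    (reducedHess G H : nullSpace G →ₗ[ℝ] nullSpace G) t}

/-- `τ⁺ = |min{τ, 0}|`. -/
def negPart (t : ℝ) : ℝ := |min t 0|

/-- `min{Δ, a / h}` for `h ≥ 0`, where a quotient with `h = 0` is read as `+∞`. -/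
def minQuot (Δ a h : ℝ) : ℝ := if h = 0 then Δ else min Δ (a / h)

/-- `v = -Gᵀ[G Gᵀ]⁻¹ c`. -/
def fullNormalStep (G : Vec d →L[ℝ] Vec m) (c : Vec m) : Vec d :=
  -(ContinuousLinearMap.adjoint G (gramInv G c))

/-- The normal step `w = γ̄ v` with `γ̄ = min{Δ̆ / ‖v‖, 1}`, for the radius `Δ̆`. -/
def normalStep (G : Vec d →L[ℝ] Vec m) (c : Vec m) (rad : ℝ) : Vec d :=
  min (rad / ‖fullNormalStep G c‖) 1 • fullNormalStep G c

/-- The share `a / ‖(a, b)‖ · Δ` of the radius. -/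
def share (a b Δ : ℝ) : ℝ := a / pairNorm a b * Δ

/-- The model `m(u) = ½ (Zu)ᵀ H (Zu) + (g + H w)ᵀ Z u`. -/
def tangModel (G : Vec d →L[ℝ] Vec m) (g : Vec d) (H : Vec d →L[ℝ] Vec d) (w : Vec d)
    (u : nullSpace G) : ℝ :=
  1 / 2 * inner ℝ (basisZ G u) (H (basisZ G u)) + inner ℝ (g + H w) (basisZ G u)

/-- `dx` is a gradient step: normal plus tangential step, the radius being split in proportion to
`‖c‖/‖G‖` and `‖∇ₓL‖/‖H‖`, with at least the fraction `κ` of the Cauchy reduction. -/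
def IsGradientStep (κ : ℝ) (G : Vec d →L[ℝ] Vec m) (c : Vec m) (g : Vec d)
    (H : Vec d →L[ℝ] Vec d) (Δ : ℝ) (dx : Vec d) : Prop :=
  let a := ‖c‖ / ‖G‖
  let b := ‖lagGrad G g‖ / ‖H‖
  let w := normalStep G c (share a b Δ)
  let y := ‖basisZT G (g + H w)‖
  ∃ u : nullSpace G, dx = w + basisZ G u ∧ ‖u‖ ≤ share b a Δ ∧
    tangModel G g H w u - tangModel G g H w 0 ≤
      -(κ / 2) * y * minQuot (share b a Δ) y ‖reducedHess G H‖

/-- `dx` is an eigen step: normal plus tangential step, the radius being split in proportion to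
`‖c‖/‖G‖` and `τ̄⁺/‖H‖`, with a curvature reduction along the tangential step. -/
def IsEigenStep (κ : ℝ) (G : Vec d →L[ℝ] Vec m) (c : Vec m) (g : Vec d)
    (H : Vec d →L[ℝ] Vec d) (tauPlus Δ : ℝ) (dx : Vec d) : Prop :=
  let a := ‖c‖ / ‖G‖
  let b := tauPlus / ‖H‖
  let w := normalStep G c (share a b Δ)
  ∃ u : nullSpace G, dx = w + basisZ G u ∧ inner ℝ (g + H w) (basisZ G u) ≤ 0 ∧
    ‖u‖ ≤ share b a Δ ∧
    inner ℝ (basisZ G u) (H (basisZ G u)) ≤ -κ * tauPlus * share b a Δ ^ 2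

end LinearAlgebra

/-- User-specified inputs of the algorithm. -/
structure Params (d : ℕ) where
  /-- `0` for first-order, `1` for second-order stationarity -/
  α : ℕ
  x0 : Vec d
  Δ0 : ℝ
  ε0 : ℝ
  mu0 : ℝ
  ph : ℝ
  pg : ℝ
  pf : ℝ
  η : ℝ
  κfcd : ℝ
  r : ℝ
  Δmax : ℝ
  κh : ℝ
  κg : ℝ
  κf : ℝ
  ρ : ℝ
  γ : ℝ

/-- The admissible ranges of the inputs. -/
structure Params.Valid {d : ℕ} (A : Params d) : Prop where
  α_mem : A.α = 0 ∨ A.α = 1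
  Δ0_mem : A.Δ0 ∈ Set.Ioo 0 A.Δmax
  ε0_pos : 0 < A.ε0
  mu0_pos : 0 < A.mu0
  ph_mem : A.ph ∈ Set.Ioo (0 : ℝ) 1
  pg_mem : A.pg ∈ Set.Ioo (0 : ℝ) 1
  pf_mem : A.pf ∈ Set.Ioo (0 : ℝ) 1
  η_mem : A.η ∈ Set.Ioo (0 : ℝ) 1
  κfcd_mem : A.κfcd ∈ Set.Ioc (0 : ℝ) 1
  r_pos : 0 < A.r
  Δmax_pos : 0 < A.Δmax
  κh_pos : 0 < A.κh
  κg_pos : 0 < A.κg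
  κf_pos : 0 < A.κf
  κf_le : A.κf ≤ A.κfcd * A.η ^ 3 / (16 * max 1 A.Δmax)
  ρ_gt : 1 < A.ρ
  γ_gt : 1 < A.γ

/-- All quantities produced along one realisation of the algorithm. -/
structure Path (d m : ℕ) where
  /-- iterates `x_k` -/
  x : ℕ → Vec d
  /-- trust-region radii `Δ_k` -/
  Δ : ℕ → ℝ
  /-- reliability parameters `ε̄_k` -/
  ε : ℕ → ℝ
  /-- merit parameters `μ̄_k`, after the update made in iteration `k` -/
  mu : ℕ → ℝ
  /-- gradient estimates `ḡ_k` -/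
  g : ℕ → Vec d
  /-- estimates of `∇²f(x_k)` (used only for `α = 1`) -/
  hess : ℕ → Vec d →L[ℝ] Vec d
  /-- the matrices `H̄_k` -/
  H : ℕ → Vec d →L[ℝ] Vec d
  /-- trial steps `Δx_k` -/
  dx : ℕ → Vec d
  /-- estimates of `f(x_k)` -/
  fk : ℕ → ℝ
  /-- estimates of `f(x_k + Δx_k)` -/
  fs : ℕ → ℝ
  /-- estimates of `f(x_k + Δx_k + d_k)`, made when the second-order correction is computed -/
  fsoc : ℕ → ℝ

namespace Path

variable {d m : ℕ} (P : Problem d m) (A : Params d) (R : Path d m) (k : ℕ)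

/-- `c_k`. -/
def cv : Vec m := P.c (R.x k)

/-- `G_k`. -/
def G : Vec d →L[ℝ] Vec m := P.jac (R.x k)

/-- The true KKT residual `‖∇L_k‖`, with multiplier `λ_k = -[G_k G_kᵀ]⁻¹ G_k ∇f(x_k)`. -/
def kkt : ℝ := kktNorm (R.G P k) (P.grad (R.x k)) (R.cv P k)

/-- The true `τ_k⁺`, from `Z_kᵀ ∇²ₓL_k Z_k`. -/
def tauPlus : ℝ :=
  negPart (minEig (R.G P k)
    (P.lagHess (P.hess (R.x k)) (multiplier (R.G P k) (P.grad (R.x k))) (R.x k)))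

/-- The estimated KKT residual. -/
def kktBar : ℝ := kktNorm (R.G P k) (R.g k) (R.cv P k)

/-- The estimate `τ̄_k⁺`, set to `0` for `α = 0`. -/
def tauBarPlus : ℝ := if A.α = 1 then negPart (minEig (R.G P k) (R.H k)) else 0

/-- The test that the radius is small relative to the estimated residuals. -/
def Acc : Prop :=
  A.η * R.Δ k ≤ max (R.kktBar P k / max 1 ‖R.H k‖) (R.tauBarPlus P A k)

/-- Reduction offered by the gradient step. -/
def gradRed : ℝ := R.kktBar P k * minQuot (R.Δ k) (R.kktBar P k) ‖R.H k‖

/-- Reduction offered by the eigen step. -/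
def eigRed : ℝ := R.tauBarPlus P A k * R.Δ k * (R.Δ k + ‖R.cv P k‖)

/-- `Pred_k` for the merit parameter `mu`. -/
def pred (mu : ℝ) : ℝ :=
  inner ℝ (R.g k) (R.dx k) + 1 / 2 * inner ℝ (R.dx k) (R.H k (R.dx k)) +
    mu * (‖R.cv P k + R.G P k (R.dx k)‖ - ‖R.cv P k‖)

/-- Sufficient predicted reduction for the merit parameter `mu`. -/
def PredOK (mu : ℝ) : Prop :=
  R.pred P k mu ≤ -(A.κfcd / 2) * max (R.gradRed P k) (R.eigRed P A k)

/-- Merit parameter at the start of iteration `k`. -/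
def muStart : ℕ → ℝ
  | 0 => A.mu0
  | j + 1 => R.mu j

/-- The second-order correction `d_k`. -/
def soc : Vec d :=
  -(ContinuousLinearMap.adjoint (R.G P k) (gramInv (R.G P k)
    (P.c (R.x k + R.dx k) - R.cv P k - R.G P k (R.dx k))))

/-- `Ared_k` for the trial point `xs` with function estimate `fs`. -/
def ared (xs : Vec d) (fs : ℝ) : ℝ :=
  fs - R.fk k + R.mu k * (‖P.c xs‖ - ‖R.cv P k‖)

/-- The trial point `x_k + Δx_k` passes the ratio test. -/
def Accept : Prop :=
  A.η ≤ R.ared P k (R.x k + R.dx k) (R.fs k) / R.pred P k (R.mu k)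

/-- The second-order correction is computed in iteration `k`. -/
def SocUsed : Prop :=
  R.Acc P A k ∧ ¬ R.Accept P A k ∧ A.α = 1 ∧ ‖R.cv P k‖ ≤ A.r

/-- The corrected trial point passes the ratio test. -/
def AcceptSoc : Prop :=
  A.η ≤ R.ared P k (R.x k + R.dx k + R.soc P k) (R.fsoc k) / R.pred P k (R.mu k)

/-- Iteration `k` is successful. -/
def Success : Prop :=
  R.Acc P A k ∧ (R.Accept P A k ∨ (R.SocUsed P A k ∧ R.AcceptSoc P A k))

/-- `R` is a realisation of TR-SQP-STORM for the problem `P` with inputs `A`. -/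
structure IsRun : Prop where
  x_zero : R.x 0 = A.x0
  Δ_zero : R.Δ 0 = A.Δ0
  ε_zero : R.ε 0 = A.ε0
  /-- for `α = 1`, `H̄_k` is the estimated Lagrangian Hessian -/
  hessian_eq : A.α = 1 → ∀ k, IsSelfAdjoint (R.hess k) ∧
    R.H k = P.lagHess (R.hess k) (multiplier (R.G P k) (R.g k)) (R.x k)
  gradient_step : ∀ k, R.Acc P A k → R.eigRed P A k ≤ R.gradRed P k →
    IsGradientStep A.κfcd (R.G P k) (R.cv P k) (R.g k) (R.H k) (R.Δ k) (R.dx k)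
  eigen_step : ∀ k, R.Acc P A k → ¬ R.eigRed P A k ≤ R.gradRed P k →
    IsEigenStep A.κfcd (R.G P k) (R.cv P k) (R.g k) (R.H k) (R.tauBarPlus P A k) (R.Δ k) (R.dx k)
  /-- the merit parameter is multiplied by `ρ` until the predicted reduction suffices -/
  merit_update : ∀ k, R.Acc P A k → ∃ j : ℕ, R.mu k = A.ρ ^ j * R.muStart A k ∧
    R.PredOK P A k (R.mu k) ∧ ∀ i < j, ¬ R.PredOK P A k (A.ρ ^ i * R.muStart A k)
  merit_keep : ∀ k, ¬ R.Acc P A k → R.mu k = R.muStart A k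
  x_accept : ∀ k, R.Acc P A k → R.Accept P A k → R.x (k + 1) = R.x k + R.dx k
  x_accept_soc : ∀ k, R.SocUsed P A k → R.AcceptSoc P A k →
    R.x (k + 1) = R.x k + R.dx k + R.soc P k
  Δ_success : ∀ k, R.Success P A k → R.Δ (k + 1) = min (A.γ * R.Δ k) A.Δmax
  ε_reliable : ∀ k, R.Success P A k → R.ε k ≤ -R.pred P k (R.mu k) →
    R.ε (k + 1) = A.γ * R.ε k
  ε_unreliable : ∀ k, R.Success P A k → ¬ R.ε k ≤ -R.pred P k (R.mu k) →
    R.ε (k + 1) = R.ε k / A.γ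
  unsuccessful : ∀ k, ¬ R.Success P A k →
    R.x (k + 1) = R.x k ∧ R.Δ (k + 1) = R.Δ k / A.γ ∧ R.ε (k + 1) = R.ε k / A.γ

end Path

/-- Constants of the smoothness and boundedness assumptions, and the bound `muHat` on the stabilised
merit parameter. -/
structure Consts where
  finf : ℝ
  /-- Lipschitz constant of `∇f` -/
  Lf : ℝ
  /-- Lipschitz constant of `∇²f` -/
  Lhf : ℝ
  /-- Lipschitz constant of `G` -/
  LG : ℝ
  /-- Lipschitz constant of each `∇²cⁱ` -/
  Lhc : ℝ
  κc : ℝ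
  κdf : ℝ
  κ1 : ℝ
  κ2 : ℝ
  /-- bound on `‖H̄_k‖` for `α = 0` -/
  κB : ℝ
  muHat : ℝ

structure Consts.Valid (C : Consts) : Prop where
  Lf_nonneg : 0 ≤ C.Lf
  Lhf_nonneg : 0 ≤ C.Lhf
  LG_nonneg : 0 ≤ C.LG
  Lhc_nonneg : 0 ≤ C.Lhc
  κc_pos : 0 < C.κc
  κdf_pos : 0 < C.κdf
  κ1_pos : 0 < C.κ1
  κ2_pos : 0 < C.κ2
  κB_ge : 1 ≤ C.κB

/-- Smoothness of the problem data over the open convex set `D`. -/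
structure Smooth {d m : ℕ} (P : Problem d m) (D : Set (Vec d)) (C : Consts) : Prop where
  isOpen : IsOpen D
  convex : Convex ℝ D
  f_contDiff : ContDiffOn ℝ 2 P.f D
  c_contDiff : ContDiffOn ℝ 2 P.c D
  f_bdd : ∀ x ∈ D, C.finf ≤ P.f x
  grad_lip : ∀ x ∈ D, ∀ y ∈ D, ‖P.grad x - P.grad y‖ ≤ C.Lf * ‖x - y‖
  hess_lip : ∀ x ∈ D, ∀ y ∈ D, ‖P.hess x - P.hess y‖ ≤ C.Lhf * ‖x - y‖
  jac_lip : ∀ x ∈ D, ∀ y ∈ D, ‖P.jac x - P.jac y‖ ≤ C.LG * ‖x - y‖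
  hessC_lip : ∀ i, ∀ x ∈ D, ∀ y ∈ D, ‖P.hessC i x - P.hessC i y‖ ≤ C.Lhc * ‖x - y‖

/-- `D` contains the iterates and trial points, and the problem data are bounded along the iterates;
for `α = 0` the matrices `H̄_k` are bounded. -/
structure BoundedAlong {d m : ℕ} (P : Problem d m) (A : Params d) (D : Set (Vec d)) (C : Consts)
    (R : Path d m) : Prop where
  x_mem : ∀ k, R.x k ∈ D
  trial_mem : ∀ k, R.Acc P A k → R.x k + R.dx k ∈ D
  soc_mem : ∀ k, R.SocUsed P A k → R.x k + R.dx k + R.soc P k ∈ D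
  c_bdd : ∀ k, ‖R.cv P k‖ ≤ C.κc
  grad_bdd : ∀ k, ‖P.grad (R.x k)‖ ≤ C.κdf
  gram_lower : ∀ k (y : Vec m),
    C.κ1 * ‖y‖ ^ 2 ≤ inner ℝ y (R.G P k (ContinuousLinearMap.adjoint (R.G P k) y))
  gram_upper : ∀ k (y : Vec m),
    inner ℝ y (R.G P k (ContinuousLinearMap.adjoint (R.G P k) y)) ≤ C.κ2 * ‖y‖ ^ 2
  H_bdd : A.α = 0 → ∀ k, ‖R.H k‖ ≤ C.κB

/-- The merit parameter is eventually constant, with value at most `muHat`. -/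
def MeritStabilizes {d m : ℕ} (C : Consts) (R : Path d m) : Prop :=
  ∃ K : ℕ, ∀ k, K ≤ k → R.mu k = R.mu K ∧ R.mu K ≤ C.muHat

section RandomModels

variable {d m : ℕ} {Ω : Type*} (P : Problem d m) (A : Params d) (run : Ω → Path d m) (k : ℕ)

/-- The Hessian estimate is accurate. -/
def eventA : Set Ω :=
  {ω | ‖(run ω).hess k - P.hess ((run ω).x k)‖ ≤ A.κh * (run ω).Δ k}

/-- The gradient estimate is accurate. -/
def eventB : Set Ω :=
  {ω | ‖(run ω).g k - P.grad ((run ω).x k)‖ ≤ A.κg * (run ω).Δ k ^ (A.α + 1)}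

/-- Error of the estimate of `f(x_k)`. -/
def errK (ω : Ω) : ℝ := |(run ω).fk k - P.f ((run ω).x k)|

/-- Error of the estimate of `f(x_k + Δx_k)`. -/
def errS (ω : Ω) : ℝ := |(run ω).fs k - P.f ((run ω).x k + (run ω).dx k)|

/-- Error of the estimate of `f(x_k + Δx_k + d_k)`. -/
def errSoc (ω : Ω) : ℝ :=
  |(run ω).fsoc k - P.f ((run ω).x k + (run ω).dx k + (run ω).soc P k)|

/-- Iterations in which a trial step is computed, hence `f` is estimated. -/
def trialSet : Set Ω := {ω | (run ω).Acc P A k}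

/-- Iterations in which the second-order correction is computed, hence `f` is re-estimated. -/
def socSet : Set Ω := {ω | (run ω).SocUsed P A k}

/-- The function estimates at `x_k` and `x_k + Δx_k` are accurate, if they are made. -/
def eventC : Set Ω :=
  {ω | (run ω).Acc P A k →
    max (errK P run k ω) (errS P run k ω) ≤ A.κf * (run ω).Δ k ^ (A.α + 2)}

/-- The function re-estimate at `x_k + Δx_k + d_k` is accurate, if it is made. -/
def eventC' : Set Ω :=
  {ω | (run ω).SocUsed P A k → errSoc P run k ω ≤ A.κf * (run ω).Δ k ^ (A.α + 2)}

/-- Random models. `ℱ k` is the information available before iteration `k`, and `𝒢 k` the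
information after the gradient and Hessian estimates of iteration `k` and the trial step have been
formed. Function estimates are constrained only in iterations that make them. -/
structure RandomModels [mΩ : MeasurableSpace Ω] (Pr : Measure Ω) (ℱ : Filtration ℕ mΩ)
    (𝒢 : ℕ → MeasurableSpace Ω) : Prop where
  le_mid : ∀ k, ℱ k ≤ 𝒢 k
  mid_le : ∀ k, 𝒢 k ≤ mΩ
  x_meas : ∀ k, StronglyMeasurable[ℱ k] fun ω => (run ω).x k
  Δ_meas : ∀ k, StronglyMeasurable[ℱ k] fun ω => (run ω).Δ k
  ε_meas : ∀ k, StronglyMeasurable[ℱ k] fun ω => (run ω).ε k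
  muStart_meas : ∀ k, StronglyMeasurable[ℱ k] fun ω => (run ω).muStart A k
  g_meas : ∀ k, StronglyMeasurable[𝒢 k] fun ω => (run ω).g k
  hess_meas : ∀ k, StronglyMeasurable[𝒢 k] fun ω => (run ω).hess k
  H_meas : ∀ k, StronglyMeasurable[𝒢 k] fun ω => (run ω).H k
  dx_meas : ∀ k, StronglyMeasurable[𝒢 k] fun ω => (run ω).dx k
  mu_meas : ∀ k, StronglyMeasurable[𝒢 k] fun ω => (run ω).mu k
  fk_meas : ∀ k, StronglyMeasurable fun ω => (run ω).fk k
  fs_meas : ∀ k, StronglyMeasurable fun ω => (run ω).fs k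
  fsoc_meas : ∀ k, StronglyMeasurable fun ω => (run ω).fsoc k
  /-- needed only for `α = 1` -/
  prob_A : A.α = 1 → ∀ k, ∀ᵐ ω ∂Pr,
    1 - A.ph ≤ (Pr[(eventA P A run k).indicator (fun _ => (1 : ℝ)) | ℱ k]) ω
  prob_B : ∀ k, ∀ᵐ ω ∂Pr,
    1 - A.pg ≤ (Pr[(eventB P A run k).indicator (fun _ => (1 : ℝ)) | ℱ k]) ω
  prob_C : ∀ k, ∀ᵐ ω ∂Pr,
    1 - A.pf ≤ (Pr[(eventC P A run k).indicator (fun _ => (1 : ℝ)) | 𝒢 k]) ω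
  prob_C' : ∀ k, ∀ᵐ ω ∂Pr,
    1 - A.pf ≤ (Pr[(eventC' P A run k).indicator (fun _ => (1 : ℝ)) | 𝒢 k]) ω
  integrable_errK : ∀ k,
    Integrable ((trialSet P A run k).indicator fun ω => errK P run k ω ^ 2) Pr
  integrable_errS : ∀ k,
    Integrable ((trialSet P A run k).indicator fun ω => errS P run k ω ^ 2) Pr
  integrable_errSoc : ∀ k,
    Integrable ((socSet P A run k).indicator fun ω => errSoc P run k ω ^ 2) Pr
  moment_errK : ∀ k, ∀ᵐ ω ∂Pr,
    (Pr[(trialSet P A run k).indicator (fun ω => errK P run k ω ^ 2) | 𝒢 k]) ω ≤ (run ω).ε k ^ 2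
  moment_errS : ∀ k, ∀ᵐ ω ∂Pr,
    (Pr[(trialSet P A run k).indicator (fun ω => errS P run k ω ^ 2) | 𝒢 k]) ω ≤ (run ω).ε k ^ 2
  moment_errSoc : ∀ k, ∀ᵐ ω ∂Pr,
    (Pr[(socSet P A run k).indicator (fun ω => errSoc P run k ω ^ 2) | 𝒢 k]) ω ≤ (run ω).ε k ^ 2

end RandomModels

section Constants

variable {d : ℕ} (A : Params d) (m : ℕ) (C : Consts)

/-- The bound on `‖H̄_k‖`: the assumed one for `α = 0`; for `α = 1` the one that holds whenever the
gradient and Hessian estimates are accurate. -/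
def kappaB : ℝ :=
  if A.α = 0 then C.κB
  else max 1 (A.κh * A.Δmax + C.Lf +
    Real.sqrt m * C.LG / Real.sqrt C.κ1 * (A.κg * A.Δmax ^ 2 + C.κdf))

/-- `Υ₁`. -/
def ups1 : ℝ :=
  A.κg * max 1 A.Δmax + 1 / 2 * (C.Lf + kappaB A m C + C.muHat * C.LG)

/-- `Υ₃`. -/
def ups3 : ℝ :=
  3 * A.κfcd / 8 *
    max (kappaB A m C / (A.κg * max 1 A.Δmax + kappaB A m C))
      ((4 * A.κf * max 1 A.Δmax + 8 * ups1 A m C) /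
        (((1 - A.η) * A.κfcd * A.κg + 4 * A.κf) * max 1 A.Δmax + 8 * ups1 A m C))

/-- The condition on the potential-function weight `ν`. -/
def NuCondition (ν : ℝ) : Prop :=
  max (4 * A.γ ^ 3 * max 1 A.Δmax / min (A.η ^ 3 * A.κfcd) (ups3 A m C)) (2 * A.γ / A.η) ≤
    ν / (1 - ν)

end Constants

end

end TRSQP

/-! With `β = (1 - ν) / ν`, two facts collide: the radius tends to zero almost surely, yet it cannot
do so along a path that eventually stays uniformly nonstationary.

Radius to zero. The potential `f - f_inf + μ‖c‖ + (β/4) Δ^(α+2) + β ε̄` decreases in every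
iteration, pathwise and with no accuracy assumed of the models, by `(1 - 1/γ)` times its last two
terms, up to the excess error of the function estimates (`Path.IsRun.potential_decrease`). On
success the merit decrease `¾ η |Pred|` pays for the growth of `Δ` and `ε̄`; on failure both shrink
by themselves. A conditional Cauchy–Schwarz inequality (`integral_indicator_compl_indicator_le`)
bounds the mean excess error by `3√p_f` times the mean of `ε̄`, and the `ε̄` part of the decrease
absorbs this because `3√p_f ≤ β (1 - 1/γ)`. Hence the means of `Δ^(α+2)` are summable. Since the
merit parameter settles only after a random time, this is done on the events `stableSet`, which over
countably many indices cover almost every path (`ae_tendsto_radius_zero`).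

Recurrence. At a point with KKT residual above `ε`, an accurate iteration with small radius promises
a reduction of order `Δ` against a model error of order `Δ²`, so it succeeds. At a point with
curvature below `-ε` the promise is of order `Δ` if `‖c‖ > r`; if `‖c‖ ≤ r` it is of order `Δ²`, and
the second-order correction lowers the error to order `Δ³`. All estimates are accurate with
conditional probability at least one half, so `log Δ` dominates `log γ` times a `±1` walk with
upward probability at least one half. That walk is a submartingale with bounded, non-vanishing
increments, hence unbounded above (`ae_not_bddAbove_walk`), whereas `Δ ≤ Δ_max`. Therefore the
nonstationary set is left infinitely often (`ae_not_eventually_mem`), and letting `ε` run through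
`1/(n+1)` gives both limits. -/

namespace TRSQP

/-! ### Projections, step lengths and the smallest reduced eigenvalue. -/

section LinearAlgebra

variable {d m : ℕ}

/-- Two-sided bounds `κ₁ I ≼ G Gᵀ ≼ κ₂ I` with `κ₁ > 0`. -/
structure GramBounds (κ₁ κ₂ : ℝ) (G : Vec d →L[ℝ] Vec m) : Prop where
  pos : 0 < κ₁
  lower : ∀ y : Vec m, κ₁ * ‖y‖ ^ 2 ≤ inner ℝ y (G (ContinuousLinearMap.adjoint G y))
  upper : ∀ y : Vec m, inner ℝ y (G (ContinuousLinearMap.adjoint G y)) ≤ κ₂ * ‖y‖ ^ 2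

theorem inner_gram (G : Vec d →L[ℝ] Vec m) (y : Vec m) :
    inner ℝ y (G (ContinuousLinearMap.adjoint G y)) = ‖ContinuousLinearMap.adjoint G y‖ ^ 2 := by
  rw [← ContinuousLinearMap.adjoint_inner_left, real_inner_self_eq_norm_sq]

theorem gram_gramInv_apply {G : Vec d →L[ℝ] Vec m}
    (h : (G ∘L ContinuousLinearMap.adjoint G).IsInvertible) (y : Vec m) :
    G (ContinuousLinearMap.adjoint G (gramInv G y)) = y := by
  obtain ⟨z, rfl⟩ := h.bijective.2 y
  exact congrArg (fun w => G (ContinuousLinearMap.adjoint G w)) (h.inverse_apply_self z)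

theorem jac_fullNormalStep {G : Vec d →L[ℝ] Vec m}
    (h : (G ∘L ContinuousLinearMap.adjoint G).IsInvertible) (c : Vec m) :
    G (fullNormalStep G c) = -c := by
  simp [fullNormalStep, gram_gramInv_apply h]

theorem jac_lagGrad {G : Vec d →L[ℝ] Vec m}
    (h : (G ∘L ContinuousLinearMap.adjoint G).IsInvertible) (g : Vec d) :
    G (lagGrad G g) = 0 := by
  simp [lagGrad, multiplier, gram_gramInv_apply h]

/-- `lagGrad G` is the projector onto `ker G`. Together with `jac_lagGrad` this parametrises a
varying kernel by fixed vectors, which is how `curvatureSet` is seen to be open. -/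
theorem lagGrad_of_ker {G : Vec d →L[ℝ] Vec m} {g : Vec d} (hg : G g = 0) : lagGrad G g = g := by
  simp [lagGrad, multiplier, hg]

theorem inner_gramInv_comm {G : Vec d →L[ℝ] Vec m}
    (h : (G ∘L ContinuousLinearMap.adjoint G).IsInvertible) (a b : Vec m) :
    inner ℝ (gramInv G a) b = inner ℝ a (gramInv G b) := by
  conv_lhs => rw [← gram_gramInv_apply h b]
  conv_rhs => rw [← gram_gramInv_apply h a]
  rw [← ContinuousLinearMap.adjoint_inner_left, ContinuousLinearMap.adjoint_inner_right]

/-- `gᵀ v = λᵀ c` for the full normal step `v = -Gᵀ[G Gᵀ]⁻¹ c`. -/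
theorem inner_fullNormalStep {G : Vec d →L[ℝ] Vec m}
    (h : (G ∘L ContinuousLinearMap.adjoint G).IsInvertible) (g : Vec d) (c : Vec m) :
    inner ℝ g (fullNormalStep G c) = inner ℝ (multiplier G g) c := by
  rw [fullNormalStep, multiplier, inner_neg_right, inner_neg_left, inner_gramInv_comm h,
    ContinuousLinearMap.adjoint_inner_right]

theorem multiplier_sub (G : Vec d →L[ℝ] Vec m) (g g' : Vec d) :
    multiplier G g - multiplier G g' = multiplier G (g - g') := by
  simp only [multiplier, map_sub]; abel

theorem lagGrad_sub (G : Vec d →L[ℝ] Vec m) (g g' : Vec d) :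
    lagGrad G g - lagGrad G g' = lagGrad G (g - g') := by
  simp only [lagGrad, ← multiplier_sub, map_sub]; abel

namespace GramBounds

variable {κ₁ κ₂ : ℝ} {G : Vec d →L[ℝ] Vec m}

theorem isInvertible (h : GramBounds κ₁ κ₂ G) :
    (G ∘L ContinuousLinearMap.adjoint G).IsInvertible := by
  have hinj : Function.Injective
      ((G ∘L ContinuousLinearMap.adjoint G : Vec m →L[ℝ] Vec m) : Vec m →ₗ[ℝ] Vec m) := by
    rw [← LinearMap.ker_eq_bot, LinearMap.ker_eq_bot']
    intro y hy
    have h1 := h.lower y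
    have h2 : G (ContinuousLinearMap.adjoint G y) = 0 := hy
    rw [h2, inner_zero_right] at h1
    have h3 : ‖y‖ ^ 2 ≤ 0 := by
      by_contra hc
      push Not at hc
      exact absurd (mul_pos h.pos hc) (not_lt.2 h1)
    simpa using h3
  exact ⟨(LinearEquiv.ofInjectiveEndo _ hinj).toContinuousLinearEquiv, by ext y; rfl⟩

theorem norm_gramInv_le (h : GramBounds κ₁ κ₂ G) (y : Vec m) :
    ‖gramInv G y‖ ≤ κ₁⁻¹ * ‖y‖ := by
  have h1 := h.lower (gramInv G y)
  rw [gram_gramInv_apply h.isInvertible] at h1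
  have h2 := real_inner_le_norm (gramInv G y) y
  rcases (norm_nonneg (gramInv G y)).eq_or_lt with h0 | h0
  · rw [← h0]; have := h.pos; positivity
  · rw [inv_mul_eq_div, le_div_iff₀ h.pos]
    nlinarith

theorem norm_adjoint_le (h : GramBounds κ₁ κ₂ G) : ‖ContinuousLinearMap.adjoint G‖ ≤ √κ₂ := by
  refine ContinuousLinearMap.opNorm_le_bound _ (Real.sqrt_nonneg _) fun y => ?_
  have h1 := h.upper y
  rw [inner_gram] at h1
  rcases le_or_gt 0 κ₂ with h2 | h2
  · refine (sq_le_sq₀ (norm_nonneg _) (by positivity)).1 ?_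
    rwa [mul_pow, Real.sq_sqrt h2]
  -- A negative `κ₂` is compatible with the bounds only if every `y` vanishes.
  · have h3 : ‖y‖ ^ 2 = 0 := by
      by_contra hc
      have : 0 < ‖y‖ ^ 2 := lt_of_le_of_ne (by positivity) (Ne.symm hc)
      nlinarith [sq_nonneg ‖ContinuousLinearMap.adjoint G y‖]
    have h4 : y = 0 := by simpa using h3
    simp [h4]

theorem norm_le (h : GramBounds κ₁ κ₂ G) : ‖G‖ ≤ √κ₂ := by
  have := h.norm_adjoint_le
  rwa [LinearIsometryEquiv.norm_map] at this

theorem norm_multiplier_le (h : GramBounds κ₁ κ₂ G) (g : Vec d) :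
    ‖multiplier G g‖ ≤ κ₁⁻¹ * √κ₂ * ‖g‖ := by
  rw [multiplier, norm_neg, mul_assoc]
  refine (h.norm_gramInv_le _).trans ?_
  have := h.pos
  gcongr
  exact (G.le_opNorm g).trans (by gcongr; exact h.norm_le)

theorem norm_lagGrad_le (h : GramBounds κ₁ κ₂ G) (g : Vec d) :
    ‖lagGrad G g‖ ≤ (1 + √κ₂ * (κ₁⁻¹ * √κ₂)) * ‖g‖ := by
  refine (norm_add_le _ _).trans ?_
  have h1 := (ContinuousLinearMap.adjoint G).le_opNorm (multiplier G g)
  have h2 : ‖ContinuousLinearMap.adjoint G‖ * ‖multiplier G g‖ ≤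
      √κ₂ * (κ₁⁻¹ * √κ₂ * ‖g‖) := by
    gcongr
    · exact h.norm_adjoint_le
    · exact h.norm_multiplier_le g
  linarith

theorem norm_fullNormalStep_le (h : GramBounds κ₁ κ₂ G) (c : Vec m) :
    ‖fullNormalStep G c‖ ≤ √κ₂ * κ₁⁻¹ * ‖c‖ := by
  rw [fullNormalStep, norm_neg]
  refine ((ContinuousLinearMap.adjoint G).le_opNorm _).trans ?_
  rw [mul_assoc]
  gcongr
  · exact h.norm_adjoint_le
  · exact h.norm_gramInv_le c

end GramBounds

theorem pairNorm_nonneg (a b : ℝ) : 0 ≤ pairNorm a b := Real.sqrt_nonneg _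

theorem le_pairNorm_left (a b : ℝ) : a ≤ pairNorm a b :=
  Real.le_sqrt_of_sq_le (by nlinarith [sq_nonneg b])

theorem pairNorm_sub_le (a b c : ℝ) : pairNorm a c ≤ pairNorm b c + |a - b| := by
  refine Real.sqrt_le_iff.2 ⟨by have := pairNorm_nonneg b c; positivity, ?_⟩
  have h1 : pairNorm b c ^ 2 = b ^ 2 + c ^ 2 := Real.sq_sqrt (by positivity)
  have h2 : |b| ≤ pairNorm b c := Real.abs_le_sqrt (by nlinarith [sq_nonneg c])
  have h3 : (a - b) * b ≤ |a - b| * |b| := by rw [← abs_mul]; exact le_abs_self _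
  nlinarith [sq_abs (a - b), mul_le_mul_of_nonneg_left h2 (abs_nonneg (a - b))]

/-- Only the first component of the residual depends on `g`, and it does so linearly; this transfers
a lower bound on the true residual to the estimated one. -/
theorem kktNorm_le_add {κ₁ κ₂ : ℝ} {G : Vec d →L[ℝ] Vec m} (h : GramBounds κ₁ κ₂ G)
    (g g' : Vec d) (c : Vec m) :
    kktNorm G g c ≤ kktNorm G g' c + (1 + √κ₂ * (κ₁⁻¹ * √κ₂)) * ‖g' - g‖ := by
  refine (pairNorm_sub_le _ ‖lagGrad G g'‖ _).trans (add_le_add le_rfl ?_)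
  refine (abs_norm_sub_norm_le (lagGrad G g) (lagGrad G g')).trans ?_
  rw [lagGrad_sub, norm_sub_rev g' g]
  exact h.norm_lagGrad_le _

theorem share_nonneg {a b Δ : ℝ} (ha : 0 ≤ a) (hΔ : 0 ≤ Δ) : 0 ≤ share a b Δ :=
  mul_nonneg (div_nonneg ha (pairNorm_nonneg _ _)) hΔ

theorem share_le {a b Δ : ℝ} (hΔ : 0 ≤ Δ) : share a b Δ ≤ Δ :=
  mul_le_of_le_one_left hΔ (div_le_one_of_le₀ (le_pairNorm_left a b) (pairNorm_nonneg a b))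

theorem norm_normalStep_le (G : Vec d →L[ℝ] Vec m) (c : Vec m) {rad : ℝ} (hr : 0 ≤ rad) :
    ‖normalStep G c rad‖ ≤ rad := by
  have h0 : 0 ≤ min (rad / ‖fullNormalStep G c‖) 1 := by positivity
  rw [normalStep, norm_smul, Real.norm_of_nonneg h0]
  rcases (norm_nonneg (fullNormalStep G c)).eq_or_lt with h | h
  · rw [← h]; simpa
  · calc _ ≤ rad / ‖fullNormalStep G c‖ * ‖fullNormalStep G c‖ := by gcongr; exact min_le_left _ _
      _ = rad := div_mul_cancel₀ _ h.ne'

/-- Each share of the radius is at most `Δ`. Orthogonality of the two components would give `Δ`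
instead of `2 * Δ`, but only the order in `Δ` matters. -/
theorem norm_step_le (G : Vec d →L[ℝ] Vec m) (c : Vec m) {a b Δ : ℝ} (ha : 0 ≤ a) (hΔ : 0 ≤ Δ)
    {u : nullSpace G} (hu : ‖u‖ ≤ share b a Δ) :
    ‖normalStep G c (share a b Δ) + basisZ G u‖ ≤ 2 * Δ := by
  refine (norm_add_le _ _).trans ?_
  have h1 := norm_normalStep_le G c (share_nonneg (b := b) ha hΔ)
  have h2 : ‖basisZ G u‖ = ‖u‖ := rfl
  have h3 := share_le (a := a) (b := b) hΔ
  have h4 := share_le (a := b) (b := a) hΔ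
  linarith

theorem IsGradientStep.norm_le {κ Δ : ℝ} {G : Vec d →L[ℝ] Vec m} {c : Vec m} {g dx : Vec d}
    {H : Vec d →L[ℝ] Vec d} (h : IsGradientStep κ G c g H Δ dx) (hΔ : 0 ≤ Δ) : ‖dx‖ ≤ 2 * Δ := by
  obtain ⟨u, rfl, hu, -⟩ := h
  exact norm_step_le G c (by positivity) hΔ hu

theorem IsEigenStep.norm_le {κ Δ t : ℝ} {G : Vec d →L[ℝ] Vec m} {c : Vec m} {g dx : Vec d}
    {H : Vec d →L[ℝ] Vec d} (h : IsEigenStep κ G c g H t Δ dx) (hΔ : 0 ≤ Δ) : ‖dx‖ ≤ 2 * Δ := by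
  obtain ⟨u, rfl, -, hu, -⟩ := h
  exact norm_step_le G c (by positivity) hΔ hu

theorem inner_reducedHess (G : Vec d →L[ℝ] Vec m) (H : Vec d →L[ℝ] Vec d) (u v : nullSpace G) :
    inner ℝ u (reducedHess G H v) = inner ℝ (u : Vec d) (H v) := by
  change inner ℝ u (ContinuousLinearMap.adjoint (basisZ G) (H (basisZ G v))) = _
  rw [ContinuousLinearMap.adjoint_inner_right]
  rfl

theorem negPart_nonneg (t : ℝ) : 0 ≤ negPart t := abs_nonneg _

theorem lt_negPart_iff {ε t : ℝ} (hε : 0 ≤ ε) : ε < negPart t ↔ t < -ε := by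
  rw [negPart, abs_of_nonpos (min_le_right _ _)]
  rcases le_total t 0 with h | h
  · rw [min_eq_left h]; constructor <;> intro <;> linarith
  · rw [min_eq_right h]; constructor <;> intro <;> linarith

/-- A sufficiently negative smallest eigenvalue produces a direction of negative curvature. -/
theorem exists_curvature_of_minEig_lt {G : Vec d →L[ℝ] Vec m} {H : Vec d →L[ℝ] Vec d} {ε : ℝ}
    (hε : 0 ≤ ε) (h : minEig G H < -ε) :
    ∃ u : Vec d, G u = 0 ∧ inner ℝ u (H u) < -ε * ‖u‖ ^ 2 := by
  -- With no eigenvalue, `sInf ∅ = 0` would contradict `minEig G H < -ε`. An eigenvector then serves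
  -- as the direction; symmetry of `H` plays no role.
  have hne : {t : ℝ | Module.End.HasEigenvalue
      (reducedHess G H : nullSpace G →ₗ[ℝ] nullSpace G) t}.Nonempty := by
    by_contra hc
    rw [Set.not_nonempty_iff_eq_empty] at hc
    rw [minEig, hc, Real.sInf_empty] at h
    linarith
  obtain ⟨t, ht, htε⟩ := exists_lt_of_csInf_lt hne h
  obtain ⟨u, hu⟩ := Module.End.HasEigenvalue.exists_hasEigenvector ht
  refine ⟨u, u.2, ?_⟩
  have h1 : reducedHess G H u = t • u := hu.apply_eq_smul
  have h2 : inner ℝ (u : Vec d) (H u) = t * ‖(u : Vec d)‖ ^ 2 := by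
    rw [← inner_reducedHess, h1]
    change inner ℝ (u : Vec d) (t • (u : Vec d)) = _
    rw [inner_smul_right, real_inner_self_eq_norm_sq]
  have h3 : 0 < ‖(u : Vec d)‖ := by
    have := hu.2
    exact norm_pos_iff.2 fun h0 => this (Subtype.ext h0)
  rw [h2]
  have : 0 < ‖(u : Vec d)‖ ^ 2 := by positivity
  nlinarith

/-- For symmetric `H`, the smallest eigenvalue bounds every Rayleigh quotient from below. -/
theorem minEig_mul_le {G : Vec d →L[ℝ] Vec m} {H : Vec d →L[ℝ] Vec d} (hH : IsSelfAdjoint H)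
    {u : Vec d} (hu : G u = 0) : minEig G H * ‖u‖ ^ 2 ≤ inner ℝ u (H u) := by
  rcases eq_or_ne u 0 with rfl | h0
  · simp
  let v : nullSpace G := ⟨u, hu⟩
  have hv : v ≠ 0 := fun h => h0 (congrArg Subtype.val h)
  have : Nontrivial (nullSpace G) := ⟨⟨v, 0, hv⟩⟩
  have hHs : ∀ a b : Vec d, inner ℝ (H a) b = inner ℝ a (H b) := hH.isSymmetric
  have hT : (reducedHess G H : nullSpace G →ₗ[ℝ] nullSpace G).IsSymmetric := by
    intro a b
    change inner ℝ (reducedHess G H a) b = inner ℝ a (reducedHess G H b)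
    rw [real_inner_comm, inner_reducedHess, inner_reducedHess, ← hHs, real_inner_comm]
  have hbd : ∀ a : { x : nullSpace G // x ≠ 0 }, -‖reducedHess G H‖ ≤
      RCLike.re (inner ℝ (reducedHess G H a) (a : nullSpace G)) / ‖(a : nullSpace G)‖ ^ 2 := by
    intro a
    have ha : 0 < ‖(a : nullSpace G)‖ := norm_pos_iff.2 a.2
    rw [le_div_iff₀ (by positivity)]
    have h1 := abs_real_inner_le_norm (reducedHess G H a) (a : nullSpace G)
    have h2 := (reducedHess G H).le_opNorm a
    have h3 := neg_abs_le (inner ℝ (reducedHess G H a) (a : nullSpace G))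
    simp only [RCLike.re_to_real]
    nlinarith
  -- The infimum of the Rayleigh quotient is itself an eigenvalue, so `minEig` is at most every
  -- Rayleigh quotient once the set of eigenvalues is known to be bounded below.
  have key := hT.hasEigenvalue_iInf_of_finiteDimensional
  have hbelow : BddBelow {t : ℝ | Module.End.HasEigenvalue
      (reducedHess G H : nullSpace G →ₗ[ℝ] nullSpace G) t} := by
    refine ⟨-‖reducedHess G H‖, fun t ht => ?_⟩
    obtain ⟨w, hw⟩ := Module.End.HasEigenvalue.exists_hasEigenvector ht
    have h1 := hbd ⟨w, hw.2⟩
    have h2 : reducedHess G H w = t • w := hw.apply_eq_smul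
    have h3 : ‖w‖ ≠ 0 := norm_ne_zero_iff.2 hw.2
    have h4 : inner ℝ (reducedHess G H w) w = t * ‖w‖ ^ 2 := by
      rw [h2]
      change inner ℝ (t • (w : Vec d)) (w : Vec d) = _
      rw [real_inner_smul_left, real_inner_self_eq_norm_sq]
      rfl
    simp only [RCLike.re_to_real, h4] at h1
    rwa [mul_div_cancel_right₀ _ (pow_ne_zero 2 h3)] at h1
  have h1 : minEig G H ≤ _ := csInf_le hbelow key
  have h2 := h1.trans (ciInf_le ⟨_, by rintro _ ⟨a, rfl⟩; exact hbd a⟩ ⟨v, hv⟩)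
  have h3 : 0 < ‖v‖ := norm_pos_iff.2 hv
  have h4 : minEig G H ≤ inner ℝ (reducedHess G H v) v / ‖v‖ ^ 2 := h2
  rw [le_div_iff₀ (by positivity), real_inner_comm, inner_reducedHess] at h4
  exact h4

end LinearAlgebra

/-! ### Taylor estimates and bounds on the derivatives. -/

section Smoothness

variable {d m : ℕ} {P : Problem d m} {D : Set (Vec d)} {C : Consts}

/-- First-order Taylor estimate for a map with Lipschitz derivative on a convex set. -/
theorem norm_taylor_one_le {E F : Type*} [NormedAddCommGroup E] [NormedSpace ℝ E]
    [NormedAddCommGroup F] [NormedSpace ℝ F] {D : Set E} (hD : Convex ℝ D) {h : E → F}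
    {h' : E → E →L[ℝ] F} {L : ℝ} (hL : 0 ≤ L)
    (hd : ∀ z ∈ D, HasFDerivAt h (h' z) z)
    (hlip : ∀ z ∈ D, ∀ y ∈ D, ‖h' z - h' y‖ ≤ L * ‖z - y‖) {x y : E} (hx : x ∈ D) (hy : y ∈ D) :
    ‖h y - h x - h' x (y - x)‖ ≤ L * ‖y - x‖ ^ 2 := by
  have hseg : segment ℝ x y ⊆ D := hD.segment_subset hx hy
  have := (convex_segment x y).norm_image_sub_le_of_norm_hasFDerivWithin_le'
    -- Mean value inequality with the derivative compared to its value at `x`; the sharper factor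
    -- `1/2` is not needed.
    (f := h) (f' := h') (φ := h' x) (C := L * ‖y - x‖)
    (fun z hz => (hd z (hseg hz)).hasFDerivWithinAt)
    (fun z hz => (hlip z (hseg hz) x hx).trans
      (by
        gcongr
        rw [← dist_eq_norm, ← dist_eq_norm, dist_comm z, dist_comm y]
        linarith [dist_add_dist_of_mem_segment hz, dist_nonneg (x := z) (y := y)]))
    (left_mem_segment ℝ x y) (right_mem_segment ℝ x y)
  refine this.trans (le_of_eq (by ring))

theorem inner_gradient_eq {h : Vec d → ℝ} (x v : Vec d) :
    inner ℝ (gradient h x) v = fderiv ℝ h x v := by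
  rw [gradient, InnerProductSpace.toDual_symm_apply]

theorem contDiffAt_gradient {h : Vec d → ℝ} {x : Vec d} (hh : ContDiffAt ℝ 2 h x) :
    ContDiffAt ℝ 1 (fun y => gradient h y) x :=
  ((InnerProductSpace.toDual ℝ (Vec d)).symm.contDiff.contDiffAt).comp x
    (hh.fderiv_right (m := 1) (by norm_num))

theorem hasFDerivAt_gradient {h : Vec d → ℝ} {x : Vec d} (hh : ContDiffAt ℝ 2 h x) :
    HasFDerivAt (fun y => gradient h y) (hessian h x) x :=
  ((contDiffAt_gradient hh).differentiableAt (by norm_num)).hasFDerivAt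

theorem inner_hessian_eq {h : Vec d → ℝ} {x : Vec d} (hh : ContDiffAt ℝ 2 h x) (u v : Vec d) :
    inner ℝ (hessian h x u) v = fderiv ℝ (fderiv ℝ h) x u v := by
  have h1 : HasFDerivAt (fderiv ℝ h) (fderiv ℝ (fderiv ℝ h) x) x :=
    ((hh.fderiv_right (m := 1) (by norm_num)).differentiableAt (by norm_num)).hasFDerivAt
  have h2 : HasFDerivAt (fun y => inner ℝ (gradient h y) v)
      ((innerSL ℝ v) ∘L hessian h x) x := by
    have := (innerSL ℝ v).hasFDerivAt.comp x (hasFDerivAt_gradient hh)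
    refine this.congr_of_eventuallyEq (Eventually.of_forall fun y => ?_)
    simp [real_inner_comm v]
  have h3 : HasFDerivAt (fun y => inner ℝ (gradient h y) v)
      ((ContinuousLinearMap.apply ℝ ℝ v) ∘L fderiv ℝ (fderiv ℝ h) x) x := by
    have := (ContinuousLinearMap.apply ℝ ℝ v).hasFDerivAt.comp x h1
    refine this.congr_of_eventuallyEq (Eventually.of_forall fun y => ?_)
    simp
  have h4 := congrArg (fun T : Vec d →L[ℝ] ℝ => T u) (h2.unique h3)
  simpa [real_inner_comm] using h4

/-- Symmetry of the second derivative, transported through the Riesz isomorphism. -/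
theorem inner_hessian_symm {h : Vec d → ℝ} {x : Vec d} (hh : ContDiffAt ℝ 2 h x) (u v : Vec d) :
    inner ℝ (hessian h x u) v = inner ℝ u (hessian h x v) := by
  rw [inner_hessian_eq hh, real_inner_comm, inner_hessian_eq hh]
  exact (hh.isSymmSndFDerivAt (by simp)) u v

theorem isSelfAdjoint_hessian {h : Vec d → ℝ} {x : Vec d} (hh : ContDiffAt ℝ 2 h x) :
    IsSelfAdjoint (hessian h x) := by
  rw [ContinuousLinearMap.isSelfAdjoint_iff_isSymmetric]
  exact fun u v => inner_hessian_symm hh u v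

/-- Second-order Taylor estimate for a function with Lipschitz Hessian on a convex set. -/
theorem abs_taylor_two_le {D : Set (Vec d)} (hD : Convex ℝ D) {h : Vec d → ℝ} {L : ℝ} (hL : 0 ≤ L)
    (hd : ∀ z ∈ D, ContDiffAt ℝ 2 h z)
    (hlip : ∀ z ∈ D, ∀ y ∈ D, ‖hessian h z - hessian h y‖ ≤ L * ‖z - y‖) {x y : Vec d}
    (hx : x ∈ D) (hy : y ∈ D) :
    |h y - h x - inner ℝ (gradient h x) (y - x) - 1 / 2 * inner ℝ (y - x) (hessian h x (y - x))| ≤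
      L * ‖y - x‖ ^ 3 := by
  set g := gradient h x
  set H := hessian h x
  -- The gradient of `φ`, the function minus its quadratic model, is the first-order Taylor
  -- remainder of `∇h`, of size at most `L ‖z - x‖²`; the mean value inequality supplies the third
  -- power.
  set φ : Vec d → ℝ := fun z => h z - inner ℝ g (z - x) - 1 / 2 * inner ℝ (z - x) (H (z - x))
  set φ' : Vec d → Vec d →L[ℝ] ℝ := fun z => innerSL ℝ (gradient h z - g - H (z - x))
  have hφ : ∀ z ∈ D, HasFDerivAt φ (φ' z) z := by
    intro z hz
    have h1 : HasFDerivAt h (fderiv ℝ h z) z :=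
      ((hd z hz).differentiableAt (by norm_num)).hasFDerivAt
    have h2 : HasFDerivAt (fun z : Vec d => z - x) (ContinuousLinearMap.id ℝ (Vec d)) z :=
      (hasFDerivAt_id z).sub_const x
    have h3 : HasFDerivAt (fun z : Vec d => H (z - x)) (H ∘L ContinuousLinearMap.id ℝ (Vec d)) z :=
      H.hasFDerivAt.comp z h2
    have h4 := (h1.sub ((innerSL ℝ g).hasFDerivAt.comp z h2)).sub
      ((h2.inner ℝ h3).const_mul (1 / 2))
    refine h4.congr_fderiv ?_
    ext v
    -- Symmetry of `H` makes `H (z - x)` the gradient of the quadratic term.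
    have hs : inner ℝ (H v) (z - x) = inner ℝ v (H (z - x)) := inner_hessian_symm (hd x hx) _ _
    simp only [φ', innerSL_apply_apply, inner_sub_left, inner_gradient_eq]
    simp [real_inner_comm] at hs ⊢
    rw [hs]
    ring
  have hseg : segment ℝ x y ⊆ D := hD.segment_subset hx hy
  have hb : ∀ z ∈ segment ℝ x y, ‖φ' z - 0‖ ≤ L * ‖y - x‖ ^ 2 := by
    intro z hz
    have hzx : ‖z - x‖ ≤ ‖y - x‖ := by
      rw [← dist_eq_norm, ← dist_eq_norm, dist_comm z, dist_comm y]
      linarith [dist_add_dist_of_mem_segment hz, dist_nonneg (x := z) (y := y)]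
    rw [sub_zero, innerSL_apply_norm]
    refine (norm_taylor_one_le hD hL (fun w hw => hasFDerivAt_gradient (hd w hw)) hlip hx
      (hseg hz)).trans ?_
    gcongr
  have := (convex_segment x y).norm_image_sub_le_of_norm_hasFDerivWithin_le'
    (f := φ) (f' := φ') (φ := 0) (C := L * ‖y - x‖ ^ 2)
    (fun z hz => (hφ z (hseg hz)).hasFDerivWithinAt) hb
    (left_mem_segment ℝ x y) (right_mem_segment ℝ x y)
  rw [Real.norm_eq_abs] at this
  refine le_trans (le_of_eq ?_) (this.trans (le_of_eq (by ring)))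
  congr 1
  simp [φ]
  ring

theorem norm_hessian_le {h : Vec d → ℝ} {L : ℝ} (hL : 0 ≤ L) (hD : IsOpen D)
    (hlip : ∀ z ∈ D, ∀ y ∈ D, ‖gradient h z - gradient h y‖ ≤ L * ‖z - y‖) {x : Vec d}
    (hx : x ∈ D) : ‖hessian h x‖ ≤ L :=
  norm_fderiv_le_of_lip' ℝ hL (by
    filter_upwards [hD.mem_nhds hx] with y hy using hlip y hy x hx)

namespace Smooth

theorem f_contDiffAt (hP : Smooth P D C) {x : Vec d} (hx : x ∈ D) : ContDiffAt ℝ 2 P.f x :=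
  hP.f_contDiff.contDiffAt (hP.isOpen.mem_nhds hx)

theorem c_contDiffAt (hP : Smooth P D C) {x : Vec d} (hx : x ∈ D) : ContDiffAt ℝ 2 P.c x :=
  hP.c_contDiff.contDiffAt (hP.isOpen.mem_nhds hx)

theorem ci_contDiffAt (hP : Smooth P D C) (i : Fin m) {x : Vec d} (hx : x ∈ D) :
    ContDiffAt ℝ 2 (fun y => P.c y i) x :=
  contDiffAt_euclidean.1 (hP.c_contDiffAt hx) i

theorem hasFDerivAt_c (hP : Smooth P D C) {x : Vec d} (hx : x ∈ D) :
    HasFDerivAt P.c (P.jac x) x :=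
  ((hP.c_contDiffAt hx).differentiableAt (by norm_num)).hasFDerivAt

theorem inner_gradient_ci (hP : Smooth P D C) (i : Fin m) {x : Vec d} (hx : x ∈ D) (v : Vec d) :
    inner ℝ (gradient (fun y => P.c y i) x) v = P.jac x v i := by
  rw [inner_gradient_eq]
  have := (EuclideanSpace.proj (𝕜 := ℝ) i).hasFDerivAt.comp x (hP.hasFDerivAt_c hx)
  have h2 : HasFDerivAt (fun y => P.c y i) ((EuclideanSpace.proj (𝕜 := ℝ) i) ∘L P.jac x) x := this
  rw [h2.fderiv]
  rfl

theorem gradient_ci_lip (hP : Smooth P D C) (i : Fin m) :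
    ∀ x ∈ D, ∀ y ∈ D, ‖gradient (fun y => P.c y i) x - gradient (fun y => P.c y i) y‖ ≤
      C.LG * ‖x - y‖ := by
  intro x hx y hy
  refine le_trans ?_ (hP.jac_lip x hx y hy)
  set w := gradient (fun y => P.c y i) x - gradient (fun y => P.c y i) y
  rcases (norm_nonneg w).eq_or_lt with h0 | h0
  · rw [← h0]; exact norm_nonneg _
  -- Testing the difference `w` of the two gradients against itself produces the `i`-th entry of
  -- `(P.jac x - P.jac y) w`.
  have h1 : ‖w‖ * ‖w‖ = (P.jac x - P.jac y) w i := by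
    rw [← real_inner_self_eq_norm_mul_norm, inner_sub_left, hP.inner_gradient_ci i hx,
      hP.inner_gradient_ci i hy]
    rfl
  have h2 : (P.jac x - P.jac y) w i ≤ ‖(P.jac x - P.jac y) w‖ :=
    (Real.le_norm_self _).trans (PiLp.norm_apply_le _ i)
  have h3 := (P.jac x - P.jac y).le_opNorm w
  nlinarith

theorem isSelfAdjoint_hessC (hP : Smooth P D C) (i : Fin m) {x : Vec d} (hx : x ∈ D) :
    IsSelfAdjoint (P.hessC i x) :=
  isSelfAdjoint_hessian (hP.ci_contDiffAt i hx)

theorem norm_hess_le (hP : Smooth P D C) (hC : C.Valid) {x : Vec d} (hx : x ∈ D) :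
    ‖P.hess x‖ ≤ C.Lf :=
  norm_hessian_le hC.Lf_nonneg hP.isOpen hP.grad_lip hx

theorem norm_hessC_le (hP : Smooth P D C) (hC : C.Valid) (i : Fin m) {x : Vec d} (hx : x ∈ D) :
    ‖P.hessC i x‖ ≤ C.LG :=
  norm_hessian_le hC.LG_nonneg hP.isOpen (hP.gradient_ci_lip i) hx

theorem taylor_f (hP : Smooth P D C) (hC : C.Valid) {x s : Vec d} (hx : x ∈ D) (hs : x + s ∈ D) :
    |P.f (x + s) - P.f x - inner ℝ (P.grad x) s| ≤ C.Lf * ‖s‖ ^ 2 := by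
  have := norm_taylor_one_le hP.convex (h := P.f) (h' := fun z => innerSL ℝ (P.grad z))
    hC.Lf_nonneg
    (fun z hz => by
      refine ((hP.f_contDiffAt hz).differentiableAt (by norm_num)).hasFDerivAt.congr_fderiv ?_
      ext v
      exact (inner_gradient_eq z v).symm)
    (fun z hz y hy => by
      rw [← map_sub, innerSL_apply_norm]; exact hP.grad_lip z hz y hy) hx hs
  simpa using this

theorem taylor_c (hP : Smooth P D C) (hC : C.Valid) {x s : Vec d} (hx : x ∈ D) (hs : x + s ∈ D) :
    ‖P.c (x + s) - P.c x - P.jac x s‖ ≤ C.LG * ‖s‖ ^ 2 := by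
  simpa using norm_taylor_one_le hP.convex hC.LG_nonneg (fun z hz => hP.hasFDerivAt_c hz)
    hP.jac_lip hx hs

theorem taylor_f_two (hP : Smooth P D C) (hC : C.Valid) {x s : Vec d} (hx : x ∈ D)
    (hs : x + s ∈ D) :
    |P.f (x + s) - P.f x - inner ℝ (P.grad x) s - 1 / 2 * inner ℝ s (P.hess x s)| ≤
      C.Lhf * ‖s‖ ^ 3 := by
  have := abs_taylor_two_le hP.convex hC.Lhf_nonneg (fun z hz => hP.f_contDiffAt hz)
    hP.hess_lip hx hs
  rwa [add_sub_cancel_left] at this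

theorem taylor_c_two (hP : Smooth P D C) (hC : C.Valid) {x s : Vec d} (hx : x ∈ D)
    (hs : x + s ∈ D) (i : Fin m) :
    |(P.c (x + s) - P.c x - P.jac x s) i - 1 / 2 * inner ℝ s (P.hessC i x s)| ≤
      C.Lhc * ‖s‖ ^ 3 := by
  have := abs_taylor_two_le hP.convex hC.Lhc_nonneg (fun z hz => hP.ci_contDiffAt i hz)
    (hP.hessC_lip i) hx hs
  rwa [add_sub_cancel_left, hP.inner_gradient_ci i hx] at this

end Smooth

end Smoothness

/-! ### Deterministic facts along one realisation. -/

section PathFacts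

variable {d m : ℕ} {P : Problem d m} {A : Params d} {D : Set (Vec d)} {C : Consts} {R : Path d m}

theorem BoundedAlong.gramBounds (hb : BoundedAlong P A D C R) (hC : C.Valid) (k : ℕ) :
    GramBounds C.κ1 C.κ2 (R.G P k) :=
  ⟨hC.κ1_pos, hb.gram_lower k, hb.gram_upper k⟩

theorem Params.Valid.γ_pos (hA : A.Valid) : 0 < A.γ := zero_lt_one.trans hA.γ_gt

/-- Since `α ≤ 1`, the surplus factor `Δ ^ α` is at most `max 1 Δmax`; this treats both orders of
stationarity at once. -/
theorem Params.Valid.pow_add_le (hA : A.Valid) {Δ : ℝ} (h0 : 0 ≤ Δ) (h1 : Δ ≤ A.Δmax) (n : ℕ) :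
    Δ ^ (A.α + n) ≤ max 1 A.Δmax * Δ ^ n := by
  rw [pow_add]
  gcongr
  rcases hA.α_mem with h | h <;> rw [h]
  · simp
  · simpa using Or.inr h1

namespace Path

/-- All estimates made in iteration `k` meet their accuracy requirements. -/
structure Accurate (P : Problem d m) (A : Params d) (R : Path d m) (k : ℕ) : Prop where
  hess : A.α = 1 → ‖R.hess k - P.hess (R.x k)‖ ≤ A.κh * R.Δ k
  grad : ‖R.g k - P.grad (R.x k)‖ ≤ A.κg * R.Δ k ^ (A.α + 1)
  est : R.Acc P A k → max |R.fk k - P.f (R.x k)| |R.fs k - P.f (R.x k + R.dx k)| ≤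
    A.κf * R.Δ k ^ (A.α + 2)
  soc : R.SocUsed P A k → |R.fsoc k - P.f (R.x k + R.dx k + R.soc P k)| ≤
    A.κf * R.Δ k ^ (A.α + 2)

namespace IsRun

theorem Δ_mem (hR : R.IsRun P A) (hA : A.Valid) (k : ℕ) : 0 < R.Δ k ∧ R.Δ k ≤ A.Δmax := by
  induction k with
  | zero => rw [hR.Δ_zero]; exact ⟨hA.Δ0_mem.1, hA.Δ0_mem.2.le⟩
  | succ k ih =>
    by_cases hs : R.Success P A k
    · rw [hR.Δ_success k hs]
      exact ⟨lt_min (mul_pos hA.γ_pos ih.1) hA.Δmax_pos, min_le_right _ _⟩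
    · rw [(hR.unsuccessful k hs).2.1]
      exact ⟨div_pos ih.1 hA.γ_pos, (div_le_self ih.1.le hA.γ_gt.le).trans ih.2⟩

/-- A lost iteration costs at most `log γ` in `log Δ`: the downward step of the comparison walk. -/
theorem Δ_div_le (hR : R.IsRun P A) (hA : A.Valid) (k : ℕ) : R.Δ k / A.γ ≤ R.Δ (k + 1) := by
  have h := hR.Δ_mem hA k
  by_cases hs : R.Success P A k
  · rw [hR.Δ_success k hs]
    have h1 : R.Δ k / A.γ ≤ R.Δ k := div_le_self h.1.le hA.γ_gt.le
    exact le_min (h1.trans (le_mul_of_one_le_left h.1.le hA.γ_gt.le)) (h1.trans h.2)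
  · rw [(hR.unsuccessful k hs).2.1]

theorem ε_cases (hR : R.IsRun P A) (k : ℕ) :
    R.ε (k + 1) = A.γ * R.ε k ∨ R.ε (k + 1) = R.ε k / A.γ := by
  by_cases hs : R.Success P A k
  · by_cases hr : R.ε k ≤ -R.pred P k (R.mu k)
    · exact Or.inl (hR.ε_reliable k hs hr)
    · exact Or.inr (hR.ε_unreliable k hs hr)
  · exact Or.inr (hR.unsuccessful k hs).2.2

/-- Deterministic two-sided bounds make `ε̄_k` integrable, and the weights in the conditional
Cauchy–Schwarz inequality bounded. -/
theorem ε_mem (hR : R.IsRun P A) (hA : A.Valid) (k : ℕ) :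
    A.ε0 / A.γ ^ k ≤ R.ε k ∧ R.ε k ≤ A.ε0 * A.γ ^ k := by
  have hγ := hA.γ_pos
  have h0 := hA.ε0_pos
  induction k with
  | zero => simp [hR.ε_zero]
  | succ k ih =>
    have hpos : 0 < R.ε k := lt_of_lt_of_le (by positivity) ih.1
    have h1 : R.ε k / A.γ ≤ A.γ * R.ε k :=
      (div_le_self hpos.le hA.γ_gt.le).trans (le_mul_of_one_le_left hpos.le hA.γ_gt.le)
    have h2 : A.ε0 / A.γ ^ (k + 1) ≤ R.ε k / A.γ := by
      rw [pow_succ, ← div_div]; gcongr; exact ih.1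
    have h3 : A.γ * R.ε k ≤ A.ε0 * A.γ ^ (k + 1) := by
      calc A.γ * R.ε k ≤ A.γ * (A.ε0 * A.γ ^ k) := by gcongr; exact ih.2
        _ = _ := by ring
    rcases hR.ε_cases k with h | h <;> rw [h]
    · exact ⟨h2.trans h1, h3⟩
    · exact ⟨h2, h1.trans h3⟩

theorem ε_pos (hR : R.IsRun P A) (hA : A.Valid) (k : ℕ) : 0 < R.ε k :=
  lt_of_lt_of_le (div_pos hA.ε0_pos (pow_pos hA.γ_pos k)) (hR.ε_mem hA k).1

theorem mu_pos (hR : R.IsRun P A) (hA : A.Valid) (k : ℕ) : 0 < R.mu k := by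
  have hρ : 0 < A.ρ := zero_lt_one.trans hA.ρ_gt
  have step : ∀ k, 0 < R.muStart A k → 0 < R.mu k := by
    intro k hk
    by_cases h : R.Acc P A k
    · obtain ⟨j, hj, -⟩ := hR.merit_update k h
      rw [hj]; positivity
    · rwa [hR.merit_keep k h]
  induction k with
  | zero => exact step 0 hA.mu0_pos
  | succ k ih => exact step (k + 1) ih

theorem norm_dx_le (hR : R.IsRun P A) (hA : A.Valid) {k : ℕ} (h : R.Acc P A k) :
    ‖R.dx k‖ ≤ 2 * R.Δ k := by
  by_cases he : R.eigRed P A k ≤ R.gradRed P k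
  · exact (hR.gradient_step k h he).norm_le (hR.Δ_mem hA k).1.le
  · exact (hR.eigen_step k h he).norm_le (hR.Δ_mem hA k).1.le

theorem pred_le (hR : R.IsRun P A) {k : ℕ} (h : R.Acc P A k) :
    R.pred P k (R.mu k) ≤ -(A.κfcd / 2) * max (R.gradRed P k) (R.eigRed P A k) := by
  obtain ⟨j, -, h, -⟩ := hR.merit_update k h
  exact h

end IsRun

theorem kktBar_nonneg (k : ℕ) : 0 ≤ R.kktBar P k := pairNorm_nonneg _ _

theorem tauBarPlus_nonneg (k : ℕ) : 0 ≤ R.tauBarPlus P A k := by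
  unfold tauBarPlus; split_ifs
  · exact negPart_nonneg _
  · exact le_rfl

/-- If the estimated KKT residual is at least `t max{1,‖H̄‖}`, with `t ≤ Δ`, then the gradient step
offers a reduction of at least `t ‖∇̄L‖`. -/
theorem le_gradRed {k : ℕ} {t : ℝ} (ht : t ≤ R.Δ k)
    (h : t ≤ R.kktBar P k / max 1 ‖R.H k‖) : R.kktBar P k * t ≤ R.gradRed P k := by
  refine mul_le_mul_of_nonneg_left ?_ (kktBar_nonneg k)
  unfold minQuot
  split_ifs with h0
  · exact ht
  · refine le_min ht (h.trans ?_)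
    have : 0 < ‖R.H k‖ := lt_of_le_of_ne (norm_nonneg _) (Ne.symm h0)
    have := kktBar_nonneg (P := P) (R := R) k
    gcongr
    exact le_max_right _ _

theorem le_eigRed {k : ℕ} (h : 0 ≤ R.Δ k) :
    R.tauBarPlus P A k * R.Δ k ^ 2 ≤ R.eigRed P A k := by
  have h1 := tauBarPlus_nonneg (P := P) (A := A) (R := R) k
  have h2 : R.eigRed P A k = R.tauBarPlus P A k * R.Δ k ^ 2 +
      R.tauBarPlus P A k * R.Δ k * ‖R.cv P k‖ := by unfold eigRed; ring
  rw [h2]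
  have : 0 ≤ R.tauBarPlus P A k * R.Δ k * ‖R.cv P k‖ := by positivity
  linarith

/-- In iterations that compute a trial step, the offered reduction is at least of order
`Δ^(α+2)`. -/
theorem IsRun.le_max_red (hR : R.IsRun P A) (hA : A.Valid) {k : ℕ} (h : R.Acc P A k) :
    A.η ^ 2 / max 1 A.Δmax * R.Δ k ^ (A.α + 2) ≤ max (R.gradRed P k) (R.eigRed P A k) := by
  obtain ⟨h0, h1⟩ := hR.Δ_mem hA k
  obtain ⟨hη0, hη1⟩ := hA.η_mem
  have hM : 0 < max 1 A.Δmax := by positivity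
  rcases le_max_iff.1 h with h | h
  · refine le_max_of_le_left (le_trans ?_ (le_gradRed ?_ h))
    · have h2 := hA.pow_add_le h0.le h1 2
      -- The test bounds both factors of the gradient reduction below by `η Δ`: the residual itself
      -- and, through `le_gradRed`, the minimum.
      have h3 : A.η * R.Δ k ≤ R.kktBar P k :=
        h.trans (div_le_self (kktBar_nonneg k) (le_max_left _ _))
      calc A.η ^ 2 / max 1 A.Δmax * R.Δ k ^ (A.α + 2)
          ≤ A.η ^ 2 / max 1 A.Δmax * (max 1 A.Δmax * R.Δ k ^ 2) := by gcongr
        _ = (A.η * R.Δ k) * (A.η * R.Δ k) := by field_simp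
        _ ≤ _ := by gcongr
    · nlinarith
  · have hα : A.α = 1 := by
      by_contra hα
      rw [tauBarPlus, if_neg hα] at h
      nlinarith
    refine le_max_of_le_right (le_trans ?_ (le_eigRed h0.le))
    have h4 : A.η ^ 2 / max 1 A.Δmax ≤ A.η := by
      rw [div_le_iff₀ hM]
      nlinarith [le_max_left 1 A.Δmax]
    calc A.η ^ 2 / max 1 A.Δmax * R.Δ k ^ (A.α + 2) ≤ A.η * R.Δ k ^ (A.α + 2) := by gcongr
      _ = A.η * R.Δ k * R.Δ k ^ 2 := by rw [hα]; ring
      _ ≤ _ := by gcongr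

theorem IsRun.pred_le_pow (hR : R.IsRun P A) (hA : A.Valid) {k : ℕ} (h : R.Acc P A k) :
    R.pred P k (R.mu k) ≤
      -(A.κfcd / 2 * (A.η ^ 2 / max 1 A.Δmax * R.Δ k ^ (A.α + 2))) := by
  have h1 := hR.pred_le h
  have h2 := hR.le_max_red hA h
  have := hA.κfcd_mem.1
  nlinarith

theorem IsRun.pred_neg (hR : R.IsRun P A) (hA : A.Valid) {k : ℕ} (h : R.Acc P A k) :
    R.pred P k (R.mu k) < 0 := by
  refine (hR.pred_le_pow hA h).trans_lt ?_
  have := hA.κfcd_mem.1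
  have := hA.η_mem.1
  have := (hR.Δ_mem hA k).1
  rw [neg_lt_zero]
  positivity

/-- Here `a ≤ p + (1 - η) b` and `p + b ≤ 0`, so `a ≤ η p`; dividing by `p < 0` reverses the
inequality. Every acceptance proof reduces to this. -/
theorem le_div_of_abs_sub_le {η a p b : ℝ} (hp : p ≤ -b) (hb : 0 < b)
    (h : |a - p| ≤ (1 - η) * b) (hη : η ≤ 1) : η ≤ a / p := by
  have hp0 : p < 0 := by linarith
  rw [le_div_iff_of_neg hp0]
  have := (abs_le.1 h).2
  nlinarith

end Path

end PathFacts

/-! ### Error of the predicted reduction under accurate estimates. -/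

section ModelError

variable {d m : ℕ} {P : Problem d m} {A : Params d} {D : Set (Vec d)} {C : Consts}

/-- Bound on the operator `g ↦ λ`. -/
noncomputable def multBound (C : Consts) : ℝ := C.κ1⁻¹ * √C.κ2

/-- Bound on `‖ḡ_k‖` when the gradient estimate is accurate. -/
noncomputable def gradBound {d : ℕ} (A : Params d) (C : Consts) : ℝ :=
  C.κdf + A.κg * (max 1 A.Δmax * A.Δmax)

/-- Bound on `‖H̄_k‖` when the gradient and Hessian estimates are accurate. -/
noncomputable def hessBound {d : ℕ} (A : Params d) (m : ℕ) (C : Consts) : ℝ :=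
  max C.κB (A.κh * A.Δmax + C.Lf + m * (multBound C * gradBound A C * C.LG))

theorem multBound_nonneg (hC : C.Valid) : 0 ≤ multBound C := by
  have := hC.κ1_pos
  unfold multBound; positivity

theorem one_le_hessBound (hC : C.Valid) : 1 ≤ hessBound A m C :=
  hC.κB_ge.trans (le_max_left _ _)

theorem gradBound_nonneg (hA : A.Valid) (hC : C.Valid) : 0 ≤ gradBound A C := by
  have := hA.κg_pos; have := hC.κdf_pos; have := hA.Δmax_pos
  unfold gradBound; positivity

namespace Path

variable {R : Path d m} {k : ℕ}

theorem Accurate.norm_grad_sub_le (hacc : R.Accurate P A k) (hR : R.IsRun P A) (hA : A.Valid) :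
    ‖R.g k - P.grad (R.x k)‖ ≤ A.κg * max 1 A.Δmax * R.Δ k := by
  obtain ⟨h0, h1⟩ := hR.Δ_mem hA k
  refine hacc.grad.trans ?_
  rw [mul_assoc]
  have := hA.κg_pos
  gcongr
  simpa using hA.pow_add_le h0.le h1 1

theorem Accurate.norm_g_le (hacc : R.Accurate P A k) (hR : R.IsRun P A) (hA : A.Valid)
    (hb : BoundedAlong P A D C R) : ‖R.g k‖ ≤ gradBound A C := by
  obtain ⟨h0, h1⟩ := hR.Δ_mem hA k
  have h2 := hacc.norm_grad_sub_le hR hA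
  have h3 := norm_le_norm_add_norm_sub' (R.g k) (P.grad (R.x k))
  have h4 := hb.grad_bdd k
  have := hA.κg_pos
  have h5 : A.κg * max 1 A.Δmax * R.Δ k ≤ A.κg * max 1 A.Δmax * A.Δmax := by gcongr
  unfold gradBound
  linarith

theorem Accurate.norm_multiplier_le (hacc : R.Accurate P A k) (hR : R.IsRun P A) (hA : A.Valid)
    (hC : C.Valid) (hb : BoundedAlong P A D C R) :
    ‖multiplier (R.G P k) (R.g k)‖ ≤ multBound C * gradBound A C := by
  refine ((hb.gramBounds hC k).norm_multiplier_le _).trans ?_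
  have := multBound_nonneg hC
  exact mul_le_mul_of_nonneg_left (hacc.norm_g_le hR hA hb) this

theorem norm_sum_smul_hessC_le (hP : Smooth P D C) (hC : C.Valid) {x : Vec d} (hx : x ∈ D)
    (lam : Vec m) : ‖∑ i, lam i • P.hessC i x‖ ≤ m * (‖lam‖ * C.LG) := by
  refine (norm_sum_le_of_le (f := fun i => lam i • P.hessC i x) _
    (n := fun _ => ‖lam‖ * C.LG) fun i _ => ?_).trans ?_
  · rw [norm_smul]
    gcongr
    · exact PiLp.norm_apply_le _ i
    · exact hP.norm_hessC_le hC i hx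
  · simp

/-- The two entries of the maximum in `hessBound` serve the two values of `α`: an assumed bound for
`α = 0`, and for `α = 1` accuracy together with termwise bounds on the constraint Hessians. -/
theorem Accurate.norm_H_le (hacc : R.Accurate P A k) (hP : Smooth P D C) (hR : R.IsRun P A)
    (hA : A.Valid) (hC : C.Valid) (hb : BoundedAlong P A D C R) : ‖R.H k‖ ≤ hessBound A m C := by
  rcases hA.α_mem with hα | hα
  · exact (hb.H_bdd hα k).trans (le_max_left _ _)
  refine le_max_of_le_right ?_
  rw [(hR.hessian_eq hα k).2]
  obtain ⟨h0, h1⟩ := hR.Δ_mem hA k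
  have hx := hb.x_mem k
  have h2 := norm_le_norm_add_norm_sub' (R.hess k) (P.hess (R.x k))
  have h3 := hP.norm_hess_le hC hx
  have h4 := hacc.hess hα
  have h5 := norm_sum_smul_hessC_le hP hC hx (multiplier (R.G P k) (R.g k))
  have h6 := hacc.norm_multiplier_le hR hA hC hb
  have h7 : A.κh * R.Δ k ≤ A.κh * A.Δmax := by have := hA.κh_pos; gcongr
  have h8 : (m : ℝ) * (‖multiplier (R.G P k) (R.g k)‖ * C.LG) ≤
      m * (multBound C * gradBound A C * C.LG) := by have := hC.LG_nonneg; gcongr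
  refine (norm_add_le _ _).trans ?_
  linarith

/-- The model error of the trial step is of second order in the radius. -/
theorem exists_abs_ared_sub_pred_le (hP : Smooth P D C) (hA : A.Valid) (hC : C.Valid) :
    ∃ K : ℝ, 0 ≤ K ∧ ∀ (R : Path d m) (k : ℕ), R.IsRun P A → BoundedAlong P A D C R →
      R.Accurate P A k → R.mu k ≤ C.muHat → R.Acc P A k →
      |R.ared P k (R.x k + R.dx k) (R.fs k) - R.pred P k (R.mu k)| ≤ K * R.Δ k ^ 2 := by
  set M := max 1 A.Δmax
  have hM : 0 < M := by positivity
  refine ⟨2 * (A.κf * M) + 4 * C.Lf + A.κg * M * 2 + 2 * hessBound A m C +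
    4 * |C.muHat| * C.LG, ?_, fun R k hR hb hacc hmu hk => ?_⟩
  · have := hA.κf_pos; have := hA.κg_pos; have := hC.Lf_nonneg; have := hC.LG_nonneg
    have := one_le_hessBound (A := A) (m := m) hC
    positivity
  obtain ⟨h0, h1⟩ := hR.Δ_mem hA k
  have hx := hb.x_mem k
  have hxs := hb.trial_mem k hk
  have hs := hR.norm_dx_le hA hk
  have hs2 : ‖R.dx k‖ ^ 2 ≤ 4 * R.Δ k ^ 2 := by nlinarith [norm_nonneg (R.dx k)]
  have hest := max_le_iff.1 (hacc.est hk)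
  have hpow := mul_le_mul_of_nonneg_left (hA.pow_add_le h0.le h1 2) hA.κf_pos.le
  have e1 := hest.1.trans hpow
  have e2 := hest.2.trans hpow
  have e3 : |P.f (R.x k + R.dx k) - P.f (R.x k) - inner ℝ (P.grad (R.x k)) (R.dx k)| ≤
      C.Lf * (4 * R.Δ k ^ 2) :=
    (hP.taylor_f hC hx hxs).trans (mul_le_mul_of_nonneg_left hs2 hC.Lf_nonneg)
  have e4 : |inner ℝ (R.g k - P.grad (R.x k)) (R.dx k)| ≤ A.κg * M * R.Δ k * (2 * R.Δ k) := by
    refine (abs_real_inner_le_norm _ _).trans ?_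
    have := hA.κg_pos
    gcongr
    exact hacc.norm_grad_sub_le hR hA
  have e5 : |inner ℝ (R.dx k) (R.H k (R.dx k))| ≤ hessBound A m C * (4 * R.Δ k ^ 2) := by
    refine (abs_real_inner_le_norm _ _).trans ?_
    have h2 := (R.H k).le_opNorm (R.dx k)
    have h3 := hacc.norm_H_le hP hR hA hC hb
    calc ‖R.dx k‖ * ‖R.H k (R.dx k)‖ ≤ ‖R.dx k‖ * (‖R.H k‖ * ‖R.dx k‖) := by gcongr
      _ = ‖R.H k‖ * ‖R.dx k‖ ^ 2 := by ring
      _ ≤ _ := mul_le_mul h3 hs2 (by positivity) (zero_le_one.trans (one_le_hessBound hC))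
  have e6 : |R.mu k * (‖P.c (R.x k + R.dx k)‖ - ‖R.cv P k + R.G P k (R.dx k)‖)| ≤
      |C.muHat| * (C.LG * (4 * R.Δ k ^ 2)) := by
    rw [abs_mul, abs_of_pos (hR.mu_pos hA k)]
    have h2 : |‖P.c (R.x k + R.dx k)‖ - ‖R.cv P k + R.G P k (R.dx k)‖| ≤
        C.LG * (4 * R.Δ k ^ 2) := by
      refine (abs_norm_sub_norm_le _ _).trans ?_
      have := hP.taylor_c hC hx hxs
      rw [sub_sub] at this
      exact this.trans (mul_le_mul_of_nonneg_left hs2 hC.LG_nonneg)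
    exact mul_le_mul (hmu.trans (le_abs_self _)) h2 (abs_nonneg _) (abs_nonneg _)
  -- Exact splitting into estimation errors, the Taylor remainder of `f`, the gradient error, the
  -- quadratic term and the linearisation error of `c`; each is of order `Δ²`.
  have key : R.ared P k (R.x k + R.dx k) (R.fs k) - R.pred P k (R.mu k) =
      (R.fs k - P.f (R.x k + R.dx k)) - (R.fk k - P.f (R.x k)) +
      (P.f (R.x k + R.dx k) - P.f (R.x k) - inner ℝ (P.grad (R.x k)) (R.dx k)) -
      inner ℝ (R.g k - P.grad (R.x k)) (R.dx k) - 1 / 2 * inner ℝ (R.dx k) (R.H k (R.dx k)) +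
      R.mu k * (‖P.c (R.x k + R.dx k)‖ - ‖R.cv P k + R.G P k (R.dx k)‖) := by
    rw [ared, pred, inner_sub_left]; ring
  rw [key, abs_le]
  rw [abs_le] at e1 e2 e3 e4 e5 e6
  constructor <;> nlinarith

/-- With the second-order correction, the model error is of third order in the radius. -/
theorem exists_abs_ared_soc_sub_pred_le (hP : Smooth P D C) (hA : A.Valid) (hC : C.Valid) :
    ∃ K : ℝ, 0 ≤ K ∧ ∀ (R : Path d m) (k : ℕ), R.IsRun P A → BoundedAlong P A D C R →
      R.Accurate P A k → R.mu k ≤ C.muHat → R.SocUsed P A k →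
      |R.ared P k (R.x k + R.dx k + R.soc P k) (R.fsoc k) - R.pred P k (R.mu k)| ≤
        K * R.Δ k ^ 3 := by
  set Kv := √C.κ2 * C.κ1⁻¹
  set Kl := multBound C * gradBound A C
  have hKv : 0 ≤ Kv := by have := hC.κ1_pos; positivity
  have hKl : 0 ≤ Kl := mul_nonneg (multBound_nonneg hC) (gradBound_nonneg hA hC)
  have hKm := multBound_nonneg hC
  have := hA.κf_pos; have := hA.κg_pos; have := hA.κh_pos
  have hLf := hC.Lf_nonneg
  have hLG := hC.LG_nonneg
  have hLhf := hC.Lhf_nonneg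
  have hLhc := hC.Lhc_nonneg
  have hΔm := hA.Δmax_pos
  set Kd := Kv * (C.LG * 4)
  have hKd : 0 ≤ Kd := by positivity
  refine ⟨2 * A.κf + C.Lf * Kd ^ 2 * A.Δmax + C.Lf * 2 * Kd + C.Lhf * 8 + A.κg * 2 + A.κh * 4 +
    multBound C * A.κg * (C.LG * 4) * A.Δmax + m * (Kl * (C.Lhc * 8)) +
    |C.muHat| * (C.LG * Kd ^ 2 * A.Δmax + C.LG * 2 * Kd), by positivity,
    fun R k hR hb hacc hmu hk => ?_⟩
  obtain ⟨hAcc, -, hα, -⟩ := id hk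
  obtain ⟨h0, h1⟩ := hR.Δ_mem hA k
  have hx := hb.x_mem k
  have hxs := hb.trial_mem k hAcc
  have hxd := hb.soc_mem k hk
  have hs := hR.norm_dx_le hA hAcc
  have hs2 : ‖R.dx k‖ ^ 2 ≤ 4 * R.Δ k ^ 2 := by nlinarith [norm_nonneg (R.dx k)]
  have hs3 : ‖R.dx k‖ ^ 3 ≤ 8 * R.Δ k ^ 3 := by
    calc ‖R.dx k‖ ^ 3 ≤ (2 * R.Δ k) ^ 3 := by gcongr
      _ = _ := by ring
  have h4 : R.Δ k ^ 4 ≤ A.Δmax * R.Δ k ^ 3 := by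
    rw [pow_succ' _ 3]; gcongr
  have hg := hb.gramBounds hC k
  set e := P.c (R.x k + R.dx k) - R.cv P k - R.G P k (R.dx k)
  have hsoc : R.soc P k = fullNormalStep (R.G P k) e := rfl
  have he : ‖e‖ ≤ C.LG * 4 * R.Δ k ^ 2 := by
    refine (hP.taylor_c hC hx hxs).trans ?_
    rw [mul_assoc]
    gcongr
  have hd : ‖R.soc P k‖ ≤ Kd * R.Δ k ^ 2 := by
    rw [hsoc]
    refine (hg.norm_fullNormalStep_le e).trans ?_
    simp only [Kd]
    rw [mul_assoc Kv]
    gcongr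
  have hd2 : ‖R.soc P k‖ ^ 2 ≤ Kd ^ 2 * (A.Δmax * R.Δ k ^ 3) := by
    calc ‖R.soc P k‖ ^ 2 ≤ (Kd * R.Δ k ^ 2) ^ 2 := by gcongr
      _ = Kd ^ 2 * R.Δ k ^ 4 := by ring
      _ ≤ _ := by gcongr
  have e1 : |R.fk k - P.f (R.x k)| ≤ A.κf * R.Δ k ^ 3 := by
    have := (max_le_iff.1 (hacc.est hAcc)).1
    rwa [hα] at this
  have e2 : |R.fsoc k - P.f (R.x k + R.dx k + R.soc P k)| ≤ A.κf * R.Δ k ^ 3 := by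
    have := hacc.soc hk
    rwa [hα] at this
  have e3 : |P.f (R.x k + R.dx k + R.soc P k) - P.f (R.x k + R.dx k) -
      inner ℝ (P.grad (R.x k + R.dx k)) (R.soc P k)| ≤
      C.Lf * (Kd ^ 2 * (A.Δmax * R.Δ k ^ 3)) :=
    (hP.taylor_f hC hxs hxd).trans (by gcongr)
  have e4 : |inner ℝ (P.grad (R.x k + R.dx k) - P.grad (R.x k)) (R.soc P k)| ≤
      C.Lf * (2 * R.Δ k) * (Kd * R.Δ k ^ 2) := by
    refine (abs_real_inner_le_norm _ _).trans ?_
    have h := hP.grad_lip _ hxs _ hx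
    rw [add_sub_cancel_left] at h
    gcongr
    exact h.trans (by gcongr)
  have e5 : |P.f (R.x k + R.dx k) - P.f (R.x k) - inner ℝ (P.grad (R.x k)) (R.dx k) -
      1 / 2 * inner ℝ (R.dx k) (P.hess (R.x k) (R.dx k))| ≤ C.Lhf * (8 * R.Δ k ^ 3) :=
    (hP.taylor_f_two hC hx hxs).trans (by gcongr)
  have hgrad : ‖R.g k - P.grad (R.x k)‖ ≤ A.κg * R.Δ k ^ 2 := by
    have := hacc.grad
    rwa [hα] at this
  have e6 : |inner ℝ (R.g k - P.grad (R.x k)) (R.dx k)| ≤ A.κg * R.Δ k ^ 2 * (2 * R.Δ k) := by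
    refine (abs_real_inner_le_norm _ _).trans ?_
    gcongr
  have e7 : |inner ℝ (R.dx k) ((R.hess k - P.hess (R.x k)) (R.dx k))| ≤
      A.κh * R.Δ k * (4 * R.Δ k ^ 2) := by
    refine (abs_real_inner_le_norm _ _).trans ?_
    have h2 := (R.hess k - P.hess (R.x k)).le_opNorm (R.dx k)
    have h3 := hacc.hess hα
    calc ‖R.dx k‖ * ‖(R.hess k - P.hess (R.x k)) (R.dx k)‖
        ≤ ‖R.dx k‖ * (‖R.hess k - P.hess (R.x k)‖ * ‖R.dx k‖) := by gcongr
      _ = ‖R.hess k - P.hess (R.x k)‖ * ‖R.dx k‖ ^ 2 := by ring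
      _ ≤ _ := by gcongr
  set lb := multiplier (R.G P k) (R.g k)
  set lt := multiplier (R.G P k) (P.grad (R.x k))
  -- For `α = 1` the multiplier error and `e` are both of order `Δ²`, so one power of `Δ` can be
  -- traded for `Δmax`.
  have e8 : |inner ℝ (lb - lt) e| ≤ multBound C * (A.κg * R.Δ k ^ 2) * (C.LG * 4 * R.Δ k ^ 2) := by
    refine (abs_real_inner_le_norm _ _).trans ?_
    gcongr
    rw [multiplier_sub]
    exact (hg.norm_multiplier_le _).trans (mul_le_mul_of_nonneg_left hgrad hKm)
  have e8' : |inner ℝ (lb - lt) e| ≤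
      multBound C * A.κg * (C.LG * 4) * (A.Δmax * R.Δ k ^ 3) := by
    refine e8.trans ?_
    calc _ = multBound C * A.κg * (C.LG * 4) * R.Δ k ^ 4 := by ring
      _ ≤ _ := by gcongr
  have e9 : |∑ i, lb i * (e i - 1 / 2 * inner ℝ (R.dx k) (P.hessC i (R.x k) (R.dx k)))| ≤
      m * (Kl * (C.Lhc * (8 * R.Δ k ^ 3))) := by
    refine (Finset.abs_sum_le_sum_abs _ _).trans ((Finset.sum_le_sum
      (g := fun _ => Kl * (C.Lhc * (8 * R.Δ k ^ 3))) fun i _ => ?_).trans (by simp))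
    rw [abs_mul]
    gcongr
    · exact (PiLp.norm_apply_le lb i).trans (hacc.norm_multiplier_le hR hA hC hb)
    · exact (hP.taylor_c_two hC hx hxs i).trans (by gcongr)
  have e10 : |R.mu k * (‖P.c (R.x k + R.dx k + R.soc P k)‖ - ‖R.cv P k + R.G P k (R.dx k)‖)| ≤
      |C.muHat| * (C.LG * (Kd ^ 2 * (A.Δmax * R.Δ k ^ 3)) +
        C.LG * (2 * R.Δ k) * (Kd * R.Δ k ^ 2)) := by
    rw [abs_mul, abs_of_pos (hR.mu_pos hA k)]
    refine mul_le_mul (hmu.trans (le_abs_self _)) ?_ (abs_nonneg _) (abs_nonneg _)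
    refine (abs_norm_sub_norm_le _ _).trans ?_
    have hGd : R.G P k (R.soc P k) = -e := by rw [hsoc]; exact jac_fullNormalStep hg.isInvertible e
    -- The correction satisfies `G d = -e`. It thus removes the linearisation error `e` and leaves a
    -- remainder quadratic in `d` plus the change of the Jacobian applied to `d`, of orders `Δ⁴` and
    -- `Δ³`.
    have hdec : P.c (R.x k + R.dx k + R.soc P k) - (R.cv P k + R.G P k (R.dx k)) =
        (P.c (R.x k + R.dx k + R.soc P k) - P.c (R.x k + R.dx k) -
          P.jac (R.x k + R.dx k) (R.soc P k)) +
        (P.jac (R.x k + R.dx k) - P.jac (R.x k)) (R.soc P k) := by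
      have : P.jac (R.x k) (R.soc P k) = -e := hGd
      rw [sub_apply, this]
      simp only [e]
      abel
    rw [hdec]
    refine (norm_add_le _ _).trans (add_le_add ?_ ?_)
    · exact (hP.taylor_c hC hxs hxd).trans (by gcongr)
    · refine (ContinuousLinearMap.le_opNorm _ _).trans ?_
      have h := hP.jac_lip _ hxs _ hx
      rw [add_sub_cancel_left] at h
      gcongr
      exact h.trans (by gcongr)
  have hHdx : inner ℝ (R.dx k) (R.H k (R.dx k)) = inner ℝ (R.dx k) (R.hess k (R.dx k)) +
      ∑ i, lb i * inner ℝ (R.dx k) (P.hessC i (R.x k) (R.dx k)) := by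
    rw [(hR.hessian_eq hα k).2, Problem.lagHess, add_apply, inner_add_right,
      sum_apply, inner_sum]
    simp [real_inner_smul_right, lb]
  have hlbe : inner ℝ lb e = ∑ i, lb i * e i := by
    rw [PiLp.inner_apply]
    simp [mul_comm]
  -- The decisive cancellation: the correction changes `f` to first order by `λᵀ e`, and `e` is half
  -- the constraint curvature along `Δx` up to third order. This accounts for the multiplier part of
  -- `½ Δxᵀ H̄ Δx`.
  have hgd : inner ℝ (P.grad (R.x k)) (R.soc P k) = inner ℝ lt e := by
    rw [hsoc]; exact inner_fullNormalStep hg.isInvertible _ e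
  have hsum : ∑ i, lb i * (e i - 1 / 2 * inner ℝ (R.dx k) (P.hessC i (R.x k) (R.dx k))) =
      inner ℝ lb e - 1 / 2 * ∑ i, lb i * inner ℝ (R.dx k) (P.hessC i (R.x k) (R.dx k)) := by
    rw [hlbe, Finset.mul_sum, ← Finset.sum_sub_distrib]
    exact Finset.sum_congr rfl fun i _ => by ring
  have key : R.ared P k (R.x k + R.dx k + R.soc P k) (R.fsoc k) - R.pred P k (R.mu k) =
      (R.fsoc k - P.f (R.x k + R.dx k + R.soc P k)) - (R.fk k - P.f (R.x k)) +
      (P.f (R.x k + R.dx k + R.soc P k) - P.f (R.x k + R.dx k) -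
        inner ℝ (P.grad (R.x k + R.dx k)) (R.soc P k)) +
      inner ℝ (P.grad (R.x k + R.dx k) - P.grad (R.x k)) (R.soc P k) +
      (P.f (R.x k + R.dx k) - P.f (R.x k) - inner ℝ (P.grad (R.x k)) (R.dx k) -
        1 / 2 * inner ℝ (R.dx k) (P.hess (R.x k) (R.dx k))) -
      inner ℝ (R.g k - P.grad (R.x k)) (R.dx k) -
      1 / 2 * inner ℝ (R.dx k) ((R.hess k - P.hess (R.x k)) (R.dx k)) -
      inner ℝ (lb - lt) e +
      ∑ i, lb i * (e i - 1 / 2 * inner ℝ (R.dx k) (P.hessC i (R.x k) (R.dx k))) +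
      R.mu k * (‖P.c (R.x k + R.dx k + R.soc P k)‖ - ‖R.cv P k + R.G P k (R.dx k)‖) := by
    rw [hsum, ared, pred, hHdx, sub_apply]
    simp only [inner_sub_left, inner_sub_right, hgd]
    ring
  have hΔ3 : 0 ≤ R.Δ k ^ 3 := by positivity
  have hκ3 : 0 ≤ A.κh * R.Δ k ^ 3 := by positivity
  rw [key, abs_le]
  rw [abs_le] at e1 e2 e3 e4 e5 e6 e7 e8' e9 e10
  constructor <;> linarith

end Path

end ModelError

/-! ### Success of accurate iterations with a small radius. -/

section SuccessfulSteps

variable {d m : ℕ} {P : Problem d m} {A : Params d} {D : Set (Vec d)} {C : Consts}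

theorem exists_pos_forall_lt_mul_le {K c : ℝ} (hK : 0 ≤ K) (hc : 0 < c) :
    ∃ δ > 0, ∀ Δ < δ, K * Δ ≤ c := by
  refine ⟨c / (K + 1), by positivity, fun Δ hΔ => ?_⟩
  rw [lt_div_iff₀ (by positivity)] at hΔ
  rcases le_or_gt 0 Δ with h | h <;> nlinarith

namespace Path

/-- A reduction of first order in the radius makes the trial step acceptable. -/
theorem exists_radius_accept (hP : Smooth P D C) (hA : A.Valid) (hC : C.Valid) {t : ℝ}
    (ht : 0 < t) : ∃ δ > 0, ∀ (R : Path d m) (k : ℕ), R.IsRun P A → BoundedAlong P A D C R →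
      R.Accurate P A k → R.mu k ≤ C.muHat → R.Acc P A k → R.Δ k < δ →
      t * R.Δ k ≤ max (R.gradRed P k) (R.eigRed P A k) → R.Accept P A k := by
  obtain ⟨K, hK, hle⟩ := exists_abs_ared_sub_pred_le (P := P) (A := A) (D := D) hP hA hC
  have hκ := hA.κfcd_mem.1
  have hη : 0 < 1 - A.η := sub_pos.2 hA.η_mem.2
  obtain ⟨δ, hδ, hδK⟩ := exists_pos_forall_lt_mul_le hK
    (c := (1 - A.η) * (A.κfcd / 2 * t)) (by positivity)
  refine ⟨δ, hδ, fun R k hR hb hacc hmu hk hΔ hred => ?_⟩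
  have h0 := (hR.Δ_mem hA k).1
  refine le_div_of_abs_sub_le (b := A.κfcd / 2 * (t * R.Δ k)) ?_ (by positivity) ?_ hA.η_mem.2.le
  · have := hR.pred_le hk
    nlinarith
  · refine (hle R k hR hb hacc hmu hk).trans ?_
    have := mul_le_mul_of_nonneg_right (hδK _ hΔ) h0.le
    nlinarith

/-- A reduction of second order in the radius makes the corrected trial step acceptable. -/
theorem exists_radius_acceptSoc (hP : Smooth P D C) (hA : A.Valid) (hC : C.Valid) {t : ℝ}
    (ht : 0 < t) : ∃ δ > 0, ∀ (R : Path d m) (k : ℕ), R.IsRun P A → BoundedAlong P A D C R →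
      R.Accurate P A k → R.mu k ≤ C.muHat → R.SocUsed P A k → R.Δ k < δ →
      t * R.Δ k ^ 2 ≤ max (R.gradRed P k) (R.eigRed P A k) → R.AcceptSoc P A k := by
  obtain ⟨K, hK, hle⟩ := exists_abs_ared_soc_sub_pred_le (P := P) (A := A) (D := D) hP hA hC
  have hκ := hA.κfcd_mem.1
  have hη : 0 < 1 - A.η := sub_pos.2 hA.η_mem.2
  obtain ⟨δ, hδ, hδK⟩ := exists_pos_forall_lt_mul_le hK
    (c := (1 - A.η) * (A.κfcd / 2 * t)) (by positivity)
  refine ⟨δ, hδ, fun R k hR hb hacc hmu hk hΔ hred => ?_⟩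
  have h0 := (hR.Δ_mem hA k).1
  refine le_div_of_abs_sub_le (b := A.κfcd / 2 * (t * R.Δ k ^ 2)) ?_ (by positivity) ?_
    hA.η_mem.2.le
  · have := hR.pred_le hk.1
    nlinarith
  · refine (hle R k hR hb hacc hmu hk).trans ?_
    have := mul_le_mul_of_nonneg_right (hδK _ hΔ) (sq_nonneg (R.Δ k))
    nlinarith

/-- Away from first-order stationary points, accurate iterations with a small radius succeed. -/
theorem exists_radius_success_of_kkt (hP : Smooth P D C) (hA : A.Valid) (hC : C.Valid) {ε : ℝ}
    (hε : 0 < ε) : ∃ δ > 0, ∀ (R : Path d m) (k : ℕ), R.IsRun P A → BoundedAlong P A D C R →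
      R.Accurate P A k → R.mu k ≤ C.muHat → R.Δ k < δ → ε < R.kkt P k → R.Success P A k := by
  set B := hessBound A m C
  have hB : 1 ≤ B := one_le_hessBound hC
  set L := 1 + √C.κ2 * (C.κ1⁻¹ * √C.κ2)
  have hL : 0 ≤ L := by have := hC.κ1_pos; positivity
  have hκg := hA.κg_pos
  obtain ⟨δ₁, hδ₁, h₁⟩ := exists_radius_accept (P := P) (A := A) (D := D) hP hA hC (half_pos hε)
  obtain ⟨δ₂, hδ₂, h₂⟩ := exists_pos_forall_lt_mul_le (K := L * (A.κg * max 1 A.Δmax))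
    (by positivity) (half_pos hε)
  obtain ⟨δ₃, hδ₃, h₃⟩ := exists_pos_forall_lt_mul_le (K := B) (by positivity) (half_pos hε)
  -- `δ₂` keeps the estimated residual above `ε/2`, `δ₃` makes the radius at most the residual
  -- quotient so that the reduction is at least `(ε/2) Δ`, and `δ₁` is the acceptance threshold for
  -- that reduction.
  refine ⟨min δ₁ (min δ₂ δ₃), by positivity, fun R k hR hb hacc hmu hΔ hkkt => ?_⟩
  obtain ⟨hΔ₁, hΔ'⟩ := lt_min_iff.1 hΔ
  obtain ⟨hΔ₂, hΔ₃⟩ := lt_min_iff.1 hΔ'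
  have h0 := (hR.Δ_mem hA k).1
  have hbar : ε / 2 ≤ R.kktBar P k := by
    have h4 : R.kkt P k ≤ R.kktBar P k + L * ‖R.g k - P.grad (R.x k)‖ :=
      kktNorm_le_add (hb.gramBounds hC k) _ _ _
    have h5 := mul_le_mul_of_nonneg_left (hacc.norm_grad_sub_le hR hA) hL
    have h6 := h₂ _ hΔ₂
    linarith
  have hquot : R.Δ k ≤ R.kktBar P k / max 1 ‖R.H k‖ := by
    rw [le_div_iff₀ (by positivity)]
    have h4 : max 1 ‖R.H k‖ ≤ B := max_le hB (hacc.norm_H_le hP hR hA hC hb)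
    have h5 := h₃ _ hΔ₃
    nlinarith
  have hAcc : R.Acc P A k := by
    refine le_max_of_le_left (le_trans ?_ hquot)
    exact mul_le_of_le_one_left h0.le hA.η_mem.2.le
  refine ⟨hAcc, Or.inl (h₁ R k hR hb hacc hmu hAcc hΔ₁ (le_max_of_le_left ?_))⟩
  exact (mul_le_mul_of_nonneg_right hbar h0.le).trans (le_gradRed le_rfl hquot)

/-- Where the reduced Lagrangian Hessian has negative curvature, accurate iterations with a small
radius succeed. -/
theorem exists_radius_success_of_curvature (hP : Smooth P D C) (hA : A.Valid) (hC : C.Valid)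
    (hα : A.α = 1) {ε : ℝ} (hε : 0 < ε) :
    ∃ δ > 0, ∀ (R : Path d m) (k : ℕ), R.IsRun P A → BoundedAlong P A D C R →
      R.Accurate P A k → R.mu k ≤ C.muHat → R.Δ k < δ →
      (∃ u : Vec d, R.G P k u = 0 ∧ inner ℝ u (P.lagHess (P.hess (R.x k))
        (multiplier (R.G P k) (P.grad (R.x k))) (R.x k) u) < -ε * ‖u‖ ^ 2) →
      R.Success P A k := by
  have hκg := hA.κg_pos
  have hκh := hA.κh_pos
  have hLG := hC.LG_nonneg
  have hmb := multBound_nonneg hC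
  have hr := hA.r_pos
  set E := A.κh + m * (multBound C * (A.κg * max 1 A.Δmax) * C.LG)
  have hE : 0 ≤ E := by positivity
  obtain ⟨δ₁, hδ₁, h₁⟩ := exists_radius_accept (P := P) (A := A) (D := D) hP hA hC
    (t := ε / 2 * A.r) (by positivity)
  obtain ⟨δ₂, hδ₂, h₂⟩ := exists_radius_acceptSoc (P := P) (A := A) (D := D) hP hA hC (half_pos hε)
  obtain ⟨δ₃, hδ₃, h₃⟩ := exists_pos_forall_lt_mul_le hE (half_pos hε)
  -- `δ₃` limits the Hessian error to `ε/2`, half of the available curvature; `ε/2` makes the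
  -- iteration compute a trial step. `δ₁` and `δ₂` belong to the cases `‖c‖ > r` and `‖c‖ ≤ r`.
  refine ⟨min δ₁ (min δ₂ (min δ₃ (ε / 2))), by positivity,
    fun R k hR hb hacc hmu hΔ ⟨u, hGu, hu⟩ => ?_⟩
  obtain ⟨hΔ₁, hΔ'⟩ := lt_min_iff.1 hΔ
  obtain ⟨hΔ₂, hΔ''⟩ := lt_min_iff.1 hΔ'
  obtain ⟨hΔ₃, hΔ₄⟩ := lt_min_iff.1 hΔ''
  have h0 := (hR.Δ_mem hA k).1
  have hx := hb.x_mem k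
  obtain ⟨hself, hH⟩ := hR.hessian_eq hα k
  set Q := P.lagHess (P.hess (R.x k)) (multiplier (R.G P k) (P.grad (R.x k))) (R.x k)
  have hHQ : ‖R.H k - Q‖ ≤ E * R.Δ k := by
    have hdiff : R.H k - Q = (R.hess k - P.hess (R.x k)) +
        ∑ i, multiplier (R.G P k) (R.g k - P.grad (R.x k)) i • P.hessC i (R.x k) := by
      have hi : ∀ i, multiplier (R.G P k) (R.g k - P.grad (R.x k)) i • P.hessC i (R.x k) =
          multiplier (R.G P k) (R.g k) i • P.hessC i (R.x k) -
            multiplier (R.G P k) (P.grad (R.x k)) i • P.hessC i (R.x k) := fun i => by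
        rw [← multiplier_sub]
        exact sub_smul (R := ℝ) (M := Vec d →L[ℝ] Vec d) _ _ _
      rw [hH, Finset.sum_congr rfl fun i _ => hi i, Finset.sum_sub_distrib]
      simp only [Q, Problem.lagHess]
      abel
    rw [hdiff]
    refine (norm_add_le _ _).trans ?_
    have h4 := hacc.hess hα
    have h5 := norm_sum_smul_hessC_le hP hC hx (multiplier (R.G P k) (R.g k - P.grad (R.x k)))
    have h6 : ‖multiplier (R.G P k) (R.g k - P.grad (R.x k))‖ ≤
        multBound C * (A.κg * max 1 A.Δmax * R.Δ k) :=
      ((hb.gramBounds hC k).norm_multiplier_le _).trans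
        (mul_le_mul_of_nonneg_left (hacc.norm_grad_sub_le hR hA) hmb)
    have h7 : (m : ℝ) * (‖multiplier (R.G P k) (R.g k - P.grad (R.x k))‖ * C.LG) ≤
        m * (multBound C * (A.κg * max 1 A.Δmax * R.Δ k) * C.LG) := by gcongr
    simp only [E]
    linarith
  have hsa : IsSelfAdjoint (R.H k) := by
    rw [hH]
    refine IsSelfAdjoint.add (R := Vec d →L[ℝ] Vec d) hself (isSelfAdjoint_sum _ fun i _ => ?_)
    exact (IsSelfAdjoint.all _).smul (hP.isSelfAdjoint_hessC i hx)
  have hu0 : 0 < ‖u‖ ^ 2 := by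
    rcases eq_or_ne u 0 with rfl | h
    · simp at hu
    · have := norm_pos_iff.2 h
      positivity
  have hmin : minEig (R.G P k) (R.H k) < -(ε / 2) := by
    have h4 := minEig_mul_le hsa hGu
    have h5 : inner ℝ u (R.H k u) = inner ℝ u (Q u) + inner ℝ u ((R.H k - Q) u) := by
      rw [sub_apply, inner_sub_right]; ring
    have h6 : inner ℝ u ((R.H k - Q) u) ≤ ε / 2 * ‖u‖ ^ 2 := by
      calc inner ℝ u ((R.H k - Q) u) ≤ ‖u‖ * ‖(R.H k - Q) u‖ := real_inner_le_norm _ _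
        _ ≤ ‖u‖ * (‖R.H k - Q‖ * ‖u‖) := by gcongr; exact ContinuousLinearMap.le_opNorm _ _
        _ = ‖R.H k - Q‖ * ‖u‖ ^ 2 := by ring
        _ ≤ ε / 2 * ‖u‖ ^ 2 := by gcongr; exact hHQ.trans (h₃ _ hΔ₃)
    by_contra hc
    push Not at hc
    nlinarith
  have htau : ε / 2 ≤ R.tauBarPlus P A k := by
    rw [tauBarPlus, if_pos hα]
    exact ((lt_negPart_iff (half_pos hε).le).2 hmin).le
  have hAcc : R.Acc P A k := by
    refine le_max_of_le_right (le_trans ?_ htau)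
    exact (mul_le_of_le_one_left h0.le hA.η_mem.2.le).trans hΔ₄.le
  refine ⟨hAcc, ?_⟩
  -- Near feasibility the eigen reduction is only of order `Δ²` and may need the correction.
  -- Otherwise its factor `‖c‖` exceeds `r`, and a reduction of order `Δ` makes the plain trial step
  -- acceptable.
  rcases le_or_gt ‖R.cv P k‖ A.r with hcr | hcr
  · refine or_iff_not_imp_left.2 fun hnot => ?_
    have hsoc : R.SocUsed P A k := ⟨hAcc, hnot, hα, hcr⟩
    refine ⟨hsoc, h₂ R k hR hb hacc hmu hsoc hΔ₂ (le_max_of_le_right ?_)⟩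
    exact (mul_le_mul_of_nonneg_right htau (sq_nonneg _)).trans (le_eigRed h0.le)
  · refine Or.inl (h₁ R k hR hb hacc hmu hAcc hΔ₁ (le_max_of_le_right ?_))
    calc ε / 2 * A.r * R.Δ k = ε / 2 * R.Δ k * A.r := by ring
      _ ≤ R.tauBarPlus P A k * R.Δ k * (R.Δ k + ‖R.cv P k‖) := by
        have := mul_le_mul_of_nonneg_right htau h0.le
        refine mul_le_mul this (by linarith) hr.le (le_trans (by positivity) this)

end Path

end SuccessfulSteps

/-! ### Open sets of nonstationary points. -/

section NonstationarySets

variable {d m : ℕ} {P : Problem d m} {D : Set (Vec d)} {C : Consts}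

/-- The points of `D` at which the Jacobian has full row rank. -/
def regularSet (P : Problem d m) (D : Set (Vec d)) : Set (Vec d) :=
  {x ∈ D | (P.jac x ∘L ContinuousLinearMap.adjoint (P.jac x)).IsInvertible}

/-- The points of the regular set with KKT residual larger than `ε`. -/
def kktSet (P : Problem d m) (D : Set (Vec d)) (ε : ℝ) : Set (Vec d) :=
  {x ∈ regularSet P D | ε < kktNorm (P.jac x) (P.grad x) (P.c x)}

/-- The points of the regular set at which the Lagrangian Hessian has a direction of curvature less
than `-ε` in the null space of the Jacobian. -/
def curvatureSet (P : Problem d m) (D : Set (Vec d)) (ε : ℝ) : Set (Vec d) :=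
  {x ∈ regularSet P D | ∃ u : Vec d, P.jac x u = 0 ∧
    inner ℝ u (P.lagHess (P.hess x) (multiplier (P.jac x) (P.grad x)) x u) < -ε * ‖u‖ ^ 2}

theorem continuousOn_of_norm_sub_le {E F : Type*} [SeminormedAddCommGroup E]
    [SeminormedAddCommGroup F] {s : Set E} {h : E → F} {L : ℝ}
    (hh : ∀ x ∈ s, ∀ y ∈ s, ‖h x - h y‖ ≤ L * ‖x - y‖) : ContinuousOn h s :=
  (LipschitzOnWith.of_dist_le_mul (K := L.toNNReal) fun x hx y hy => by
    rw [dist_eq_norm, dist_eq_norm]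
    exact (hh x hx y hy).trans (by gcongr; exact Real.le_coe_toNNReal L)).continuousOn

namespace Smooth

theorem continuousOn_gram (hP : Smooth P D C) :
    ContinuousOn (fun x => P.jac x ∘L ContinuousLinearMap.adjoint (P.jac x)) D := by
  have hj : ContinuousOn P.jac D := continuousOn_of_norm_sub_le hP.jac_lip
  exact hj.clm_comp (ContinuousLinearMap.adjoint.continuous.comp_continuousOn hj)

theorem isOpen_regularSet (hP : Smooth P D C) : IsOpen (regularSet P D) :=
  hP.continuousOn_gram.isOpen_inter_preimage hP.isOpen
    (ContinuousLinearEquiv.isOpen (𝕜 := ℝ) (E := Vec m) (F := Vec m))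

theorem continuousOn_multiplier (hP : Smooth P D C) {h : Vec d → Vec d}
    (hh : ContinuousOn h (regularSet P D)) :
    ContinuousOn (fun x => multiplier (P.jac x) (h x)) (regularSet P D) := by
  have hsub : regularSet P D ⊆ D := fun x hx => hx.1
  have hj : ContinuousOn P.jac (regularSet P D) :=
    (continuousOn_of_norm_sub_le hP.jac_lip).mono hsub
  have hinv : ContinuousOn (fun x => gramInv (P.jac x)) (regularSet P D) := by
    intro x hx
    have h1 : ContinuousAt ContinuousLinearMap.inverse
        (P.jac x ∘L ContinuousLinearMap.adjoint (P.jac x)) :=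
      (hx.2.contDiffAt_map_inverse (n := 0)).continuousAt
    exact h1.comp_continuousWithinAt
      (f := fun x => P.jac x ∘L ContinuousLinearMap.adjoint (P.jac x)) (hP.continuousOn_gram.mono hsub x hx)
  exact (hinv.clm_apply (hj.clm_apply hh)).neg

theorem continuousOn_lagGrad (hP : Smooth P D C) {h : Vec d → Vec d}
    (hh : ContinuousOn h (regularSet P D)) :
    ContinuousOn (fun x => lagGrad (P.jac x) (h x)) (regularSet P D) := by
  have hj : ContinuousOn P.jac (regularSet P D) :=
    (continuousOn_of_norm_sub_le hP.jac_lip).mono fun x hx => hx.1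
  exact hh.add ((ContinuousLinearMap.adjoint.continuous.comp_continuousOn hj).clm_apply
    (hP.continuousOn_multiplier hh))

/-- Openness serves measurability: the event that an iterate lies in the set must belong to the
filtration. -/
theorem isOpen_kktSet (hP : Smooth P D C) (ε : ℝ) : IsOpen (kktSet P D ε) := by
  have hg : ContinuousOn P.grad (regularSet P D) :=
    (continuousOn_of_norm_sub_le hP.grad_lip).mono fun x hx => hx.1
  have hc : ContinuousOn P.c (regularSet P D) :=
    hP.c_contDiff.continuousOn.mono fun x hx => hx.1
  have hk : ContinuousOn (fun x => kktNorm (P.jac x) (P.grad x) (P.c x)) (regularSet P D) :=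
    Real.continuous_sqrt.comp_continuousOn
      (((hP.continuousOn_lagGrad hg).norm.pow 2).add (hc.norm.pow 2))
  exact hk.isOpen_inter_preimage hP.isOpen_regularSet isOpen_Ioi

theorem isOpen_curvatureSet (hP : Smooth P D C) (ε : ℝ) : IsOpen (curvatureSet P D ε) := by
  have hsub : regularSet P D ⊆ D := fun x hx => hx.1
  have hg : ContinuousOn P.grad (regularSet P D) :=
    (continuousOn_of_norm_sub_le hP.grad_lip).mono hsub
  have hQ : ContinuousOn
      (fun x => P.lagHess (P.hess x) (multiplier (P.jac x) (P.grad x)) x) (regularSet P D) := by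
    refine ((continuousOn_of_norm_sub_le hP.hess_lip).mono hsub).add
      (continuousOn_finsetSum _ fun i _ => ?_)
    exact ((EuclideanSpace.proj (𝕜 := ℝ) i).continuous.comp_continuousOn
      (hP.continuousOn_multiplier hg)).smul
      ((continuousOn_of_norm_sub_le (hP.hessC_lip i)).mono hsub)
  -- A direction in the kernel of `P.jac x` varies with `x`. Projecting a fixed `w` onto the kernel
  -- gives a continuous function of `x`, so the existential becomes a union of open sets, and no
  -- continuity of eigenvalues is needed.
  have heq : curvatureSet P D ε = ⋃ w : Vec d, regularSet P D ∩ (fun x =>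
      inner ℝ (lagGrad (P.jac x) w) (P.lagHess (P.hess x) (multiplier (P.jac x) (P.grad x)) x
        (lagGrad (P.jac x) w)) + ε * ‖lagGrad (P.jac x) w‖ ^ 2) ⁻¹' Set.Iio 0 := by
    ext x
    simp only [curvatureSet, Set.mem_ofPred_eq, Set.mem_iUnion, Set.mem_inter_iff,
      Set.mem_preimage, Set.mem_Iio]
    constructor
    · rintro ⟨hx, u, hu, hlt⟩
      refine ⟨u, hx, ?_⟩
      rw [lagGrad_of_ker hu]
      linarith
    · rintro ⟨w, hx, hlt⟩
      exact ⟨hx, lagGrad (P.jac x) w, jac_lagGrad hx.2 w, by linarith⟩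
  rw [heq]
  refine isOpen_iUnion fun w => ?_
  have hw := hP.continuousOn_lagGrad (h := fun _ => w) continuousOn_const
  exact ((ContinuousOn.inner (𝕜 := ℝ) hw (hQ.clm_apply hw)).add ((hw.norm.pow 2).const_mul ε)).isOpen_inter_preimage
    hP.isOpen_regularSet isOpen_Iio

end Smooth

end NonstationarySets

/-! ### Pathwise decrease of the potential function. -/

section Potential

variable {d m : ℕ} {P : Problem d m} {A : Params d} {D : Set (Vec d)} {C : Consts}

theorem ups3_pos (hA : A.Valid) (hC : C.Valid) : 0 < ups3 A m C := by
  have hB : 0 < kappaB A m C := by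
    unfold kappaB
    split_ifs
    · exact zero_lt_one.trans_le hC.κB_ge
    · exact zero_lt_one.trans_le (le_max_left _ _)
  have := hA.κfcd_mem.1
  have := hA.κg_pos
  exact mul_pos (by positivity) (lt_max_of_lt_left (by positivity))

/-- Both bounds invert the condition on `ν / (1 - ν)`. The minimum with `ups3` can be replaced by
its first entry because it is positive. -/
theorem NuCondition.weights {ν : ℝ} (h : NuCondition A m C ν) (hA : A.Valid) (hC : C.Valid)
    (hν : ν ∈ Set.Ioo (0 : ℝ) 1) :
    2 * A.γ * ((1 - ν) / ν) ≤ A.η ∧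
      4 * A.γ ^ 3 * max 1 A.Δmax * ((1 - ν) / ν) ≤ A.η ^ 3 * A.κfcd := by
  have h0 := hν.1
  have h1 : 0 < 1 - ν := sub_pos.2 hν.2
  have hη := hA.η_mem.1
  have hκ := hA.κfcd_mem.1
  have hinv : ν / (1 - ν) * ((1 - ν) / ν) = 1 := by field_simp
  have hβ : 0 ≤ (1 - ν) / ν := by positivity
  obtain ⟨ha, hb⟩ := max_le_iff.1 h
  constructor
  · have := mul_le_mul_of_nonneg_right hb hβ
    rw [hinv, div_mul_eq_mul_div, div_le_one hη] at this
    exact this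
  · have := mul_le_mul_of_nonneg_right ha hβ
    have hm : 0 < min (A.η ^ 3 * A.κfcd) (ups3 A m C) := lt_min (by positivity) (ups3_pos hA hC)
    rw [hinv, div_mul_eq_mul_div, div_le_one hm] at this
    exact this.trans (min_le_left _ _)

/-- One hypothesis serves two purposes: absorbing the mean excess error, and giving the walk an
upward probability of at least one half. The latter is generous, since `γ > 1 > η` forces `β ≤ 1/2`.
-/
theorem probability_bounds (hA : A.Valid) {β : ℝ} (hβ : 0 ≤ β) (hγβ : 2 * A.γ * β ≤ A.η)
    (hp : A.ph + A.pg + 2 * A.pf ≤ β ^ 2 / 16 * (1 - 1 / A.γ) ^ 2) :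
    3 * √A.pf ≤ β * (1 - 1 / A.γ) ∧ A.ph + A.pg + A.pf + A.pf ≤ 1 / 2 := by
  have hγ := hA.γ_pos
  have hph := hA.ph_mem.1
  have hpg := hA.pg_mem.1
  have hpf := hA.pf_mem.1
  have h1 : 1 / A.γ ≤ 1 := (div_le_one hγ).2 hA.γ_gt.le
  have h2 : 0 ≤ 1 - 1 / A.γ := sub_nonneg.2 h1
  have h3 : 1 - 1 / A.γ ≤ 1 := sub_le_self _ (by positivity)
  have h4 : 0 ≤ β * (1 - 1 / A.γ) := mul_nonneg hβ h2
  constructor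
  · refine le_of_sq_le_sq ?_ h4
    rw [mul_pow, Real.sq_sqrt hpf.le]
    nlinarith [sq_nonneg (β * (1 - 1 / A.γ))]
  · have h5 : β ≤ 1 / 2 := by
      have := hA.η_mem.2
      have := hA.γ_gt
      nlinarith
    have h6 : β * (1 - 1 / A.γ) ≤ 1 / 2 := by nlinarith
    nlinarith

namespace Path

/-- The potential function `f - f_inf + μ ‖c‖ + (β/4) Δ^(α+2) + β ε̄`. -/
noncomputable def potential (P : Problem d m) (A : Params d) (C : Consts) (β : ℝ) (R : Path d m)
    (k : ℕ) (μ : ℝ) : ℝ :=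
  P.f (R.x k) - C.finf + μ * ‖R.cv P k‖ + β / 4 * R.Δ k ^ (A.α + 2) + β * R.ε k

open Classical in
/-- The part of the errors of the function estimates that exceeds the accuracy requirement. -/
noncomputable def excessErr (P : Problem d m) (A : Params d) (R : Path d m) (k : ℕ) : ℝ :=
  (if R.Acc P A k → max |R.fk k - P.f (R.x k)| |R.fs k - P.f (R.x k + R.dx k)| ≤
      A.κf * R.Δ k ^ (A.α + 2) then 0 else
    |R.fk k - P.f (R.x k)| + |R.fs k - P.f (R.x k + R.dx k)|) +
  (if R.SocUsed P A k → |R.fsoc k - P.f (R.x k + R.dx k + R.soc P k)| ≤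
      A.κf * R.Δ k ^ (A.α + 2) then 0 else
    |R.fsoc k - P.f (R.x k + R.dx k + R.soc P k)|)

variable {R : Path d m} {k : ℕ}

theorem excessErr_nonneg : 0 ≤ excessErr P A R k := by
  unfold excessErr; split_ifs <;> positivity

/-- Accurate estimates are covered by the first term; inaccurate ones enter `excessErr` in full. No
accuracy event is assumed, so the potential argument applies to every iteration. -/
theorem abs_errors_le_of_acc (hA : A.Valid) (hΔ : 0 < R.Δ k) (hk : R.Acc P A k) :
    |R.fk k - P.f (R.x k)| + |R.fs k - P.f (R.x k + R.dx k)| ≤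
      2 * (A.κf * R.Δ k ^ (A.α + 2)) + excessErr P A R k := by
  have := hA.κf_pos
  unfold excessErr
  split_ifs with h1 h2 h2
  all_goals try have h3 := max_le_iff.1 (h1 hk)
  · linarith
  · have := abs_nonneg (R.fsoc k - P.f (R.x k + R.dx k + R.soc P k))
    linarith
  · have : 0 ≤ 2 * (A.κf * R.Δ k ^ (A.α + 2)) := by positivity
    linarith
  · have : 0 ≤ 2 * (A.κf * R.Δ k ^ (A.α + 2)) := by positivity
    have := abs_nonneg (R.fsoc k - P.f (R.x k + R.dx k + R.soc P k))
    linarith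

theorem abs_errors_le_of_soc (hA : A.Valid) (hΔ : 0 < R.Δ k) (hk : R.SocUsed P A k) :
    |R.fk k - P.f (R.x k)| + |R.fsoc k - P.f (R.x k + R.dx k + R.soc P k)| ≤
      2 * (A.κf * R.Δ k ^ (A.α + 2)) + excessErr P A R k := by
  have := hA.κf_pos
  have h0 : 0 ≤ A.κf * R.Δ k ^ (A.α + 2) := by positivity
  unfold excessErr
  split_ifs with h1 h2 h2
  all_goals try have h3 := max_le_iff.1 (h1 hk.1)
  all_goals try have h4 := h2 hk
  all_goals try have h5 := abs_nonneg (R.fs k - P.f (R.x k + R.dx k))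
  all_goals linarith

/-- A successful iteration decreases the merit function by a fraction of the predicted reduction,
up to the excess error. -/
theorem IsRun.merit_decrease (hR : R.IsRun P A) (hA : A.Valid) (hs : R.Success P A k) :
    P.f (R.x (k + 1)) + R.mu k * ‖R.cv P (k + 1)‖ - (P.f (R.x k) + R.mu k * ‖R.cv P k‖) ≤
      3 / 4 * (A.η * R.pred P k (R.mu k)) + excessErr P A R k := by
  obtain ⟨hAcc, hcase⟩ := hs
  have hneg := hR.pred_neg hA hAcc
  have hΔ := (hR.Δ_mem hA k).1
  have hη := hA.η_mem.1
  have hM : 0 < max 1 A.Δmax := by positivity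
  -- The upper bound on `κf` is calibrated so that tolerated errors consume at most a quarter of `η
  -- |Pred|`, leaving three quarters.
  have hsmall : 2 * (A.κf * R.Δ k ^ (A.α + 2)) ≤ -(1 / 4 * (A.η * R.pred P k (R.mu k))) := by
    have h1 := mul_le_mul_of_nonneg_left (hR.pred_le_pow hA hAcc) hη.le
    have h2 := mul_le_mul_of_nonneg_right hA.κf_le (pow_nonneg hΔ.le (A.α + 2))
    have h3 : A.κfcd * A.η ^ 3 / (16 * max 1 A.Δmax) * R.Δ k ^ (A.α + 2) =
        1 / 8 * (A.η * (A.κfcd / 2 * (A.η ^ 2 / max 1 A.Δmax * R.Δ k ^ (A.α + 2)))) := by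
      field_simp
      ring
    rw [h3] at h2
    linarith
  by_cases hacc : R.Accept P A k
  · have h1 := (le_div_iff_of_neg hneg).1 hacc
    have h2 := abs_errors_le_of_acc hA hΔ hAcc
    rw [cv, hR.x_accept k hAcc hacc]
    have h3 := neg_abs_le (R.fs k - P.f (R.x k + R.dx k))
    have h4 := le_abs_self (R.fk k - P.f (R.x k))
    unfold ared at h1
    linarith
  · obtain ⟨hsoc, hacs⟩ := hcase.resolve_left hacc
    have h1 := (le_div_iff_of_neg hneg).1 hacs
    have h2 := abs_errors_le_of_soc hA hΔ hsoc
    rw [cv, hR.x_accept_soc k hsoc hacs]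
    have h3 := neg_abs_le (R.fsoc k - P.f (R.x k + R.dx k + R.soc P k))
    have h4 := le_abs_self (R.fk k - P.f (R.x k))
    unfold ared at h1
    linarith

/-- Up to the excess error, every iteration decreases the potential function by a fixed fraction of
`(β/4) Δ^(α+2) + β ε̄`. -/
theorem IsRun.potential_decrease (hR : R.IsRun P A) (hA : A.Valid) {β : ℝ} (hβ : 0 ≤ β)
    (hγβ : 2 * A.γ * β ≤ A.η)
    (hMβ : 4 * A.γ ^ 3 * max 1 A.Δmax * β ≤ A.η ^ 3 * A.κfcd) :
    potential P A C β R (k + 1) (R.mu k) +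
        (1 - 1 / A.γ) * (β / 4 * R.Δ k ^ (A.α + 2) + β * R.ε k) ≤
      potential P A C β R k (R.mu k) + excessErr P A R k := by
  obtain ⟨hΔ, -⟩ := hR.Δ_mem hA k
  have hε := hR.ε_pos hA k
  have hγ := hA.γ_pos
  have hγ1 := hA.γ_gt
  have hγinv : 1 / A.γ ≤ 1 := (div_le_one hγ).2 hγ1.le
  have hM : 0 < max 1 A.Δmax := by positivity
  have hκ := hA.κfcd_mem.1
  have hη := hA.η_mem.1
  set T := R.Δ k ^ (A.α + 2)
  have hT : 0 < T := by positivity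
  unfold potential
  by_cases hs : R.Success P A k
  · have hmer := hR.merit_decrease hA hs
    have hneg := hR.pred_neg hA hs.1
    have hpred := hR.pred_le_pow hA hs.1
    have hΔ' : R.Δ (k + 1) ^ (A.α + 2) ≤ A.γ ^ 3 * T := by
      have hle : R.Δ (k + 1) ≤ A.γ * R.Δ k := by rw [hR.Δ_success k hs]; exact min_le_left _ _
      calc R.Δ (k + 1) ^ (A.α + 2) ≤ (A.γ * R.Δ k) ^ (A.α + 2) := by
            have := (hR.Δ_mem hA (k + 1)).1
            gcongr
        _ = A.γ ^ (A.α + 2) * T := mul_pow _ _ _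
        _ ≤ A.γ ^ 3 * T := by
          gcongr
          · exact hγ1.le
          · rcases hA.α_mem with h | h <;> omega
    -- Of the remaining `¾ η |Pred|`, one quarter pays for the radius and, in `hrel`, one half for
    -- the reliability parameter. The exponent of `γ` is `α + 2 ≤ 3`.
    have hrad : β / 4 * (A.γ ^ 3 * T) ≤ -(1 / 4 * (A.η * R.pred P k (R.mu k))) := by
      have h1 : β * A.γ ^ 3 ≤ A.η ^ 3 * A.κfcd / (4 * max 1 A.Δmax) := by
        rw [le_div_iff₀ (by positivity)]; linarith
      have h2 := mul_le_mul_of_nonneg_right h1 hT.le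
      have h3 := mul_le_mul_of_nonneg_left hpred hη.le
      have h4 : A.η ^ 3 * A.κfcd / (4 * max 1 A.Δmax) * T =
          1 / 2 * (A.η * (A.κfcd / 2 * (A.η ^ 2 / max 1 A.Δmax * T))) := by
        field_simp
        ring
      rw [h4] at h2
      have h5 : 0 ≤ A.η * (A.κfcd / 2 * (A.η ^ 2 / max 1 A.Δmax * T)) := by positivity
      linarith
    have hrel : β * R.ε (k + 1) + (1 - 1 / A.γ) * (β * R.ε k) ≤
        β * R.ε k - 1 / 2 * (A.η * R.pred P k (R.mu k)) := by
      -- `ε̄` grows only when `|Pred|` dominates it, so `β γ ε̄ ≤ (η/2) |Pred|`; otherwise its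
      -- division by `γ` is exactly the claimed decrease.
      by_cases hr : R.ε k ≤ -R.pred P k (R.mu k)
      · rw [hR.ε_reliable k hs hr]
        have h1 : 0 ≤ 1 / A.γ * (β * R.ε k) := by positivity
        have h2 : β * (A.γ * R.ε k) ≤ A.η / 2 * R.ε k := by nlinarith
        have h3 : A.η / 2 * R.ε k ≤ A.η / 2 * -R.pred P k (R.mu k) := by gcongr
        linarith
      · rw [hR.ε_unreliable k hs hr]
        have h1 : β * (R.ε k / A.γ) = 1 / A.γ * (β * R.ε k) := by ring
        have h2 : A.η * R.pred P k (R.mu k) ≤ 0 := mul_nonpos_of_nonneg_of_nonpos hη.le hneg.le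
        linarith
    have h6 : β / 4 * R.Δ (k + 1) ^ (A.α + 2) ≤ β / 4 * (A.γ ^ 3 * T) := by gcongr
    have h7 : 0 ≤ 1 / A.γ * (β / 4 * T) := by positivity
    linarith
  · obtain ⟨hx, hΔ', hε'⟩ := hR.unsuccessful k hs
    have h1 : R.Δ (k + 1) ^ (A.α + 2) ≤ 1 / A.γ * T := by
      rw [hΔ', div_pow, div_eq_inv_mul, one_div]
      gcongr
      exact le_self_pow₀ hγ1.le (by omega)
    have h2 : β / 4 * R.Δ (k + 1) ^ (A.α + 2) ≤ β / 4 * (1 / A.γ * T) := by gcongr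
    have h3 : R.cv P (k + 1) = R.cv P k := by rw [cv, cv, hx]
    have h4 := excessErr_nonneg (P := P) (A := A) (R := R) (k := k)
    rw [h3, hx, hε']
    have h5 : β * (R.ε k / A.γ) = 1 / A.γ * (β * R.ε k) := by ring
    linarith

/-- Telescoped form of the decrease of the potential function, while the merit parameter is
constant. -/
theorem IsRun.sum_decrease_le (hR : R.IsRun P A) (hA : A.Valid) (hP : Smooth P D C)
    (hb : BoundedAlong P A D C R) {β : ℝ} (hβ : 0 ≤ β) (hγβ : 2 * A.γ * β ≤ A.η)
    (hMβ : 4 * A.γ ^ 3 * max 1 A.Δmax * β ≤ A.η ^ 3 * A.κfcd) (K n : ℕ)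
    (hmu : ∀ i < n, R.mu (K + i) = R.mu K) :
    ∑ i ∈ Finset.range n, ((1 - 1 / A.γ) * (β / 4 * R.Δ (K + i) ^ (A.α + 2) + β * R.ε (K + i)) -
      excessErr P A R (K + i)) ≤ potential P A C β R K (R.mu K) := by
  have hsum : ∑ i ∈ Finset.range n,
      ((1 - 1 / A.γ) * (β / 4 * R.Δ (K + i) ^ (A.α + 2) + β * R.ε (K + i)) -
        excessErr P A R (K + i)) ≤
      potential P A C β R K (R.mu K) - potential P A C β R (K + n) (R.mu K) := by
    have htel := Finset.sum_range_sub' (fun i => potential P A C β R (K + i) (R.mu K)) n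
    rw [add_zero] at htel
    rw [← htel]
    refine Finset.sum_le_sum fun i hi => ?_
    have := hR.potential_decrease (C := C) (k := K + i) hA hβ hγβ hMβ
    rw [hmu i (Finset.mem_range.1 hi)] at this
    have h2 : K + (i + 1) = K + i + 1 := rfl
    rw [h2]
    linarith
  have hnonneg : 0 ≤ potential P A C β R (K + n) (R.mu K) := by
    have h1 := hP.f_bdd _ (hb.x_mem (K + n))
    have h2 := hR.ε_pos hA (K + n)
    have h3 := (hR.Δ_mem hA (K + n)).1
    have h4 := hR.mu_pos hA K
    have h5 : 0 ≤ P.f (R.x (K + n)) - C.finf := sub_nonneg.2 h1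
    unfold potential
    positivity
  linarith

end Path

end Potential

/-! ### Conditional moment bounds, union bounds and random walks. -/

section ConditionalProbability

variable {Ω : Type*} {m mΩ : MeasurableSpace Ω} {μ : Measure Ω} [IsProbabilityMeasure μ]

theorem integral_mul_condExp_of_bound (hm : m ≤ mΩ) {W Y : Ω → ℝ} (hW : StronglyMeasurable[m] W)
    (hY : Integrable Y μ) {b : ℝ} (hb : ∀ᵐ ω ∂μ, ‖W ω‖ ≤ b) :
    ∫ ω, W ω * Y ω ∂μ = ∫ ω, W ω * (μ[Y | m]) ω ∂μ := by
  have h := condExp_stronglyMeasurable_mul_of_bound hm hW hY b hb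
  calc ∫ ω, W ω * Y ω ∂μ = ∫ ω, (μ[W * Y | m]) ω ∂μ := (integral_condExp hm).symm
    _ = _ := integral_congr_ae h

theorem integral_mul_le_of_condExp_le (hm : m ≤ mΩ) {W Y y : Ω → ℝ} (hW : StronglyMeasurable[m] W)
    (hW0 : ∀ᵐ ω ∂μ, 0 ≤ W ω) (hY : Integrable Y μ) {b : ℝ} (hb : ∀ᵐ ω ∂μ, ‖W ω‖ ≤ b)
    (hy : Integrable (fun ω => W ω * y ω) μ) (hYy : ∀ᵐ ω ∂μ, (μ[Y | m]) ω ≤ y ω) :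
    ∫ ω, W ω * Y ω ∂μ ≤ ∫ ω, W ω * y ω ∂μ := by
  rw [integral_mul_condExp_of_bound hm hW hY hb]
  refine integral_mono_ae
    (integrable_condExp.bdd_mul (hW.mono hm).aestronglyMeasurable hb) hy ?_
  filter_upwards [hW0, hYy] with ω h0 h1
  exact mul_le_mul_of_nonneg_left h1 h0

theorem integrable_indicator_of_le_condExp {E : Set Ω} {p : ℝ} (hp : p < 1)
    (h : ∀ᵐ ω ∂μ, 1 - p ≤ (μ[E.indicator (fun _ => (1 : ℝ)) | m]) ω) :
    Integrable (E.indicator fun _ => (1 : ℝ)) μ := by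
  -- The event is not assumed measurable. A non-integrable indicator would have conditional
  -- expectation `0` by convention, contradicting `0 < 1 - p`.
  by_contra hc
  rw [condExp_of_not_integrable hc] at h
  obtain ⟨ω, hω⟩ := h.exists
  simp only [Pi.zero_apply] at hω
  linarith

theorem compl_indicator_one_eq (E : Set Ω) :
    (Eᶜ.indicator fun _ => (1 : ℝ)) = (fun _ => (1 : ℝ)) - E.indicator fun _ => (1 : ℝ) := by
  rw [Set.indicator_compl]

theorem integrable_compl_indicator_one {E : Set Ω}
    (h : Integrable (E.indicator fun _ => (1 : ℝ)) μ) :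
    Integrable (Eᶜ.indicator fun _ => (1 : ℝ)) μ := by
  rw [compl_indicator_one_eq]
  exact (integrable_const _).sub h

theorem condExp_compl_indicator_le (hm : m ≤ mΩ) {E : Set Ω} {p : ℝ} (hp : p < 1)
    (h : ∀ᵐ ω ∂μ, 1 - p ≤ (μ[E.indicator (fun _ => (1 : ℝ)) | m]) ω) :
    ∀ᵐ ω ∂μ, (μ[Eᶜ.indicator (fun _ => (1 : ℝ)) | m]) ω ≤ p := by
  rw [compl_indicator_one_eq]
  have h1 := condExp_sub (m := m) (integrable_const (1 : ℝ))
    (integrable_indicator_of_le_condExp hp h)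
  filter_upwards [h, h1] with ω h h1
  rw [h1, Pi.sub_apply, condExp_const hm]
  linarith

theorem integrable_of_integrable_sq {X : Ω → ℝ} (hX : ∀ ω, 0 ≤ X ω)
    (h : Integrable (fun ω => X ω ^ 2) μ) : Integrable X μ := by
  have hmeas : AEStronglyMeasurable X μ := by
    have := Real.continuous_sqrt.comp_aestronglyMeasurable h.aestronglyMeasurable
    refine this.congr (Eventually.of_forall fun ω => ?_)
    exact Real.sqrt_sq (hX ω)
  refine ((integrable_const (1 : ℝ)).add h).mono' hmeas (Eventually.of_forall fun ω => ?_)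
  rw [Real.norm_of_nonneg (hX ω), Pi.add_apply]
  nlinarith [sq_nonneg (X ω - 1), hX ω]

theorem indicator_compl_eq_mul (E : Set Ω) (X : Ω → ℝ) :
    Eᶜ.indicator X = fun ω => Eᶜ.indicator (fun _ => (1 : ℝ)) ω * X ω := by
  funext ω
  by_cases h : ω ∈ Eᶜ <;> simp only [h, Set.indicator_of_mem, Set.indicator_of_notMem,
    not_false_eq_true, one_mul, zero_mul]

theorem norm_indicator_one_le (E : Set Ω) (ω : Ω) :
    ‖E.indicator (fun _ => (1 : ℝ)) ω‖ ≤ 1 :=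
  (norm_indicator_le_norm_self (fun _ => (1 : ℝ)) ω).trans (by simp)

theorem integrable_compl_indicator_of_sq {E : Set Ω} {X : Ω → ℝ}
    (hE : Integrable (E.indicator fun _ => (1 : ℝ)) μ) (hX : ∀ ω, 0 ≤ X ω)
    (h : Integrable (fun ω => X ω ^ 2) μ) : Integrable (Eᶜ.indicator X) μ := by
  rw [indicator_compl_eq_mul]
  exact (integrable_of_integrable_sq hX h).bdd_mul
    (integrable_compl_indicator_one hE).aestronglyMeasurable
    (Eventually.of_forall (norm_indicator_one_le _))

/-- A conditional Cauchy–Schwarz inequality: on an event of conditional probability at most `p`, a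
nonnegative variable with conditional second moment at most `s²` has mean at most `√p s`. -/
theorem integral_indicator_compl_indicator_le (hm : m ≤ mΩ) {Z E : Set Ω} {X s : Ω → ℝ} {p a b : ℝ}
    (hZ : MeasurableSet[m] Z) (hs : StronglyMeasurable[m] s) (ha : 0 < a)
    (hab : ∀ᵐ ω ∂μ, a ≤ s ω ∧ s ω ≤ b) (hp0 : 0 < p) (hp1 : p < 1)
    (hE : ∀ᵐ ω ∂μ, 1 - p ≤ (μ[E.indicator (fun _ => (1 : ℝ)) | m]) ω)
    (hX : ∀ ω, 0 ≤ X ω) (hX2 : Integrable (fun ω => X ω ^ 2) μ)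
    (hmom : ∀ᵐ ω ∂μ, (μ[fun ω => X ω ^ 2 | m]) ω ≤ s ω ^ 2) :
    ∫ ω, Z.indicator (Eᶜ.indicator X) ω ∂μ ≤ √p * ∫ ω, Z.indicator s ω ∂μ := by
  set q := √p
  have hq : 0 < q := Real.sqrt_pos.2 hp0
  have hq2 : q ^ 2 = p := Real.sq_sqrt hp0.le
  -- Weights for the pointwise inequality `X ≤ V X² + W` on `Z ∩ Eᶜ`, which is `(q X - s)² ≥ 0`.
  -- They are chosen so that each term contributes at most half of `q s` in the mean; the bounds `a
  -- ≤ s ≤ b` keep them bounded.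
  set V : Ω → ℝ := Z.indicator fun ω => q / (2 * s ω)
  set W : Ω → ℝ := Z.indicator fun ω => s ω / (2 * q)
  have hVm : StronglyMeasurable[m] V :=
    ((hs.measurable.const_mul 2).const_div q).stronglyMeasurable.indicator hZ
  have hWm : StronglyMeasurable[m] W := (hs.measurable.div_const _).stronglyMeasurable.indicator hZ
  have hV0 : ∀ᵐ ω ∂μ, 0 ≤ V ω := by
    filter_upwards [hab] with ω h
    have : 0 < s ω := ha.trans_le h.1
    exact Set.indicator_apply_nonneg fun _ => by positivity
  have hW0 : ∀ᵐ ω ∂μ, 0 ≤ W ω := by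
    filter_upwards [hab] with ω h
    have : 0 < s ω := ha.trans_le h.1
    exact Set.indicator_apply_nonneg fun _ => by positivity
  have hVb : ∀ᵐ ω ∂μ, ‖V ω‖ ≤ q / (2 * a) := by
    filter_upwards [hab] with ω h
    have : 0 < s ω := ha.trans_le h.1
    refine (norm_indicator_le_norm_self _ _).trans ?_
    rw [Real.norm_of_nonneg (by positivity)]
    gcongr
    exact h.1
  have hWb : ∀ᵐ ω ∂μ, ‖W ω‖ ≤ b / (2 * q) := by
    filter_upwards [hab] with ω h
    have : 0 < s ω := ha.trans_le h.1
    refine (norm_indicator_le_norm_self _ _).trans ?_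
    rw [Real.norm_of_nonneg (by positivity)]
    gcongr
    exact h.2
  have hsint : Integrable s μ := by
    refine (integrable_const b).mono' (hs.mono hm).aestronglyMeasurable ?_
    filter_upwards [hab] with ω h
    rw [Real.norm_of_nonneg (ha.le.trans h.1)]
    exact h.2
  have hZs : Integrable (Z.indicator s) μ := hsint.indicator (hm _ hZ)
  have hVs : (fun ω => V ω * s ω ^ 2) =ᵐ[μ] fun ω => q / 2 * Z.indicator s ω := by
    filter_upwards [hab] with ω h
    have : s ω ≠ 0 := (ha.trans_le h.1).ne'
    by_cases hω : ω ∈ Z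
    · simp only [V, Set.indicator_of_mem hω]; field_simp
    · simp only [V, Set.indicator_of_notMem hω]; ring
  have hWs : (fun ω => W ω * p) = fun ω => q / 2 * Z.indicator s ω := by
    funext ω
    by_cases hω : ω ∈ Z
    · simp only [W, Set.indicator_of_mem hω]; rw [← hq2]; field_simp
    · simp only [W, Set.indicator_of_notMem hω]; ring
  have hEi := integrable_indicator_of_le_condExp hp1 hE
  have hEc := integrable_compl_indicator_one hEi
  have h1 : ∫ ω, V ω * X ω ^ 2 ∂μ ≤ q / 2 * ∫ ω, Z.indicator s ω ∂μ := by
    rw [← integral_const_mul, ← integral_congr_ae hVs]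
    exact integral_mul_le_of_condExp_le hm hVm hV0 hX2 hVb
      ((integrable_congr hVs).2 (hZs.const_mul _)) hmom
  have h2 : ∫ ω, W ω * Eᶜ.indicator (fun _ => (1 : ℝ)) ω ∂μ ≤
      q / 2 * ∫ ω, Z.indicator s ω ∂μ := by
    rw [← integral_const_mul, ← hWs]
    refine integral_mul_le_of_condExp_le hm hWm hW0 hEc hWb ?_ (condExp_compl_indicator_le hm hp1 hE)
    rw [hWs]
    exact hZs.const_mul _
  have hi1 : Integrable (fun ω => V ω * X ω ^ 2) μ :=
    hX2.bdd_mul (hVm.mono hm).aestronglyMeasurable hVb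
  have hi2 : Integrable (fun ω => W ω * Eᶜ.indicator (fun _ => (1 : ℝ)) ω) μ :=
    hEc.bdd_mul (hWm.mono hm).aestronglyMeasurable hWb
  calc ∫ ω, Z.indicator (Eᶜ.indicator X) ω ∂μ
      ≤ ∫ ω, (V ω * X ω ^ 2 + W ω * Eᶜ.indicator (fun _ => (1 : ℝ)) ω) ∂μ := by
        refine integral_mono_ae ((integrable_compl_indicator_of_sq hEi hX hX2).indicator (hm _ hZ))
          (hi1.add hi2) ?_
        filter_upwards [hab, hV0, hW0] with ω h hv hw
        have hs0 : 0 < s ω := ha.trans_le h.1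
        by_cases hω : ω ∈ Z
        · by_cases hωE : ω ∈ Eᶜ
          · simp only [V, W, Set.indicator_of_mem hω, Set.indicator_of_mem hωE]
            have : q / (2 * s ω) * X ω ^ 2 + s ω / (2 * q) * 1 - X ω =
                (q * X ω - s ω) ^ 2 / (2 * q * s ω) := by field_simp; ring
            have h3 : 0 ≤ (q * X ω - s ω) ^ 2 / (2 * q * s ω) := by positivity
            linarith
          · simp only [Set.indicator_of_mem hω, Set.indicator_of_notMem hωE]
            have := mul_nonneg hv (sq_nonneg (X ω))
            linarith
        · rw [Set.indicator_of_notMem hω]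
          have := mul_nonneg hv (sq_nonneg (X ω))
          have := mul_nonneg hw (Set.indicator_nonneg (s := Eᶜ) (f := fun _ => (1 : ℝ))
            (fun _ _ => zero_le_one) ω)
          linarith
    _ = ∫ ω, V ω * X ω ^ 2 ∂μ + ∫ ω, W ω * Eᶜ.indicator (fun _ => (1 : ℝ)) ω ∂μ :=
        integral_add hi1 hi2
    _ ≤ q * ∫ ω, Z.indicator s ω ∂μ := by linarith

theorem le_condExp_of_le_condExp {m' : MeasurableSpace Ω} (hmm : m ≤ m') (hm' : m' ≤ mΩ)
    {Y : Ω → ℝ} {a : ℝ} (h : ∀ᵐ ω ∂μ, a ≤ (μ[Y | m']) ω) : ∀ᵐ ω ∂μ, a ≤ (μ[Y | m]) ω := by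
  have h1 : μ[fun _ => a | m] ≤ᵐ[μ] μ[μ[Y | m'] | m] :=
    condExp_mono (integrable_const a) integrable_condExp h
  filter_upwards [h1, condExp_condExp_of_le (f := Y) (μ := μ) hmm hm'] with ω h1 h2
  rwa [h2, condExp_const (hmm.trans hm')] at h1

/-- Union bound for conditional probabilities. -/
theorem le_condExp_indicator_of_inter_subset (hm : m ≤ mΩ) {E₁ E₂ E₃ E₄ S : Set Ω}
    {p₁ p₂ p₃ p₄ : ℝ} (hp₁ : p₁ < 1) (hp₂ : p₂ < 1) (hp₃ : p₃ < 1) (hp₄ : p₄ < 1)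
    (h₁ : ∀ᵐ ω ∂μ, 1 - p₁ ≤ (μ[E₁.indicator (fun _ => (1 : ℝ)) | m]) ω)
    (h₂ : ∀ᵐ ω ∂μ, 1 - p₂ ≤ (μ[E₂.indicator (fun _ => (1 : ℝ)) | m]) ω)
    (h₃ : ∀ᵐ ω ∂μ, 1 - p₃ ≤ (μ[E₃.indicator (fun _ => (1 : ℝ)) | m]) ω)
    (h₄ : ∀ᵐ ω ∂μ, 1 - p₄ ≤ (μ[E₄.indicator (fun _ => (1 : ℝ)) | m]) ω)
    (hS : MeasurableSet S)
    (hsub : ∀ᵐ ω ∂μ, ω ∈ E₁ → ω ∈ E₂ → ω ∈ E₃ → ω ∈ E₄ → ω ∈ S) :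
    ∀ᵐ ω ∂μ, 1 - (p₁ + p₂ + p₃ + p₄) ≤ (μ[S.indicator (fun _ => (1 : ℝ)) | m]) ω := by
  have i₁ := integrable_compl_indicator_one (integrable_indicator_of_le_condExp hp₁ h₁)
  have i₂ := integrable_compl_indicator_one (integrable_indicator_of_le_condExp hp₂ h₂)
  have i₃ := integrable_compl_indicator_one (integrable_indicator_of_le_condExp hp₃ h₃)
  have i₄ := integrable_compl_indicator_one (integrable_indicator_of_le_condExp hp₄ h₄)
  have iS : Integrable (S.indicator fun _ => (1 : ℝ)) μ := (integrable_const _).indicator hS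
  have hle : (fun _ => (1 : ℝ)) - S.indicator (fun _ => (1 : ℝ)) ≤ᵐ[μ]
      E₁ᶜ.indicator (fun _ => (1 : ℝ)) + E₂ᶜ.indicator (fun _ => (1 : ℝ)) +
        E₃ᶜ.indicator (fun _ => (1 : ℝ)) + E₄ᶜ.indicator (fun _ => (1 : ℝ)) := by
    filter_upwards [hsub] with ω h
    have hnn : ∀ E : Set Ω, 0 ≤ E.indicator (fun _ => (1 : ℝ)) ω := fun E =>
      Set.indicator_nonneg (fun _ _ => zero_le_one) ω
    have hone : ∀ E : Set Ω, ω ∉ E → Eᶜ.indicator (fun _ => (1 : ℝ)) ω = 1 := fun E hE =>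
      Set.indicator_of_mem (show ω ∈ Eᶜ from hE) _
    have n₁ := hnn E₁ᶜ
    have n₂ := hnn E₂ᶜ
    have n₃ := hnn E₃ᶜ
    have n₄ := hnn E₄ᶜ
    have nS := hnn S
    simp only [Pi.sub_apply, Pi.add_apply]
    by_cases e₁ : ω ∈ E₁
    · by_cases e₂ : ω ∈ E₂
      · by_cases e₃ : ω ∈ E₃
        · by_cases e₄ : ω ∈ E₄
          · rw [Set.indicator_of_mem (h e₁ e₂ e₃ e₄)]; linarith
          · linarith [hone _ e₄]
        · linarith [hone _ e₃]
      · linarith [hone _ e₂]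
    · linarith [hone _ e₁]
  have hmono := condExp_mono (m := m) ((integrable_const _).sub iS) (((i₁.add i₂).add i₃).add i₄) hle
  filter_upwards [hmono, condExp_sub (m := m) (integrable_const (1 : ℝ)) iS,
    condExp_add (m := m) ((i₁.add i₂).add i₃) i₄, condExp_add (m := m) (i₁.add i₂) i₃,
    condExp_add (m := m) i₁ i₂, condExp_compl_indicator_le hm hp₁ h₁,
    condExp_compl_indicator_le hm hp₂ h₂, condExp_compl_indicator_le hm hp₃ h₃,
    condExp_compl_indicator_le hm hp₄ h₄] with ω h0 hs ha hb hc c₁ c₂ c₃ c₄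
  rw [hs, ha, Pi.sub_apply, Pi.add_apply, hb, Pi.add_apply, hc, Pi.add_apply,
    condExp_const hm] at h0
  linarith

/-- A walk whose steps are `+1` with conditional probability at least one half, and `-1` otherwise,
is almost surely unbounded above. -/
theorem ae_not_bddAbove_walk {ℱ : Filtration ℕ mΩ} {S : ℕ → Set Ω}
    (hS : ∀ k, MeasurableSet[ℱ (k + 1)] (S k))
    (h : ∀ k, ∀ᵐ ω ∂μ, 1 / 2 ≤ (μ[(S k).indicator (fun _ => (1 : ℝ)) | ℱ k]) ω) :
    ∀ᵐ ω ∂μ, ¬ BddAbove (Set.range fun n : ℕ =>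
      ∑ i ∈ Finset.range n, (2 * (S i).indicator (fun _ => (1 : ℝ)) ω - 1)) := by
  set f : ℕ → Ω → ℝ := fun n ω =>
    ∑ i ∈ Finset.range n, (2 * (S i).indicator (fun _ => (1 : ℝ)) ω - 1)
  have hstep : ∀ n ω, f (n + 1) ω - f n ω = 2 * (S n).indicator (fun _ => (1 : ℝ)) ω - 1 :=
    fun n ω => by
    simp only [f, Finset.sum_range_succ, add_sub_cancel_left]
  have hSi : ∀ k, Integrable ((S k).indicator fun _ => (1 : ℝ)) μ := fun k =>
    (integrable_const _).indicator (ℱ.le _ _ (hS k))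
  have habs : ∀ n ω, |f (n + 1) ω - f n ω| = 1 := by
    intro n ω
    rw [hstep]
    by_cases hω : ω ∈ S n
    · rw [Set.indicator_of_mem hω]; norm_num
    · rw [Set.indicator_of_notMem hω]; norm_num
  have hadp : StronglyAdapted ℱ f := by
    intro n
    refine Finset.stronglyMeasurable_fun_sum _ fun i hi => ?_
    have h1 : StronglyMeasurable[ℱ n] ((S i).indicator fun _ => (1 : ℝ)) :=
      stronglyMeasurable_const.indicator
        (ℱ.mono (Nat.succ_le_of_lt (Finset.mem_range.1 hi)) _ (hS i))
    exact (h1.const_mul 2).sub stronglyMeasurable_const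
  have hint : ∀ n, Integrable (f n) μ := fun n =>
    integrable_finsetSum _ fun i _ => ((hSi i).const_mul 2).sub (integrable_const 1)
  have hsub : Submartingale f ℱ μ := by
    refine submartingale_of_condExp_sub_nonneg_nat hadp hint fun k => ?_
    have heq : f (k + 1) - f k =
        (2 : ℝ) • (S k).indicator (fun _ => (1 : ℝ)) - fun _ => (1 : ℝ) := by
      funext ω
      exact hstep k ω
    rw [heq]
    filter_upwards [h k, condExp_sub (m := ℱ k) ((hSi k).smul (2 : ℝ)) (integrable_const 1),
      condExp_smul (2 : ℝ) ((S k).indicator fun _ => (1 : ℝ)) (ℱ k) (μ := μ)] with ω h1 h2 h3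
    rw [h2, Pi.sub_apply, h3, condExp_const (ℱ.le k)]
    simp only [Pi.zero_apply, Pi.smul_apply, smul_eq_mul]
    linarith
  -- A submartingale with bounded increments is almost surely bounded above exactly where it
  -- converges, and steps of modulus one exclude convergence.
  filter_upwards [hsub.bddAbove_iff_exists_tendsto (R := 1)
    (Eventually.of_forall fun ω i => by rw [habs]; simp)] with ω hω hbdd
  obtain ⟨c, hc⟩ := hω.1 hbdd
  have h1 : Tendsto (fun n => |f (n + 1) ω - f n ω|) atTop (𝓝 |c - c|) :=
    ((hc.comp (tendsto_add_atTop_nat 1)).sub hc).abs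
  simp only [habs, sub_self, abs_zero] at h1
  exact zero_ne_one (tendsto_nhds_unique h1 tendsto_const_nhds)

end ConditionalProbability

/-- A sequence of nonnegative variables with summable means converges to zero almost surely. -/
theorem ae_tendsto_zero_of_sum_integral_le {Ω : Type*} {mΩ : MeasurableSpace Ω}
    {μ : Measure Ω} {Y : ℕ → Ω → ℝ} (hY : ∀ n, Integrable (Y n) μ)
    (h0 : ∀ n, 0 ≤ᵐ[μ] Y n) {B : ℝ} (hB : ∀ n, ∑ i ∈ Finset.range n, ∫ ω, Y i ω ∂μ ≤ B) :
    ∀ᵐ ω ∂μ, Tendsto (fun n => Y n ω) atTop (𝓝 0) := by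
  have hsum : Summable fun n => ∫ ω, Y n ω ∂μ :=
    summable_of_sum_range_le (fun n => integral_nonneg_of_ae (h0 n)) hB
  -- By Tonelli the series itself has finite mean, hence is finite almost surely and its terms
  -- vanish in the limit.
  have hlt : ∫⁻ ω, ∑' n, ENNReal.ofReal (Y n ω) ∂μ ≠ ⊤ := by
    rw [lintegral_tsum fun n => (hY n).aestronglyMeasurable.aemeasurable.ennreal_ofReal]
    simp_rw [← ofReal_integral_eq_lintegral_ofReal (hY _) (h0 _)]
    exact hsum.tsum_ofReal_ne_top
  have hae := ae_lt_top' (AEMeasurable.tsum fun n =>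
    (hY n).aestronglyMeasurable.aemeasurable.ennreal_ofReal) hlt
  filter_upwards [hae, ae_all_iff.2 h0] with ω hω h0ω
  have h1 := ENNReal.tendsto_atTop_zero_of_tsum_ne_top hω.ne
  have h2 := (ENNReal.tendsto_toReal ENNReal.zero_ne_top).comp h1
  refine h2.congr fun n => ?_
  exact ENNReal.toReal_ofReal (h0ω n)

theorem indicator_sq_eq {Ω : Type*} (s : Set Ω) (X : Ω → ℝ) :
    (fun ω => s.indicator X ω ^ 2) = s.indicator fun ω => X ω ^ 2 := by
  funext ω
  by_cases h : ω ∈ s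
  · simp only [Set.indicator_of_mem h]
  · simp only [Set.indicator_of_notMem h]; ring

/-! ### The trust-region radius tends to zero. -/

section Convergence

variable {d m : ℕ} {P : Problem d m} {A : Params d} {D : Set (Vec d)} {C : Consts}
  {Ω : Type*} {run : Ω → Path d m}

/-- The merit parameter is constant during iterations `K, …, K + i`, and `x_K` and this parameter
are bounded by `N`. -/
def stableSet (run : Ω → Path d m) (K N i : ℕ) : Set Ω :=
  {ω | ‖(run ω).x K‖ ≤ N ∧ (run ω).mu K ≤ N ∧ ∀ j ≤ i, (run ω).mu (K + j) = (run ω).mu K}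

theorem excessErr_eq (k : ℕ) (ω : Ω) : (run ω).excessErr P A k =
    (eventC P A run k)ᶜ.indicator ((trialSet P A run k).indicator (errK P run k)) ω +
    (eventC P A run k)ᶜ.indicator ((trialSet P A run k).indicator (errS P run k)) ω +
    (eventC' P A run k)ᶜ.indicator ((socSet P A run k).indicator (errSoc P run k)) ω := by
  unfold Path.excessErr
  congr 1
  · by_cases h : ω ∈ eventC P A run k
    · have hn : ω ∉ (eventC P A run k)ᶜ := fun hc => hc h
      rw [Set.indicator_of_notMem hn, Set.indicator_of_notMem hn, add_zero]
      exact if_pos h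
    · have hn : ω ∈ (eventC P A run k)ᶜ := h
      have ht : ω ∈ trialSet P A run k := by
        by_contra hc
        exact h fun ha => absurd ha hc
      rw [Set.indicator_of_mem hn, Set.indicator_of_mem hn, Set.indicator_of_mem ht,
        Set.indicator_of_mem ht]
      exact if_neg h
  · by_cases h : ω ∈ eventC' P A run k
    · have hn : ω ∉ (eventC' P A run k)ᶜ := fun hc => hc h
      rw [Set.indicator_of_notMem hn]
      exact if_pos h
    · have hn : ω ∈ (eventC' P A run k)ᶜ := h
      have ht : ω ∈ socSet P A run k := by
        by_contra hc
        exact h fun ha => absurd ha hc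
      rw [Set.indicator_of_mem hn, Set.indicator_of_mem ht]
      exact if_neg h

variable [mΩ : MeasurableSpace Ω] {Pr : Measure Ω} {ℱ : Filtration ℕ mΩ}
  {𝒢 : ℕ → MeasurableSpace Ω}

/-- The updated parameter is known in the middle of iteration `j`, and as the starting value of
iteration `j + 1` ever after. Hence `stableSet` is measurable for the same `σ`-algebra that
conditions the function errors. -/
theorem RandomModels.mu_measurable (hM : RandomModels P A run Pr ℱ 𝒢) {j k : ℕ} (hjk : j ≤ k) :
    Measurable[𝒢 k] fun ω => (run ω).mu j := by
  rcases hjk.eq_or_lt with rfl | h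
  · exact (hM.mu_meas j).measurable
  · exact ((hM.muStart_meas (j + 1)).measurable).mono ((ℱ.mono h).trans (hM.le_mid k)) le_rfl

theorem RandomModels.measurableSet_stableSet (hM : RandomModels P A run Pr ℱ 𝒢) (K N i : ℕ) :
    MeasurableSet[𝒢 (K + i)] (stableSet run K N i) := by
  have hx : StronglyMeasurable[𝒢 (K + i)] fun ω => (run ω).x K :=
    (hM.x_meas K).mono ((ℱ.mono (Nat.le_add_right K i)).trans (hM.le_mid _))
  have h1 : MeasurableSet[𝒢 (K + i)] {ω | ‖(run ω).x K‖ ≤ N} :=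
    hx.norm.measurable measurableSet_Iic
  have h2 : MeasurableSet[𝒢 (K + i)] {ω | (run ω).mu K ≤ N} :=
    hM.mu_measurable (Nat.le_add_right K i) measurableSet_Iic
  have h3 : MeasurableSet[𝒢 (K + i)]
      (⋂ j : ℕ, ⋂ _ : j ≤ i, {ω | (run ω).mu (K + j) = (run ω).mu K}) := by
    refine MeasurableSet.iInter fun j => MeasurableSet.iInter fun hj => ?_
    exact measurableSet_eq_fun (m := 𝒢 (K + i)) (hM.mu_measurable (Nat.add_le_add_left hj K))
      (hM.mu_measurable (Nat.le_add_right K i))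
  convert h1.inter (h2.inter h3) using 1
  ext ω
  simp [stableSet]

/-- The mean of the excess error over a `𝒢 k`-measurable event is at most `3 √p_f` times the mean
of the reliability parameter. -/
theorem RandomModels.integral_excessErr_le [IsProbabilityMeasure Pr]
    (hM : RandomModels P A run Pr ℱ 𝒢) (hA : A.Valid)
    (hrun : ∀ᵐ ω ∂Pr, (run ω).IsRun P A) (k : ℕ) {Z : Set Ω} (hZ : MeasurableSet[𝒢 k] Z) :
    Integrable (Z.indicator fun ω => (run ω).excessErr P A k) Pr ∧
      ∫ ω, Z.indicator (fun ω => (run ω).excessErr P A k) ω ∂Pr ≤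
        3 * √A.pf * ∫ ω, Z.indicator (fun ω => (run ω).ε k) ω ∂Pr := by
  have hm := hM.mid_le k
  have hε : StronglyMeasurable[𝒢 k] fun ω => (run ω).ε k := (hM.ε_meas k).mono (hM.le_mid k)
  have ha : 0 < A.ε0 / A.γ ^ k := div_pos hA.ε0_pos (pow_pos hA.γ_pos k)
  have hab : ∀ᵐ ω ∂Pr, A.ε0 / A.γ ^ k ≤ (run ω).ε k ∧ (run ω).ε k ≤ A.ε0 * A.γ ^ k := by
    filter_upwards [hrun] with ω h using h.ε_mem hA k
  obtain ⟨hp0, hp1⟩ := hA.pf_mem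
  set X₁ := (trialSet P A run k).indicator (errK P run k)
  set X₂ := (trialSet P A run k).indicator (errS P run k)
  set X₃ := (socSet P A run k).indicator (errSoc P run k)
  have n₁ : ∀ ω, 0 ≤ X₁ ω := fun ω => Set.indicator_apply_nonneg fun _ => abs_nonneg _
  have n₂ : ∀ ω, 0 ≤ X₂ ω := fun ω => Set.indicator_apply_nonneg fun _ => abs_nonneg _
  have n₃ : ∀ ω, 0 ≤ X₃ ω := fun ω => Set.indicator_apply_nonneg fun _ => abs_nonneg _
  have s₁ : Integrable (fun ω => X₁ ω ^ 2) Pr := by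
    rw [indicator_sq_eq]; exact hM.integrable_errK k
  have s₂ : Integrable (fun ω => X₂ ω ^ 2) Pr := by
    rw [indicator_sq_eq]; exact hM.integrable_errS k
  have s₃ : Integrable (fun ω => X₃ ω ^ 2) Pr := by
    rw [indicator_sq_eq]; exact hM.integrable_errSoc k
  have hC := hM.prob_C k
  have hC' := hM.prob_C' k
  have l₁ := integral_indicator_compl_indicator_le hm hZ hε ha hab hp0 hp1 hC n₁ s₁
    (by rw [indicator_sq_eq]; exact hM.moment_errK k)
  have l₂ := integral_indicator_compl_indicator_le hm hZ hε ha hab hp0 hp1 hC n₂ s₂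
    (by rw [indicator_sq_eq]; exact hM.moment_errS k)
  have l₃ := integral_indicator_compl_indicator_le hm hZ hε ha hab hp0 hp1 hC' n₃ s₃
    (by rw [indicator_sq_eq]; exact hM.moment_errSoc k)
  have iC := integrable_indicator_of_le_condExp hp1 hC
  have iC' := integrable_indicator_of_le_condExp hp1 hC'
  have i₁ := (integrable_compl_indicator_of_sq iC n₁ s₁).indicator (hm _ hZ)
  have i₂ := (integrable_compl_indicator_of_sq iC n₂ s₂).indicator (hm _ hZ)
  have i₃ := (integrable_compl_indicator_of_sq iC' n₃ s₃).indicator (hm _ hZ)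
  have heq : (Z.indicator fun ω => (run ω).excessErr P A k) = fun ω =>
      Z.indicator ((eventC P A run k)ᶜ.indicator X₁) ω +
      Z.indicator ((eventC P A run k)ᶜ.indicator X₂) ω +
      Z.indicator ((eventC' P A run k)ᶜ.indicator X₃) ω := by
    funext ω
    by_cases hω : ω ∈ Z
    · simp only [Set.indicator_of_mem hω]
      exact excessErr_eq k ω
    · simp only [Set.indicator_of_notMem hω, add_zero]
  rw [heq]
  refine ⟨(i₁.add i₂).add i₃, ?_⟩
  have e₁ := integral_add (i₁.add i₂) i₃
  have e₂ := integral_add i₁ i₂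
  simp only [Pi.add_apply] at e₁ e₂
  rw [e₁, e₂]
  linarith

/-- On bounded sets the potential function is bounded. -/
theorem exists_potential_le (hA : A.Valid) (hC : C.Valid) (hP : Smooth P D C) (h0 : A.x0 ∈ D)
    {β : ℝ} (hβ : 0 ≤ β) (K N : ℕ) : ∃ B : ℝ, 0 ≤ B ∧ ∀ R : Path d m, R.IsRun P A →
      BoundedAlong P A D C R → ‖R.x K‖ ≤ N → R.mu K ≤ N → R.potential P A C β K (R.mu K) ≤ B := by
  have hκc := hC.κc_pos
  have hLf := hC.Lf_nonneg
  have hε0 := hA.ε0_pos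
  have hγ := hA.γ_pos
  have hΔm := hA.Δmax_pos
  refine ⟨|P.f A.x0 - C.finf| + ‖P.grad A.x0‖ * (N + ‖A.x0‖) + C.Lf * (N + ‖A.x0‖) ^ 2 +
    N * C.κc + β / 4 * A.Δmax ^ (A.α + 2) + β * (A.ε0 * A.γ ^ K), by positivity,
    fun R hR hb hx hmu => ?_⟩
  have hs : ‖R.x K - A.x0‖ ≤ N + ‖A.x0‖ := (norm_sub_le _ _).trans (by gcongr)
  -- No upper bound on `f` along the iterates is given; expansion about the deterministic `x0`
  -- together with `‖x_K‖ ≤ N` provides one.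
  have h1 := hP.taylor_f hC h0 (s := R.x K - A.x0) (by
    rw [add_sub_cancel]; exact hb.x_mem K)
  rw [add_sub_cancel] at h1
  have h2 := (abs_le.1 h1).2
  have h3 : inner ℝ (P.grad A.x0) (R.x K - A.x0) ≤ ‖P.grad A.x0‖ * (N + ‖A.x0‖) :=
    (real_inner_le_norm _ _).trans (by gcongr)
  have h4 : C.Lf * ‖R.x K - A.x0‖ ^ 2 ≤ C.Lf * (N + ‖A.x0‖) ^ 2 := by gcongr
  have h5 : R.mu K * ‖R.cv P K‖ ≤ N * C.κc :=
    mul_le_mul hmu (hb.c_bdd K) (norm_nonneg _) (Nat.cast_nonneg _)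
  have hΔ := hR.Δ_mem hA K
  have h6 : β / 4 * R.Δ K ^ (A.α + 2) ≤ β / 4 * A.Δmax ^ (A.α + 2) := by
    have := hΔ.1.le
    gcongr
    exact hΔ.2
  have h7 : β * R.ε K ≤ β * (A.ε0 * A.γ ^ K) := by gcongr; exact (hR.ε_mem hA K).2
  have h8 := le_abs_self (P.f A.x0 - C.finf)
  unfold Path.potential
  linarith

theorem tendsto_zero_of_tendsto_pow_zero {u : ℕ → ℝ} (h0 : ∀ n, 0 ≤ u n) {p : ℕ} (hp : p ≠ 0)
    (h : Tendsto (fun n => u n ^ p) atTop (𝓝 0)) : Tendsto u atTop (𝓝 0) := by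
  have h1 : (0 : ℝ) < (p : ℝ)⁻¹ := by positivity
  have h2 := h.rpow_const (p := (p : ℝ)⁻¹) (Or.inr h1.le)
  rw [Real.zero_rpow h1.ne'] at h2
  refine h2.congr fun n => ?_
  exact Real.pow_rpow_inv_natCast (h0 n) hp

/-- The trust-region radius converges to zero almost surely. -/
theorem ae_tendsto_radius_zero [IsProbabilityMeasure Pr] (hA : A.Valid) (hC : C.Valid)
    (hP : Smooth P D C) (hrun : ∀ᵐ ω ∂Pr, (run ω).IsRun P A)
    (hbdd : ∀ᵐ ω ∂Pr, BoundedAlong P A D C (run ω))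
    (hmerit : ∀ᵐ ω ∂Pr, MeritStabilizes C (run ω)) (hM : RandomModels P A run Pr ℱ 𝒢)
    {β : ℝ} (hβ : 0 < β) (hγβ : 2 * A.γ * β ≤ A.η)
    (hMβ : 4 * A.γ ^ 3 * max 1 A.Δmax * β ≤ A.η ^ 3 * A.κfcd)
    (hp : 3 * √A.pf ≤ β * (1 - 1 / A.γ)) :
    ∀ᵐ ω ∂Pr, Tendsto (fun k => (run ω).Δ k) atTop (𝓝 0) := by
  have hx0 : A.x0 ∈ D := by
    obtain ⟨ω, h1, h2⟩ := (hrun.and hbdd).exists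
    have := h2.x_mem 0
    rwa [h1.x_zero] at this
  have hγ1 : 0 < 1 - 1 / A.γ := sub_pos.2 ((div_lt_one hA.γ_pos).2 hA.γ_gt)
  -- Deterministic `K` and `N` replace the random stabilisation time and the random size of the
  -- starting potential; countably many pairs suffice.
  have key : ∀ K N : ℕ, ∀ᵐ ω ∂Pr, Tendsto (fun i => (stableSet run K N i).indicator
      (fun ω => (1 - 1 / A.γ) * (β / 4 * (run ω).Δ (K + i) ^ (A.α + 2))) ω) atTop (𝓝 0) := by
    intro K N
    obtain ⟨B, hB0, hB⟩ := exists_potential_le (P := P) (D := D) hA hC hP hx0 hβ.le K N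
    have hZ : ∀ i, MeasurableSet (stableSet run K N i) := fun i =>
      hM.mid_le _ _ (hM.measurableSet_stableSet K N i)
    have iΔ : ∀ k, Integrable (fun ω => (1 - 1 / A.γ) * (β / 4 * (run ω).Δ k ^ (A.α + 2))) Pr := by
      intro k
      have hmeas : AEStronglyMeasurable (fun ω => (run ω).Δ k ^ (A.α + 2)) Pr :=
        (((hM.Δ_meas k).mono (ℱ.le k)).pow _).aestronglyMeasurable
      refine (Integrable.const_mul ?_ _).const_mul _
      refine (integrable_const (A.Δmax ^ (A.α + 2))).mono' hmeas ?_
      filter_upwards [hrun] with ω h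
      have := h.Δ_mem hA k
      have h0 := this.1.le
      rw [Real.norm_of_nonneg (by positivity)]
      gcongr
      exact this.2
    have iε : ∀ k, Integrable (fun ω => (run ω).ε k) Pr := by
      intro k
      refine (integrable_const (A.ε0 * A.γ ^ k)).mono'
        ((hM.ε_meas k).mono (ℱ.le k)).aestronglyMeasurable ?_
      filter_upwards [hrun] with ω h
      rw [Real.norm_of_nonneg (h.ε_pos hA k).le]
      exact (h.ε_mem hA k).2
    have jΔ := fun i => (iΔ (K + i)).indicator (hZ i)
    have jε := fun i => (iε (K + i)).indicator (hZ i)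
    have hex := fun i => hM.integral_excessErr_le hA hrun (K + i)
      (hM.measurableSet_stableSet K N i)
    refine ae_tendsto_zero_of_sum_integral_le jΔ (fun i => ?_) (B := B) fun n => ?_
    · filter_upwards [hrun] with ω h
      have := (h.Δ_mem hA (K + i)).1
      exact Set.indicator_apply_nonneg fun _ => by positivity
    set F : ℕ → Ω → ℝ := fun i ω =>
      (stableSet run K N i).indicator
          (fun ω => (1 - 1 / A.γ) * (β / 4 * (run ω).Δ (K + i) ^ (A.α + 2))) ω +
        β * (1 - 1 / A.γ) * (stableSet run K N i).indicator (fun ω => (run ω).ε (K + i)) ω -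
        (stableSet run K N i).indicator (fun ω => (run ω).excessErr P A (K + i)) ω
    have hFi : ∀ i, Integrable (F i) Pr := fun i =>
      ((jΔ i).add ((jε i).const_mul _)).sub (hex i).1
    have hFle : ∀ᵐ ω ∂Pr, ∑ i ∈ Finset.range n, F i ω ≤ B := by
      filter_upwards [hrun, hbdd] with ω hR hb
      induction n with
      | zero => simpa using hB0
      | succ n ih =>
        -- The sets decrease with their last index. A path still inside at `n` was inside before and
        -- telescopes; once outside, it contributes nothing further.
        by_cases hω : ω ∈ stableSet run K N n
        · have hmem : ∀ i ∈ Finset.range (n + 1), ω ∈ stableSet run K N i := fun i hi =>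
            ⟨hω.1, hω.2.1, fun j hj =>
              hω.2.2 j (hj.trans (Nat.lt_succ_iff.1 (Finset.mem_range.1 hi)))⟩
          have h1 := hR.sum_decrease_le hA hP hb hβ.le hγβ hMβ K (n + 1)
            fun i hi => hω.2.2 i (Nat.lt_succ_iff.1 hi)
          refine le_trans (le_of_eq (Finset.sum_congr rfl fun i hi => ?_))
            (h1.trans (hB _ hR hb hω.1 hω.2.1))
          simp only [F, Set.indicator_of_mem (hmem i hi)]
          ring
        · rw [Finset.sum_range_succ]
          have : F n ω = 0 := by
            simp only [F, Set.indicator_of_notMem hω]; ring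
          rw [this, add_zero]
          exact ih
    have hint : ∑ i ∈ Finset.range n, ∫ ω, F i ω ∂Pr ≤ B := by
      rw [← integral_finsetSum _ fun i _ => hFi i]
      calc ∫ ω, ∑ i ∈ Finset.range n, F i ω ∂Pr ≤ ∫ _, B ∂Pr :=
            integral_mono_ae (integrable_finsetSum _ fun i _ => hFi i) (integrable_const B) hFle
        _ = B := by simp
    refine le_trans (Finset.sum_le_sum fun i _ => ?_) hint
    have hsplit : ∫ ω, F i ω ∂Pr =
        ∫ ω, (stableSet run K N i).indicator
          (fun ω => (1 - 1 / A.γ) * (β / 4 * (run ω).Δ (K + i) ^ (A.α + 2))) ω ∂Pr +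
        β * (1 - 1 / A.γ) *
          ∫ ω, (stableSet run K N i).indicator (fun ω => (run ω).ε (K + i)) ω ∂Pr -
        ∫ ω, (stableSet run K N i).indicator (fun ω => (run ω).excessErr P A (K + i)) ω ∂Pr := by
      have e₁ := integral_sub ((jΔ i).add ((jε i).const_mul (β * (1 - 1 / A.γ)))) (hex i).1
      have e₂ := integral_add (jΔ i) ((jε i).const_mul (β * (1 - 1 / A.γ)))
      simp only [Pi.add_apply] at e₁ e₂
      rw [e₂, integral_const_mul] at e₁
      exact e₁
    have hε0 : 0 ≤ ∫ ω, (stableSet run K N i).indicator (fun ω => (run ω).ε (K + i)) ω ∂Pr := by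
      refine integral_nonneg_of_ae ?_
      filter_upwards [hrun] with ω h
      exact Set.indicator_apply_nonneg fun _ => (h.ε_pos hA _).le
    -- The reliability term of the decrease dominates the mean excess error, leaving the radius term
    -- alone.
    have := mul_le_mul_of_nonneg_right hp hε0
    have := (hex i).2
    rw [hsplit]
    linarith
  filter_upwards [ae_all_iff.2 fun K => ae_all_iff.2 (key K), hrun, hmerit] with ω hω hR hst
  obtain ⟨K, hK⟩ := hst
  obtain ⟨N, hN⟩ := exists_nat_ge (max ‖(run ω).x K‖ ((run ω).mu K))
  obtain ⟨hN1, hN2⟩ := max_le_iff.1 hN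
  have hmem : ∀ i, ω ∈ stableSet run K N i := fun i =>
    ⟨hN1, hN2, fun j _ => (hK (K + j) (Nat.le_add_right K j)).1⟩
  have h1 := hω K N
  simp only [Set.indicator_of_mem (hmem _)] at h1
  have h2 := h1.const_mul ((1 - 1 / A.γ) * (β / 4))⁻¹
  rw [mul_zero] at h2
  have h3 : Tendsto (fun i => (run ω).Δ (K + i) ^ (A.α + 2)) atTop (𝓝 0) := by
    refine h2.congr fun i => ?_
    field_simp
  have h4 := tendsto_zero_of_tendsto_pow_zero (fun i => (hR.Δ_mem hA (K + i)).1.le)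
    (by omega) h3
  refine (tendsto_add_atTop_iff_nat K).1 (h4.congr fun i => ?_)
  rw [add_comm]

end Convergence

/-! ### Comparison with a random walk and recurrence to stationarity. -/

section Recurrence

variable {d m : ℕ} {P : Problem d m} {A : Params d} {D : Set (Vec d)} {C : Consts}
  {Ω : Type*} {run : Ω → Path d m}

/-- The radius increases in iteration `k`, the merit parameter increases in iteration `k`, or `x_k`
lies outside `U`, or the radius is at least `δ`, or the merit parameter exceeds `muHat`. -/
def advanceSet (A : Params d) (C : Consts) (run : Ω → Path d m) (U : Set (Vec d)) (δ : ℝ) (k : ℕ) :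
    Set Ω :=
  {ω | min (A.γ * (run ω).Δ k) A.Δmax ≤ (run ω).Δ (k + 1)} ∪
    {ω | (run ω).muStart A (k + 1) = (run ω).muStart A k}ᶜ ∪
    ({ω | (run ω).x k ∈ U} ∩ {ω | (run ω).Δ k < δ} ∩ {ω | (run ω).muStart A k ≤ C.muHat})ᶜ

/-- The walk that counts the advancing iterations with weight `1` and the others with weight `-1`
is bounded above along a path that eventually stays in `U` with a small radius. -/
theorem bddAbove_walk {ω : Ω} (hR : (run ω).IsRun P A) (hA : A.Valid)
    (hmu : MeritStabilizes C (run ω)) {U : Set (Vec d)} {δ : ℝ} (hδ : 0 < δ)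
    (hU : ∀ᶠ k in atTop, (run ω).x k ∈ U)
    (hΔ : Tendsto (fun k => (run ω).Δ k) atTop (𝓝 0)) :
    BddAbove (Set.range fun n : ℕ => ∑ i ∈ Finset.range n,
      (2 * (advanceSet A C run U δ i).indicator (fun _ => (1 : ℝ)) ω - 1)) := by
  set W : ℕ → ℝ := fun n => ∑ i ∈ Finset.range n,
      (2 * (advanceSet A C run U δ i).indicator (fun _ => (1 : ℝ)) ω - 1)
  have hγ := hA.γ_pos
  have hlog : 0 < Real.log A.γ := Real.log_pos hA.γ_gt
  obtain ⟨K, hK⟩ := hmu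
  -- Below `Δmax / γ` the cap on the radius is inactive, so an advance multiplies the radius by at
  -- least `γ`. The later start at `K + 1` ensures that `muStart k`, the previous `mu`, has also
  -- settled.
  have hsmall : ∀ᶠ k in atTop, (run ω).Δ k < min δ (A.Δmax / A.γ) :=
    hΔ.eventually (gt_mem_nhds (lt_min hδ (div_pos hA.Δmax_pos hγ)))
  obtain ⟨k₀, hk₀⟩ := eventually_atTop.1 ((hU.and hsmall).and (eventually_ge_atTop (K + 1)))
  have hstep : ∀ n, W (n + 1) =
      W n + (2 * (advanceSet A C run U δ n).indicator (fun _ => (1 : ℝ)) ω - 1) := fun n => by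
    simp only [W, Finset.sum_range_succ]
  have hgrow : ∀ k, k₀ ≤ k → Real.log ((run ω).Δ k) + Real.log A.γ *
      (2 * (advanceSet A C run U δ k).indicator (fun _ => (1 : ℝ)) ω - 1) ≤
        Real.log ((run ω).Δ (k + 1)) := by
    intro k hk
    obtain ⟨⟨hx, hd⟩, hKk⟩ := hk₀ k hk
    obtain ⟨hd₁, hd₂⟩ := lt_min_iff.1 hd
    have h0 := (hR.Δ_mem hA k).1
    by_cases hω : ω ∈ advanceSet A C run U δ k
    · rw [Set.indicator_of_mem hω]
      obtain ⟨j, rfl⟩ : ∃ j, k = j + 1 := ⟨k - 1, by omega⟩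
      have hmk : (run ω).mu (j + 1) = (run ω).mu j :=
        (hK _ (by omega)).1.trans (hK _ (by omega)).1.symm
      have hmh : (run ω).mu j ≤ C.muHat := by
        have := hK j (by omega)
        rw [this.1]; exact this.2
      have hinc : min (A.γ * (run ω).Δ (j + 1)) A.Δmax ≤ (run ω).Δ (j + 1 + 1) := by
        rcases hω with (h | h) | h
        · exact h
        · exact absurd hmk h
        · exact absurd ⟨⟨hx, hd₁⟩, hmh⟩ h
      rw [lt_div_iff₀ hγ, mul_comm] at hd₂
      rw [min_eq_left hd₂.le] at hinc
      have h1 := Real.log_le_log (mul_pos hγ h0) hinc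
      rw [Real.log_mul hγ.ne' h0.ne'] at h1
      linarith
    · rw [Set.indicator_of_notMem hω]
      have h1 := Real.log_le_log (div_pos h0 hγ) (hR.Δ_div_le hA k)
      rw [Real.log_div h0.ne' hγ.ne'] at h1
      linarith
  -- `log Δ - log γ · W` is nondecreasing from `k₀` on, so the upper bound on `Δ` bounds `W` above.
  have hmono : ∀ n, k₀ ≤ n → Real.log ((run ω).Δ k₀) - Real.log A.γ * W k₀ ≤
      Real.log ((run ω).Δ n) - Real.log A.γ * W n := by
    intro n hn
    induction n, hn using Nat.le_induction with
    | base => exact le_rfl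
    | succ n hn ih =>
      have := hgrow n hn
      rw [hstep, mul_add]
      linarith
  refine Filter.IsBoundedUnder.bddAbove_range ⟨(Real.log A.Δmax -
    (Real.log ((run ω).Δ k₀) - Real.log A.γ * W k₀)) / Real.log A.γ, ?_⟩
  rw [eventually_map]
  filter_upwards [eventually_ge_atTop k₀] with n hn
  rw [le_div_iff₀ hlog]
  obtain ⟨h1, h2⟩ := hR.Δ_mem hA n
  have := Real.log_le_log h1 h2
  have := hmono n hn
  linarith

variable [mΩ : MeasurableSpace Ω] {Pr : Measure Ω} {ℱ : Filtration ℕ mΩ}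
  {𝒢 : ℕ → MeasurableSpace Ω}

theorem RandomModels.measurableSet_advanceSet (hM : RandomModels P A run Pr ℱ 𝒢)
    {U : Set (Vec d)} (hU : MeasurableSet U) (δ : ℝ) (k : ℕ) :
    MeasurableSet[ℱ (k + 1)] (advanceSet A C run U δ k) := by
  have hle : ℱ k ≤ ℱ (k + 1) := ℱ.mono (Nat.le_succ k)
  have hΔ : Measurable[ℱ (k + 1)] fun ω => (run ω).Δ k := (hM.Δ_meas k).measurable.mono hle le_rfl
  have hmu : Measurable[ℱ (k + 1)] fun ω => (run ω).muStart A k :=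
    (hM.muStart_meas k).measurable.mono hle le_rfl
  have hx : Measurable[ℱ (k + 1)] fun ω => (run ω).x k :=
    (hM.x_meas k).measurable.mono hle le_rfl
  have h1 : MeasurableSet[ℱ (k + 1)]
      {ω | min (A.γ * (run ω).Δ k) A.Δmax ≤ (run ω).Δ (k + 1)} :=
    measurableSet_le (mδ := ℱ (k + 1)) ((hΔ.const_mul A.γ).min measurable_const)
      (hM.Δ_meas (k + 1)).measurable
  have h2 : MeasurableSet[ℱ (k + 1)]
      {ω | (run ω).muStart A (k + 1) = (run ω).muStart A k} :=
    measurableSet_eq_fun (m := ℱ (k + 1)) (hM.muStart_meas (k + 1)).measurable hmu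
  exact (h1.union h2.compl).union
    (((hx hU).inter (hΔ measurableSet_Iio)).inter (hmu measurableSet_Iic)).compl

/-- The iterates leave, infinitely often, every set in which accurate iterations with a small
radius succeed. -/
theorem ae_not_eventually_mem [IsProbabilityMeasure Pr] (hA : A.Valid)
    (hrun : ∀ᵐ ω ∂Pr, (run ω).IsRun P A)
    (hbdd : ∀ᵐ ω ∂Pr, BoundedAlong P A D C (run ω))
    (hmerit : ∀ᵐ ω ∂Pr, MeritStabilizes C (run ω)) (hM : RandomModels P A run Pr ℱ 𝒢)
    (hΔ : ∀ᵐ ω ∂Pr, Tendsto (fun k => (run ω).Δ k) atTop (𝓝 0))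
    (hp : A.ph + A.pg + A.pf + A.pf ≤ 1 / 2) {U : Set (Vec d)} (hU : MeasurableSet U) {δ : ℝ}
    (hδ : 0 < δ)
    (hsucc : ∀ (R : Path d m) (k : ℕ), R.IsRun P A → BoundedAlong P A D C R →
      R.Accurate P A k → R.mu k ≤ C.muHat → R.Δ k < δ → R.x k ∈ U → R.Success P A k) :
    ∀ᵐ ω ∂Pr, ¬ ∀ᶠ k in atTop, (run ω).x k ∈ U := by
  have hcond : ∀ k, ∀ᵐ ω ∂Pr, 1 / 2 ≤
      (Pr[(advanceSet A C run U δ k).indicator (fun _ => (1 : ℝ)) | ℱ k]) ω := by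
    intro k
    -- For `α = 0` the Hessian event is the whole space, so the same union bound over four events
    -- covers both orders.
    have hprobA : ∀ᵐ ω ∂Pr, 1 - A.ph ≤
        (Pr[{ω | A.α = 1 → ω ∈ eventA P A run k}.indicator (fun _ => (1 : ℝ)) | ℱ k]) ω := by
      by_cases hα : A.α = 1
      · have heq : {ω | A.α = 1 → ω ∈ eventA P A run k} = eventA P A run k :=
          Set.ext fun ω => ⟨fun h => h hα, fun h _ => h⟩
        rw [heq]
        exact hM.prob_A hα k
      · have huniv : {ω | A.α = 1 → ω ∈ eventA P A run k} = Set.univ :=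
          Set.eq_univ_of_forall fun ω h => absurd h hα
        rw [huniv, Set.indicator_univ, condExp_const (ℱ.le k)]
        have := hA.ph_mem.1
        exact Eventually.of_forall fun _ => by linarith
    have h := le_condExp_indicator_of_inter_subset (ℱ.le k) hA.ph_mem.2 hA.pg_mem.2 hA.pf_mem.2
      hA.pf_mem.2 hprobA (hM.prob_B k)
      (le_condExp_of_le_condExp (hM.le_mid k) (hM.mid_le k) (hM.prob_C k))
      (le_condExp_of_le_condExp (hM.le_mid k) (hM.mid_le k) (hM.prob_C' k))
      (ℱ.le (k + 1) _ (hM.measurableSet_advanceSet (C := C) hU δ k)) (by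
        filter_upwards [hrun, hbdd] with ω hR hb e₁ e₂ e₃ e₄
        by_cases hT : ω ∈ {ω | (run ω).x k ∈ U} ∩ {ω | (run ω).Δ k < δ} ∩
            {ω | (run ω).muStart A k ≤ C.muHat}
        · by_cases hmu : (run ω).muStart A (k + 1) = (run ω).muStart A k
          · obtain ⟨⟨hx, hd⟩, hm⟩ := hT
            have hmuk : (run ω).mu k ≤ C.muHat := le_of_eq_of_le hmu hm
            have hs := hsucc (run ω) k hR hb ⟨e₁, e₂, e₃, e₄⟩ hmuk hd hx
            exact Or.inl (Or.inl (hR.Δ_success k hs).ge)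
          · exact Or.inl (Or.inr hmu)
        · exact Or.inr hT)
    filter_upwards [h] with ω hω
    linarith
  filter_upwards [ae_not_bddAbove_walk
    (fun k => hM.measurableSet_advanceSet (C := C) hU δ k) hcond, hrun, hmerit, hΔ]
    with ω hnot hR hmu hΔω hev
  exact hnot (bddAbove_walk hR hA hmu hδ hev hΔω)

/-- A positive lower limit would exceed some `1/(n+1)`, so countably many thresholds, and hence
countably many null sets, are enough. -/
theorem liminf_coe_eq_zero {u : ℕ → ℝ} (h0 : ∀ k, 0 ≤ u k)
    (h : ∀ n : ℕ, ¬ ∀ᶠ k in atTop, 1 / ((n : ℝ) + 1) < u k) :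
    liminf (fun k => ((u k : ℝ) : EReal)) atTop = 0 := by
  refine le_antisymm ?_ ?_
  · by_contra hc
    push Not at hc
    obtain ⟨q, hq0, hq⟩ := EReal.lt_iff_exists_real_btwn.1 hc
    obtain ⟨n, hn⟩ := exists_nat_one_div_lt (EReal.coe_pos.1 hq0)
    refine h n ?_
    filter_upwards [eventually_lt_of_lt_liminf hq] with k hk
    exact hn.trans (EReal.coe_lt_coe_iff.1 hk)
  · exact le_liminf_of_le (by isBoundedDefault)
      (Eventually.of_forall fun k => EReal.coe_nonneg.2 (h0 k))

end Recurrence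

end TRSQP

/-! ### Global convergence. -/

theorem mainTheorem1 {d m : ℕ} (P : TRSQP.Problem d m) (A : TRSQP.Params d) (C : TRSQP.Consts)
    (D : Set (TRSQP.Vec d)) (hA : A.Valid) (hC : C.Valid) (hP : TRSQP.Smooth P D C)
    {Ω : Type*} [mΩ : MeasurableSpace Ω] (Pr : Measure Ω) [IsProbabilityMeasure Pr]
    (ℱ : Filtration ℕ mΩ) (𝒢 : ℕ → MeasurableSpace Ω) (run : Ω → TRSQP.Path d m)
    (hrun : ∀ᵐ ω ∂Pr, (run ω).IsRun P A)
    (hbdd : ∀ᵐ ω ∂Pr, TRSQP.BoundedAlong P A D C (run ω))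
    (hmerit : ∀ᵐ ω ∂Pr, TRSQP.MeritStabilizes C (run ω))
    (hmodel : TRSQP.RandomModels P A run Pr ℱ 𝒢)
    (ν : ℝ) (hν : ν ∈ Set.Ioo (0 : ℝ) 1) (hνc : TRSQP.NuCondition A m C ν)
    (hp : A.ph + A.pg + 2 * A.pf ≤ (1 - ν) ^ 2 / (16 * ν ^ 2) * (1 - 1 / A.γ) ^ 2) :
    (∀ᵐ ω ∂Pr, liminf (fun k => (((run ω).kkt P k : ℝ) : EReal)) atTop = 0) ∧
      (A.α = 1 → ∀ᵐ ω ∂Pr, liminf (fun k => (((run ω).tauPlus P k : ℝ) : EReal)) atTop = 0) := by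
  have hβ : 0 < (1 - ν) / ν := div_pos (sub_pos.2 hν.2) hν.1
  obtain ⟨hγβ, hMβ⟩ := hνc.weights hA hC hν
  have hp' : A.ph + A.pg + 2 * A.pf ≤ ((1 - ν) / ν) ^ 2 / 16 * (1 - 1 / A.γ) ^ 2 := by
    rwa [div_pow, div_div, mul_comm (ν ^ 2)]
  obtain ⟨hpf, hphalf⟩ := TRSQP.probability_bounds hA hβ.le hγβ hp'
  have hΔ := TRSQP.ae_tendsto_radius_zero hA hC hP hrun hbdd hmerit hmodel hβ hγβ hMβ hpf
  constructor
  · have key : ∀ n : ℕ, ∀ᵐ ω ∂Pr,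
        ¬ ∀ᶠ k in atTop, (run ω).x k ∈ TRSQP.kktSet P D (1 / ((n : ℝ) + 1)) := by
      intro n
      obtain ⟨δ, hδ, hs⟩ := TRSQP.Path.exists_radius_success_of_kkt (P := P) (A := A) (D := D)
        hP hA hC (ε := 1 / ((n : ℝ) + 1)) (by positivity)
      exact TRSQP.ae_not_eventually_mem hA hrun hbdd hmerit hmodel hΔ hphalf
        (hP.isOpen_kktSet _).measurableSet hδ
        fun R k hR hb hacc hmu hd hx => hs R k hR hb hacc hmu hd hx.2
    filter_upwards [ae_all_iff.2 key, hbdd] with ω hω hb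
    refine TRSQP.liminf_coe_eq_zero (fun k => TRSQP.pairNorm_nonneg _ _) fun n hev => hω n ?_
    filter_upwards [hev] with k hk
    exact ⟨⟨hb.x_mem k, (hb.gramBounds hC k).isInvertible⟩, hk⟩
  · intro hα
    have key : ∀ n : ℕ, ∀ᵐ ω ∂Pr,
        ¬ ∀ᶠ k in atTop, (run ω).x k ∈ TRSQP.curvatureSet P D (1 / ((n : ℝ) + 1)) := by
      intro n
      obtain ⟨δ, hδ, hs⟩ := TRSQP.Path.exists_radius_success_of_curvature (P := P) (A := A) (D := D)
        hP hA hC hα (ε := 1 / ((n : ℝ) + 1)) (by positivity)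
      exact TRSQP.ae_not_eventually_mem hA hrun hbdd hmerit hmodel hΔ hphalf
        (hP.isOpen_curvatureSet _).measurableSet hδ
        fun R k hR hb hacc hmu hd hx => hs R k hR hb hacc hmu hd hx.2
    filter_upwards [ae_all_iff.2 key, hbdd] with ω hω hb
    refine TRSQP.liminf_coe_eq_zero (fun k => TRSQP.negPart_nonneg _) fun n hev => hω n ?_
    filter_upwards [hev] with k hk
    -- The eigenvalue bound is traded for a direction of negative curvature, so recurrence is
    -- applied to the open set `curvatureSet`.
    have hn : (0 : ℝ) ≤ 1 / ((n : ℝ) + 1) := by positivity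
    exact ⟨⟨hb.x_mem k, (hb.gramBounds hC k).isInvertible⟩,
      TRSQP.exists_curvature_of_minEig_lt hn ((TRSQP.lt_negPart_iff hn).1 hk)⟩
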